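/- Let $n\ge 1$, $V=\mathbb{R}^{2n+2}$, $V_{\mathbb{C}}=V\otimes\mathbb{C}$, and let $S^{2n+1}\to X$ be a smooth fibration of the sphere by oriented great circles with base a smooth $2n$-manifold $X$: a smooth submersion whose fiber over $x\in X$ is the great circle cut out by an oriented 2-plane of $V$, again denoted $x$, the orientations varying continuously with $x$. *The osculating complex structure $J_x$.* A frame $g=(e_0,\dots,e_{2n+1})$ of $V$ lies over $x$ if $(e_0,e_1)$ is an oriented basis of $x$; let $B_1$ be the set of all frames lying over points of $X$, and $\omega=g^{-1}dg$. Let $J_0e_{2P}=e_{2P+1}$, $J_0e_{2P+1}=-e_{2P}$ and let $K_0$ exchange $e_{2P}$ and $e_{2P+1}$. Write $\omega=\Omega^{1,0}+\Omega^{0,1}K_0$ with $\Omega^{1,0},\Omega^{0,1}$ commuting with $J_0$, hence complex $(n+1)\times(n+1)$ matrices $(\Omega^P_Q)$ and $(\Omega^P_{\bar Q})$, $0\le P,Q\le n$. Let $i,j$ run over $2,\dots,2n+1$ and $p,q,r$ over $1,\dots,n$. 1. On $B_1$ one has $\omega^i_1=\sum_j t^i_j\omega^j_0$ for a unique real matrix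 $t$, which has no real eigenvalue. Let $B_2\subset B_1$ be the set of frames at which the complex structure of $\mathbb{R}^{2n}$ acting as $\sqrt{-1}$ on the generalized eigenspaces of $t$ with eigenvalues of positive imaginary part is the standard one. 2. On $B_2$, $\Omega^p_{\bar 0}=\sum_q s^p_q\Omega^q_0$ for a unique complex matrix $s$. Let $B_3=\{\operatorname{tr}s=0\}\subset B_2$. 3. On $B_3$, $\Omega^0_{\bar 0}=\sum_r s^0_r\Omega^r_0+\sum_r s^0_{\bar r}\overline{\Omega^r_0}$. Let $B=\{s^0_{\bar r}=0 \text{ for all } r\}\subset B_3$. Then $J_x=gJ_0g^{-1}$ for any $g\in B$ lying over $x$. This complex structure on $V$ exists for every $x\in X$ and does not depend on $g$; it leaves the plane $x$ invariant. **Statement.** For every $x\in X$ the set $\sigma(x)=\{v-\sqrt{-1}\,J_xv : v\in x\}$ is a complex line in $V_{\mathbb{C}}$, and the Sato map $\sigma:X\to\mathbb{CP}(V_{\mathbb{C}})=\mathbb{CP}^{2n+1}$ has the following properties. (a) $\sigma$ is a smooth embedding, and its image lies in $\mathbb{CP}(V_{\mathbb{C}})\setminus\mathbb{RP}(V)$.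 (b) $\sigma$ is $\mathrm{SL}(V)$-equivariant: for $g\in\mathrm{SL}(V)$ the planes $gx$, $x\in X$, are again the planes of such a great circle fibration, whose Sato map carries $gx$ to $g\,\sigma(x)$. (c) Let $\mathcal{O}(-1)_X$ be the complex line bundle over $X$ whose fiber over $x$ is the plane $x$ with the complex structure $J_x|_x$, and let $\mathcal{O}(-1)$ be the tautological line bundle of $\mathbb{CP}(V_{\mathbb{C}})$. The map $v\in x\mapsto v-\sqrt{-1}\,J_xv$ is an isomorphism of smooth complex line bundles $\mathcal{O}(-1)_X\cong\sigma^*\mathcal{O}(-1)$. (d) The image of $\sigma$ determines the fibration: if the Sato maps of two such fibrations $S^{2n+1}\to X$ and $S^{2n+1}\to X'$ have the same image, then there is a diffeomorphism $X\to X'$ that commutes with the two projections and preserves the oriented planes. -/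

import Mathlib

open Set Filter Topology Module Manifold
open scoped ContDiff LinearAlgebra.Projectivization Kronecker

/-! ### Complex projective space as a smooth manifold -/

/-- Complex projective space `ℂPᵐ`: the complex lines in `ℂᵐ⁺¹`. -/
abbrev CP (m : ℕ) : Type := ℙ ℂ (Fin (m + 1) → ℂ)

namespace CP

variable {m : ℕ}

/-- The quotient topology of `ℂᵐ⁺¹ ∖ 0`. -/
noncomputable instance : TopologicalSpace (CP m) :=
  TopologicalSpace.coinduced (Projectivization.mk' ℂ) inferInstance

lemma isQuotientMap_mk' :
    IsQuotientMap (Projectivization.mk' ℂ : {v : Fin (m + 1) → ℂ // v ≠ 0} → CP m) :=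
  ⟨⟨rfl⟩, fun L => ⟨⟨L.rep, L.rep_nonzero⟩, L.mk_rep⟩⟩

/-- The inhomogeneous coordinates `(z_j / z_i)_{j ≠ i}`. -/
noncomputable def affine (i : Fin (m + 1)) (L : CP m) : Fin m → ℂ :=
  fun j => L.rep (i.succAbove j) / L.rep i

lemma rep_mk (v : Fin (m + 1) → ℂ) (hv : v ≠ 0) :
    ∃ a : ℂ, a ≠ 0 ∧ (Projectivization.mk ℂ v hv).rep = a • v := by
  obtain ⟨a, ha⟩ := Projectivization.exists_smul_eq_mk_rep ℂ v hv
  exact ⟨a, a.ne_zero, ha.symm⟩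

lemma rep_mk_ne_zero_iff (i : Fin (m + 1)) (v : Fin (m + 1) → ℂ) (hv : v ≠ 0) :
    (Projectivization.mk ℂ v hv).rep i ≠ 0 ↔ v i ≠ 0 := by
  obtain ⟨a, ha, h⟩ := rep_mk v hv
  simp [h, ha]

lemma affine_mk (i : Fin (m + 1)) (v : Fin (m + 1) → ℂ) (hv : v ≠ 0) :
    affine i (Projectivization.mk ℂ v hv) = fun j => v (i.succAbove j) / v i := by
  obtain ⟨a, ha, h⟩ := rep_mk v hv
  funext j
  simp only [affine, h, Pi.smul_apply, smul_eq_mul]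
  exact mul_div_mul_left _ _ ha

lemma insertNth_ne_zero (i : Fin (m + 1)) (w : Fin m → ℂ) :
    (i.insertNth (1 : ℂ) w : Fin (m + 1) → ℂ) ≠ 0 := by
  intro h
  have := congrFun h i
  simp at this

/-- The point with homogeneous coordinates `w`, with a `1` inserted in the `i`-th place. -/
noncomputable def ofAffine (i : Fin (m + 1)) (w : Fin m → ℂ) : CP m :=
  Projectivization.mk ℂ (i.insertNth (1 : ℂ) w) (insertNth_ne_zero i w)

lemma contDiff_insertNth (i : Fin (m + 1)) :
    ContDiff ℝ ∞ (fun w : Fin m → ℂ => (i.insertNth (1 : ℂ) w : Fin (m + 1) → ℂ)) := by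
  rw [contDiff_pi]
  intro k
  refine Fin.succAboveCases i ?_ (fun j => ?_) k
  · simpa using contDiff_const
  · simpa using contDiff_apply ℝ ℂ j

/-- The standard affine chart `{z_i ≠ 0} ≃ ℂᵐ`. -/
noncomputable def chart (i : Fin (m + 1)) : OpenPartialHomeomorph (CP m) (Fin m → ℂ) where
  toFun := affine i
  invFun := ofAffine i
  source := {L | L.rep i ≠ 0}
  target := univ
  map_source' _ _ := mem_univ _
  map_target' w _ := by
    simp only [ofAffine, mem_ofPred_eq, rep_mk_ne_zero_iff]
    simp
  left_inv' L hL := by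
    have hL' : L.rep i ≠ 0 := hL
    conv_rhs => rw [← L.mk_rep]
    rw [ofAffine, Projectivization.mk_eq_mk_iff']
    refine ⟨(L.rep i)⁻¹, ?_⟩
    funext k
    refine Fin.succAboveCases i ?_ (fun j => ?_) k
    · simp [hL']
    · simp [affine, div_eq_inv_mul]
  right_inv' w _ := by
    rw [ofAffine, affine_mk]
    funext j
    simp
  open_source := by
    rw [← isQuotientMap_mk'.isOpen_preimage]
    have : (Projectivization.mk' ℂ : {v : Fin (m + 1) → ℂ // v ≠ 0} → CP m) ⁻¹'
        {L | L.rep i ≠ 0} = {v | v.1 i ≠ 0} := by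
      ext v
      exact rep_mk_ne_zero_iff i v.1 v.2
    rw [this]
    exact isOpen_ne_fun ((continuous_apply i).comp continuous_subtype_val) continuous_const
  open_target := isOpen_univ
  continuousOn_toFun := by
    have ho : IsOpen {L : CP m | L.rep i ≠ 0} := by
      rw [← isQuotientMap_mk'.isOpen_preimage]
      have : (Projectivization.mk' ℂ : {v : Fin (m + 1) → ℂ // v ≠ 0} → CP m) ⁻¹'
          {L | L.rep i ≠ 0} = {v | v.1 i ≠ 0} := by
        ext v
        exact rep_mk_ne_zero_iff i v.1 v.2
      rw [this]
      exact isOpen_ne_fun ((continuous_apply i).comp continuous_subtype_val) continuous_const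
    rw [isQuotientMap_mk'.continuousOn_isOpen_iff ho]
    have : (affine i ∘ Projectivization.mk' ℂ : {v : Fin (m + 1) → ℂ // v ≠ 0} → Fin m → ℂ) =
        fun v => fun j => v.1 (i.succAbove j) / v.1 i := by
      funext v
      exact affine_mk i v.1 v.2
    rw [this]
    refine continuousOn_pi.2 fun j => ContinuousOn.div ?_ ?_ ?_
    · exact ((continuous_apply _).comp continuous_subtype_val).continuousOn
    · exact ((continuous_apply _).comp continuous_subtype_val).continuousOn
    · intro v hv
      exact (rep_mk_ne_zero_iff i v.1 v.2).1 hv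
  continuousOn_invFun := by
    refine Continuous.continuousOn ?_
    exact isQuotientMap_mk'.continuous.comp
      (Continuous.subtype_mk (contDiff_insertNth i).continuous (insertNth_ne_zero i))

lemma exists_rep_ne_zero (L : CP m) : ∃ i, L.rep i ≠ 0 := by
  by_contra! h
  exact L.rep_nonzero (funext h)

noncomputable instance : ChartedSpace (Fin m → ℂ) (CP m) where
  atlas := range chart
  chartAt L := chart (exists_rep_ne_zero L).choose
  mem_chart_source L := (exists_rep_ne_zero L).choose_spec
  chart_mem_atlas _ := mem_range_self _

instance : IsManifold 𝓘(ℝ, Fin m → ℂ) ∞ (CP m) := by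
  refine isManifold_of_contDiffOn _ _ _ ?_
  rintro _ _ ⟨i, rfl⟩ ⟨j, rfl⟩
  have key : ContDiffOn ℝ ∞ (fun w : Fin m → ℂ => fun k =>
      (i.insertNth (1 : ℂ) w : Fin (m + 1) → ℂ) (j.succAbove k) /
        (i.insertNth (1 : ℂ) w : Fin (m + 1) → ℂ) j)
      {w | (i.insertNth (1 : ℂ) w : Fin (m + 1) → ℂ) j ≠ 0} := by
    have hc : ∀ l, ContDiff ℝ ∞
        (fun w : Fin m → ℂ => (i.insertNth (1 : ℂ) w : Fin (m + 1) → ℂ) l) :=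
      contDiff_pi.1 (contDiff_insertNth i)
    refine contDiffOn_pi.2 fun k => ?_
    simp only [div_eq_mul_inv]
    exact (hc _).contDiffOn.mul ((hc _).contDiffOn.inv fun w hw => hw)
  refine (key.congr ?_).mono ?_
  · intro w _
    exact affine_mk j _ _
  · rintro w hw
    simp only [modelWithCornersSelf_coe, modelWithCornersSelf_coe_symm, mfld_simps] at hw
    exact (rep_mk_ne_zero_iff j _ _).1 hw.2

end CP

/-! ### Oriented planes and great circle fibrations -/

namespace GreatCircle

/-- The real vector space `V = ℝ²ⁿ⁺²`. -/
abbrev V (n : ℕ) : Type := EuclideanSpace ℝ (Fin (2 * n + 1 + 1))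

/-- Its complexification `V ⊗ ℂ = ℂ²ⁿ⁺²`. -/
abbrev VC (n : ℕ) : Type := Fin (2 * n + 1 + 1) → ℂ

/-- The unit sphere `S²ⁿ⁺¹ ⊂ V`. -/
abbrev S (n : ℕ) : Type := Metric.sphere (0 : V n) 1

/-- A point of the Grassmannian of oriented 2-planes in `V`. -/
@[ext]
structure OrientedPlane (n : ℕ) where
  carrier : Submodule ℝ (V n)
  finrank_eq : finrank ℝ carrier = 2
  orientation : Orientation ℝ carrier (Fin 2)

namespace OrientedPlane

variable {n : ℕ}

/-- `(u, v)` is a positively oriented basis of the oriented plane `P`. -/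
def IsPositiveFrame (P : OrientedPlane n) (u v : V n) : Prop :=
  ∃ b : Basis (Fin 2) ℝ P.carrier,
    (b 0 : V n) = u ∧ (b 1 : V n) = v ∧ b.orientation = P.orientation

/-- The image of an oriented plane under an invertible linear map. -/
noncomputable def map (g : V n ≃ₗ[ℝ] V n) (P : OrientedPlane n) : OrientedPlane n where
  carrier := P.carrier.map (g : V n →ₗ[ℝ] V n)
  finrank_eq := by
    rw [← (g.submoduleMap P.carrier).finrank_eq]
    exact P.finrank_eq
  orientation := Orientation.map (Fin 2) (g.submoduleMap P.carrier) P.orientation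

end OrientedPlane

/-- A smooth fibration of `S²ⁿ⁺¹` by oriented great circles with base manifold `X`: a smooth
submersion `proj` whose fiber over `x` is the great circle cut out by the 2-plane `plane x`,
these planes being oriented continuously. -/
structure Fibration (n : ℕ) (X : Type*) [TopologicalSpace X]
    [ChartedSpace (EuclideanSpace ℝ (Fin (2 * n))) X] where
  proj : S n → X
  isSubmersion_proj : IsSubmersion (𝓡 (2 * n + 1)) (𝓡 (2 * n)) ∞ proj
  plane : X → OrientedPlane n
  mem_plane_iff : ∀ (p : S n) (x : X), (p : V n) ∈ (plane x).carrier ↔ proj p = x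
  continuous_orientation : ∀ x₀ : X, ∃ U ∈ 𝓝 x₀, ∃ a b : X → V n,
    ContinuousOn a U ∧ ContinuousOn b U ∧ ∀ x ∈ U, (plane x).IsPositiveFrame (a x) (b x)

/-! ### Moving frames -/

/-- A linear frame `(e_0, …, e_{2n+1})` of `V`; the index `(P, ε)` stands for `2 P + ε`. -/
abbrev Frame (n : ℕ) : Type := Basis (Fin (n + 1) × Fin 2) ℝ (V n)

/-- Real matrices in `2 × 2` blocks. -/
abbrev BlockMatrix (m : ℕ) : Type := Matrix (Fin m × Fin 2) (Fin m × Fin 2) ℝ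

/-- The values at `g` of the Maurer-Cartan form `ω = g⁻¹ dg` on the vectors tangent at `g` to the
set `B` of frames, that is, on the velocities at `g` of the smooth curves in `B`. -/
def maurerCartan {n : ℕ} (B : Set (Frame n)) (g : Frame n) : Set (BlockMatrix (n + 1)) :=
  {A | ∃ γ : ℝ → Frame n, γ 0 = g ∧ (∀ᶠ s in 𝓝 (0 : ℝ), γ s ∈ B) ∧
    ContDiffAt ℝ ∞ (fun s => (γ s : Fin (n + 1) × Fin 2 → V n)) 0 ∧
    A = fun a b => g.repr (deriv (fun s => γ s b) 0) a}

/-- The complex entries `Ω^P_Q` of `Ω^{1,0}`, where `ω = Ω^{1,0} + Ω^{0,1} K₀`, with `K₀` swapping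
`e_{2P}` and `e_{2P+1}`. -/
noncomputable def Omega {m : ℕ} (A : BlockMatrix m) (P Q : Fin m) : ℂ :=
  ⟨(A (P, 0) (Q, 0) + A (P, 1) (Q, 1)) / 2, (A (P, 1) (Q, 0) - A (P, 0) (Q, 1)) / 2⟩

/-- The complex entries `Ω^P_{Q̄}` of `Ω^{0,1}`. -/
noncomputable def OmegaBar {m : ℕ} (A : BlockMatrix m) (P Q : Fin m) : ℂ :=
  ⟨(A (P, 1) (Q, 0) + A (P, 0) (Q, 1)) / 2, (A (P, 1) (Q, 1) - A (P, 0) (Q, 0)) / 2⟩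

/-- The standard complex structure `J₀`, with `J₀ e_{2P} = e_{2P+1}`, `J₀ e_{2P+1} = -e_{2P}`. -/
def stdJ (m : ℕ) : BlockMatrix m := (1 : Matrix (Fin m) (Fin m) ℝ) ⊗ₖ !![0, -1; 1, 0]

/-- `T` has no real eigenvalue and `J = J_T`: the real matrix `J` acts as `i` on the generalized
eigenspaces of `T` in `ℂ²ᵐ` whose eigenvalue has positive imaginary part (hence as `-i` on the
conjugate ones). -/
def IsAssociatedComplexStructure {m : ℕ} (T J : BlockMatrix m) : Prop :=
  (∀ r : ℝ, ¬ End.HasEigenvalue (Matrix.toLin' T) r) ∧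
  ∀ μ : ℂ, 0 < μ.im →
    ∀ z ∈ End.maxGenEigenspace (Matrix.toLin' (T.map ((↑) : ℝ → ℂ))) μ,
      (J.map ((↑) : ℝ → ℂ)).mulVec z = Complex.I • z

section

variable {n : ℕ} {X : Type*} [TopologicalSpace X]
  [ChartedSpace (EuclideanSpace ℝ (Fin (2 * n))) X]

namespace Fibration

/-- The frames for which `(e_0, e_1)` is an oriented basis of a plane of the fibration. -/
def frames₁ (F : Fibration n X) : Set (Frame n) :=
  {g | ∃ x, (F.plane x).IsPositiveFrame (g (0, 0)) (g (0, 1))}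

/-- `t` is the value at `g` of the invariant defined by `ω^i_1 = t^i_j ω^j_0`, where
`i, j = 2, …, 2n+1`. -/
def IsT (F : Fibration n X) (g : Frame n) (t : BlockMatrix n) : Prop :=
  ∀ A ∈ maurerCartan F.frames₁ g, ∀ i : Fin n × Fin 2,
    A (i.1.succ, i.2) (0, 1) = ∑ j : Fin n × Fin 2, t i j * A (j.1.succ, j.2) (0, 0)

/-- The frames normalized by `J_t = J₀`. -/
def frames₂ (F : Fibration n X) : Set (Frame n) :=
  {g | g ∈ F.frames₁ ∧ ∃ t, F.IsT g t ∧ IsAssociatedComplexStructure t (stdJ n)}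

/-- `s` is the value at `g` of the invariant defined by `Ω^p_{0̄} = s^p_q Ω^q_0`, where
`p, q = 1, …, n`. -/
def IsS (F : Fibration n X) (g : Frame n) (s : Matrix (Fin n) (Fin n) ℂ) : Prop :=
  ∀ A ∈ maurerCartan F.frames₂ g, ∀ p : Fin n,
    OmegaBar A p.succ 0 = ∑ q : Fin n, s p q * Omega A q.succ 0

/-- The frames normalized moreover by `s^p_p = 0`. -/
def frames₃ (F : Fibration n X) : Set (Frame n) :=
  {g | g ∈ F.frames₂ ∧ ∃ s, F.IsS g s ∧ s.trace = 0}

/-- The adapted frames: along `frames₃`, `Ω^0_{0̄} = s^0_r Ω^r_0 + s^0_{r̄} Ω^{r̄}_{0̄}`, where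
`Ω^{r̄}_{0̄}` is the conjugate of `Ω^r_0`, and the last normalization is `s^0_{r̄} = 0`. -/
def adaptedFrames (F : Fibration n X) : Set (Frame n) :=
  {g | g ∈ F.frames₃ ∧ ∃ s : Fin n → ℂ, ∀ A ∈ maurerCartan F.frames₃ g,
    OmegaBar A 0 0 = ∑ r : Fin n, s r * Omega A r.succ 0}

/-- `J` is the osculating complex structure of the fibration at `x`: it is `g J₀ g⁻¹` for an
adapted frame `g` over `x`. -/
def IsOsculating (F : Fibration n X) (x : X) (J : V n →ₗ[ℝ] V n) : Prop :=
  ∃ g ∈ F.adaptedFrames, (F.plane x).IsPositiveFrame (g (0, 0)) (g (0, 1)) ∧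
    ∀ P : Fin (n + 1), J (g (P, 0)) = g (P, 1) ∧ J (g (P, 1)) = -g (P, 0)

/-- The osculating complex structure `J_x`. -/
noncomputable def osculatingJ (F : Fibration n X) (x : X) : V n →ₗ[ℝ] V n :=
  Classical.epsilon (F.IsOsculating x)

end Fibration

/-! ### The Sato map -/

/-- The inclusion `V ⊂ V ⊗ ℂ`. -/
noncomputable def toVC : V n →ₗ[ℝ] VC n where
  toFun v := fun k => (v k : ℂ)
  map_add' v w := by
    funext k
    simp
  map_smul' c v := by
    funext k
    simp

/-- The complex linear extension to `V ⊗ ℂ` of a real linear map of `V`. -/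
noncomputable def complexify (g : V n →ₗ[ℝ] V n) : VC n →ₗ[ℂ] VC n :=
  Matrix.toLin' ((LinearMap.toMatrix (EuclideanSpace.basisFun _ ℝ).toBasis
    (EuclideanSpace.basisFun _ ℝ).toBasis g).map ((↑) : ℝ → ℂ))

lemma complexify_toVC (g : V n →ₗ[ℝ] V n) (v : V n) : complexify g (toVC v) = toVC (g v) := by
  have h := LinearMap.toMatrix_mulVec_repr (EuclideanSpace.basisFun (Fin (2 * n + 1 + 1)) ℝ).toBasis
    (EuclideanSpace.basisFun _ ℝ).toBasis g v
  funext k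
  have hk := congrArg (fun r : ℝ => (r : ℂ)) (congrFun h k)
  simpa [complexify, toVC, Matrix.mulVec, dotProduct] using hk

/-- The real points `ℝP(V) ⊂ ℂP(V ⊗ ℂ)`. -/
def realPoints (n : ℕ) : Set (CP (2 * n + 1)) :=
  {L | ∃ v : V n, v ≠ 0 ∧ toVC v ∈ L.submodule}

/-- The total space of the tautological bundle `O(-1)` of `ℂP(V ⊗ ℂ)`. -/
def tautological (n : ℕ) : Set (CP (2 * n + 1) × VC n) :=
  {q | q.2 ∈ q.1.submodule}

namespace Fibration

/-- The map `v ↦ v - i J_x v`. -/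
noncomputable def satoLift (F : Fibration n X) (x : X) : V n →ₗ[ℝ] VC n :=
  toVC - Complex.I • (toVC ∘ₗ F.osculatingJ x)

/-- The Sato map: `σ(x)` is the complex line `{v - i J_x v : v ∈ x}`. -/
noncomputable def sato (F : Fibration n X) (x : X) : CP (2 * n + 1) :=
  Classical.epsilon fun L : CP (2 * n + 1) =>
    (L.submodule : Set (VC n)) = F.satoLift x '' (F.plane x).carrier

/-- The total space of the bundle `O(-1)` of `X`, whose fiber over `x` is the plane `x`, with the
complex structure `J_x`. -/
def lineBundle (F : Fibration n X) : Set (X × V n) :=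
  {q | q.2 ∈ (F.plane q.1).carrier}

/-- `v ∈ x ↦ v - i J_x v` is an isomorphism of smooth complex line bundles over `X` from `O(-1)_X`
to the pullback by `σ` of `O(-1)` of `ℂP(V ⊗ ℂ)`. -/
structure PullsBackTautological (F : Fibration n X) : Prop where
  mapsTo_J : ∀ x, ∀ v ∈ (F.plane x).carrier, F.osculatingJ x v ∈ (F.plane x).carrier
  J_sq : ∀ x, ∀ v ∈ (F.plane x).carrier, F.osculatingJ x (F.osculatingJ x v) = -v
  complexLinear : ∀ x, ∀ v ∈ (F.plane x).carrier,
    F.satoLift x (F.osculatingJ x v) = Complex.I • F.satoLift x v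
  bijOn : BijOn (fun q : X × V n => (q.1, F.satoLift q.1 q.2)) F.lineBundle
    (Prod.map F.sato id ⁻¹' tautological n)
  smooth : ContMDiffOn ((𝓡 (2 * n)).prod 𝓘(ℝ, V n)) 𝓘(ℝ, VC n) ∞
    (fun q : X × V n => F.satoLift q.1 q.2) F.lineBundle
  smooth_inverse : ∃ Ψ : X × VC n → V n,
    (∀ q ∈ F.lineBundle, Ψ (q.1, F.satoLift q.1 q.2) = q.2) ∧
    ContMDiffOn ((𝓡 (2 * n)).prod 𝓘(ℝ, VC n)) 𝓘(ℝ, V n) ∞ Ψ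
      (Prod.map F.sato id ⁻¹' tautological n)

end Fibration

end

end GreatCircle

/-! Two frames over the same oriented plane differ by a parabolic matrix: a head block of positive
determinant, an invertible real tail block, and an arbitrary upper right block. Each of the three
normalisations can be achieved, smoothly along local sections of the frames. Together they force the
remaining parabolic matrices to commute with J₀, so that g J₀ g⁻¹ depends on the base point alone
(`frameJ_eq_of_adaptedFrames`).

The reason is a chain of three facts. (1) The vectors e₀ and e₁ follow the same moving plane, so
their transverse velocities determine each other: ω₁ = t ω₀. A real eigenvector of t would be a
motion of the plane under which some combination of e₀ and e₁ has no transverse velocity, which is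
impossible. Under a change of frame with head block (a, c; b, d) and tail block m, t becomes m⁻¹(c +
d t)(a + b t)⁻¹ m. A real matrix without real eigenvalues is similar to a complex matrix τ with
spectrum in the upper half-plane (`exists_conj_isAssociated`). A real matrix conjugating two such τ
is complex, because the Sylvester equation τX = Xτ̄' has only the zero solution
(`aPart_eq_zero_of_isAssociated`).

(2) The matrix s is i times the Cayley transform of τ, so tr s = 0 says that the conformal
barycenter of the eigenvalues of τ is i (`exists_isS_iff`). Barycenters exist, are unique, depend
smoothly on τ and follow Möbius maps. Hence the head block lies in the stabiliser of i, that is, it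
is complex (`parabolic_of_frames₃`).

(3) Along the frames so normalised, the form of index (0, 0̄) is a real linear function of the forms
Ω^r_0 (`exists_OmegaBar_eq`). The antilinear part of the upper right block shifts exactly the
antilinear coefficients of this function, so killing them removes the last obstruction to commuting
with J₀.

For the Sato map everything rests on v being the real part of v - iJv: the real part followed by the
projection to the base is a smooth local left inverse of σ. This gives injectivity, the topological
embedding, the immersion (`isImmersionAtOfComplement_of_leftInverse`) and the inverse bundle map.
The frame (v, Jv) is positive, so the line σ(x) also remembers the orientation. Equivariance follows
from the invariance of g⁻¹dg under linear maps and the uniqueness of J. -/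

namespace GreatCircle

/-! ### Implicit functions, and smoothness of matrix operations. -/

section Calculus

variable {E : Type*} [NormedAddCommGroup E] [NormedSpace ℝ E]

/-- The implicit function theorem, with the invertibility of the partial derivative tested on lines. -/
lemma exists_contDiffAt_implicit [CompleteSpace E] {A : Type*} [NormedAddCommGroup A]
    [NormedSpace ℝ A] [FiniteDimensional ℝ A] {G : E × A → A} {y₀ : E} {a₀ : A}
    (hG : ContDiffAt ℝ ∞ G (y₀, a₀)) (h0 : G (y₀, a₀) = 0)
    (hinj : ∀ a, HasDerivAt (fun s : ℝ => G (y₀, a₀ + s • a)) 0 0 → a = 0) :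
    ∃ φ : E → A, φ y₀ = a₀ ∧ ContDiffAt ℝ ∞ φ y₀ ∧ ∀ᶠ y in 𝓝 y₀, G (y, φ y) = 0 := by
  have := FiniteDimensional.complete ℝ A
  have hd : HasFDerivAt G (fderiv ℝ G (y₀, a₀)) (y₀, a₀) :=
    (hG.differentiableAt (by simp)).hasFDerivAt
  set L : A →L[ℝ] A := fderiv ℝ G (y₀, a₀) ∘L .inr ℝ E A with hL
  have hLinj : Function.Injective L := by
    refine (injective_iff_map_eq_zero L).2 fun a ha => hinj a ?_
    have h1 : HasDerivAt (fun s : ℝ => (y₀, a₀ + s • a)) ((0 : E), a) 0 := by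
      refine (hasDerivAt_const _ _).prodMk ?_
      simpa using ((hasDerivAt_id (0 : ℝ)).smul_const a).const_add a₀
    have h2 : HasFDerivAt G (fderiv ℝ G (y₀, a₀)) (y₀, a₀ + (0 : ℝ) • a) := by simpa using hd
    have := h2.comp_hasDerivAt (0 : ℝ) h1
    rwa [show fderiv ℝ G (y₀, a₀) ((0 : E), a) = 0 from ha] at this
  have hinv : L.IsInvertible :=
    ⟨(LinearEquiv.ofInjectiveEndo (L : A →ₗ[ℝ] A) hLinj).toContinuousLinearEquiv, by ext; rfl⟩
  refine ⟨hG.implicitFunction (by simp) hinv, hG.implicitFunction_apply_self _ _,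
    hG.contDiffAt_implicitFunction _ _, ?_⟩
  filter_upwards [hG.eventually_apply_implicitFunction (by simp) hinv] with y hy
  rw [hy, h0]

variable {𝕜 : Type*} [NormedField 𝕜] [NormedAlgebra ℝ 𝕜] {ι κ l : Type*}

lemma contDiffAt_matrix_mul [Fintype κ] {M : E → Matrix ι κ 𝕜} {N : E → Matrix κ l 𝕜} {y₀ : E}
    (hM : ∀ i j, ContDiffAt ℝ ∞ (fun y => M y i j) y₀)
    (hN : ∀ i j, ContDiffAt ℝ ∞ (fun y => N y i j) y₀) (i j) :
    ContDiffAt ℝ ∞ (fun y => (M y * N y) i j) y₀ := by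
  simp only [Matrix.mul_apply]
  exact ContDiffAt.sum fun k _ => (hM i k).mul (hN k j)

variable [Fintype ι] [DecidableEq ι]

lemma contDiffAt_matrix_det {M : E → Matrix ι ι 𝕜} {y₀ : E}
    (hM : ∀ i j, ContDiffAt ℝ ∞ (fun y => M y i j) y₀) :
    ContDiffAt ℝ ∞ (fun y => (M y).det) y₀ := by
  simp only [Matrix.det_apply]
  refine ContDiffAt.sum fun σ _ => ?_
  have : ContDiffAt ℝ ∞ (fun y => ∏ i, M y (σ i) i) y₀ :=
    contDiffAt_prod fun i _ => hM _ _
  rcases Int.units_eq_one_or (Equiv.Perm.sign σ) with h | h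
  · simpa [h] using this
  · simpa [h] using this.neg

lemma contDiffAt_matrix_inv {M : E → Matrix ι ι 𝕜} {y₀ : E}
    (hM : ∀ i j, ContDiffAt ℝ ∞ (fun y => M y i j) y₀) (h0 : (M y₀).det ≠ 0) (i j) :
    ContDiffAt ℝ ∞ (fun y => (M y)⁻¹ i j) y₀ := by
  simp only [Matrix.inv_def, Ring.inverse_eq_inv', Matrix.smul_apply, smul_eq_mul,
    Matrix.adjugate_apply]
  refine ((contDiffAt_matrix_det hM).inv h0).mul (contDiffAt_matrix_det fun a b => ?_)
  by_cases h : a = j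
  · subst h
    simpa using contDiffAt_const
  · simpa [Matrix.updateRow_ne h] using hM a b

lemma eventually_det_ne_zero {M : E → Matrix ι ι 𝕜} {y₀ : E}
    (hM : ∀ i j, ContDiffAt ℝ ∞ (fun y => M y i j) y₀) (h0 : (M y₀).det ≠ 0) :
    ∀ᶠ y in 𝓝 y₀, (M y).det ≠ 0 :=
  (contDiffAt_matrix_det hM).continuousAt.eventually_ne h0

end Calculus

/-! ### Conformal barycenters of spectra in the upper half-plane -/

section Barycenter

open Matrix ComplexConjugate

variable {m : ℕ}

/-- All eigenvalues lie in the upper half-plane. -/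
def UpperSpectrum (τ : Matrix (Fin m) (Fin m) ℂ) : Prop :=
  ∀ ζ : ℂ, ζ.im ≤ 0 → (τ - ζ • (1 : Matrix (Fin m) (Fin m) ℂ)).det ≠ 0

/-- `z` is the conformal barycenter, in the upper half-plane, of the eigenvalues of `τ`. -/
def IsBarycenter (τ : Matrix (Fin m) (Fin m) ℂ) (z : ℂ) : Prop :=
  0 < z.im ∧ (z - conj z) * (τ - conj z • (1 : Matrix (Fin m) (Fin m) ℂ))⁻¹.trace = m

/-- Listing the eigenvalues with multiplicity by `Fin m` lets traces of resolvents be written as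
sums over points of the half-plane. -/
lemma exists_det_sub_smul_one (τ : Matrix (Fin m) (Fin m) ℂ) :
    ∃ r : Fin m → ℂ, ∀ ζ : ℂ, (τ - ζ • (1 : Matrix (Fin m) (Fin m) ℂ)).det = ∏ i, (r i - ζ) := by
  have hcard : τ.charpoly.roots.toList.length = m := by
    rw [Multiset.length_toList, ← (IsAlgClosed.splits τ.charpoly).natDegree_eq_card_roots,
      Matrix.charpoly_natDegree_eq_dim, Fintype.card_fin]
  refine ⟨fun i => τ.charpoly.roots.toList.get (i.cast hcard.symm), fun ζ => ?_⟩
  have h1 : (τ - ζ • (1 : Matrix (Fin m) (Fin m) ℂ)).det = (-1) ^ m * τ.charpoly.eval ζ := by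
    rw [Matrix.eval_charpoly, ← neg_sub, Matrix.det_neg, Fintype.card_fin, Matrix.scalar_apply,
      Matrix.smul_one_eq_diagonal]
  have h2 := (IsAlgClosed.splits τ.charpoly).eval_eq_prod_roots_of_monic τ.charpoly_monic ζ
  have h3 : (τ.charpoly.roots.map fun a => ζ - a).prod =
      ∏ i : Fin m, (ζ - τ.charpoly.roots.toList.get (i.cast hcard.symm)) := by
    have aux : ∀ (l : List ℂ) (h : l.length = m),
        (l.map fun a => ζ - a).prod = ∏ i : Fin m, (ζ - l.get (i.cast h.symm)) := by
      rintro l rfl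
      exact (Fin.prod_univ_fun_getElem l fun a => ζ - a).symm
    conv_lhs => rw [← Multiset.coe_toList τ.charpoly.roots]
    rw [Multiset.map_coe, Multiset.prod_coe]
    exact aux _ hcard
  rw [h1, h2, h3]
  conv_lhs => rw [show (-1 : ℂ) ^ m = ∏ _i : Fin m, (-1 : ℂ) by simp]
  rw [← Finset.prod_mul_distrib]
  simp

lemma hasDerivAt_det_one_add_smul (M : Matrix (Fin m) (Fin m) ℂ) :
    HasDerivAt (fun s : ℂ => (1 + s • M).det) M.trace 0 := by
  have h := (Matrix.det (1 + (Polynomial.X : Polynomial ℂ) • M.map Polynomial.C)).hasDerivAt 0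
  rw [Matrix.derivative_det_one_add_X_smul] at h
  refine h.congr_of_eventuallyEq (Eventually.of_forall fun s => ?_)
  simp only [← Polynomial.coe_evalRingHom, RingHom.map_det]
  congr 1
  ext i j
  simp [Matrix.one_apply, apply_ite]
  ring

/-- Up to sign both sides are the logarithmic derivative of ζ ↦ det(τ - ζ): once from the derivative
of the determinant at the identity, once from the product over the eigenvalues. -/
lemma trace_inv_sub {τ : Matrix (Fin m) (Fin m) ℂ} {r : Fin m → ℂ}
    (hr : ∀ ζ : ℂ, (τ - ζ • (1 : Matrix (Fin m) (Fin m) ℂ)).det = ∏ i, (r i - ζ)) {ζ : ℂ}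
    (hζ : ∀ i, r i ≠ ζ) :
    (τ - ζ • (1 : Matrix (Fin m) (Fin m) ℂ))⁻¹.trace = ∑ i, (r i - ζ)⁻¹ := by
  set M := τ - ζ • (1 : Matrix (Fin m) (Fin m) ℂ) with hM
  have hprod : ∏ i, (r i - ζ) ≠ 0 := Finset.prod_ne_zero_iff.2 fun i _ => sub_ne_zero.2 (hζ i)
  have hdet : M.det ≠ 0 := by rw [hM, hr]; exact hprod
  have h1 : HasDerivAt (fun s : ℂ => M.det * (1 + (-s) • M⁻¹).det) (M.det * -M⁻¹.trace) 0 := by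
    refine HasDerivAt.const_mul _ ?_
    have h := hasDerivAt_det_one_add_smul M⁻¹
    rw [show (0 : ℂ) = -0 by simp] at h
    simpa [Function.comp_def] using h.scomp (0 : ℂ) (hasDerivAt_neg (0 : ℂ))
  have h2 : HasDerivAt (fun s : ℂ => ∏ i, (r i - ζ - s))
      (∑ i, (∏ j ∈ Finset.univ.erase i, (r j - ζ - 0)) • (-1 : ℂ)) 0 :=
    HasDerivAt.fun_finsetProd fun i _ => by
      simpa using (hasDerivAt_id (0 : ℂ)).const_sub (r i - ζ)
  have h3 : (fun s : ℂ => M.det * (1 + (-s) • M⁻¹).det) = fun s : ℂ => ∏ i, (r i - ζ - s) := by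
    funext s
    have : M * (1 + (-s) • M⁻¹) = τ - (ζ + s) • (1 : Matrix (Fin m) (Fin m) ℂ) := by
      rw [mul_add, mul_one, Matrix.mul_smul, Matrix.mul_nonsing_inv _ hdet.isUnit, hM, add_smul,
        neg_smul]
      abel
    rw [← Matrix.det_mul, this, hr]
    simp [sub_sub]
  rw [h3] at h1
  have h4 := h1.unique h2
  have h5 : ∑ i, (∏ j ∈ Finset.univ.erase i, (r j - ζ - 0)) • (-1 : ℂ) =
      M.det * -∑ i, (r i - ζ)⁻¹ := by
    rw [hM, hr, ← Finset.sum_neg_distrib, Finset.mul_sum]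
    refine Finset.sum_congr rfl fun i _ => ?_
    rw [← Finset.mul_prod_erase _ _ (Finset.mem_univ i)]
    have := sub_ne_zero.2 (hζ i)
    simp only [sub_zero, smul_eq_mul]
    field_simp
  rw [h5] at h4
  simpa using mul_left_cancel₀ hdet h4

lemma UpperSpectrum.root_im_pos {τ : Matrix (Fin m) (Fin m) ℂ} (hτ : UpperSpectrum τ)
    {r : Fin m → ℂ}
    (hr : ∀ ζ : ℂ, (τ - ζ • (1 : Matrix (Fin m) (Fin m) ℂ)).det = ∏ i, (r i - ζ)) (i : Fin m) :
    0 < (r i).im := by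
  by_contra! h
  refine hτ _ h ?_
  rw [hr]
  exact Finset.prod_eq_zero (Finset.mem_univ i) (sub_self _)

lemma ne_conj_of_im_pos {r z : ℂ} (hr : 0 < r.im) (hz : 0 < z.im) : r ≠ conj z := by
  intro h
  have := congrArg Complex.im h
  simp at this
  linarith

lemma isBarycenter_iff {τ : Matrix (Fin m) (Fin m) ℂ} (hτ : UpperSpectrum τ) {r : Fin m → ℂ}
    (hr : ∀ ζ : ℂ, (τ - ζ • (1 : Matrix (Fin m) (Fin m) ℂ)).det = ∏ i, (r i - ζ)) {z : ℂ}
    (hz : 0 < z.im) : IsBarycenter τ z ↔ (z - conj z) * ∑ i, (r i - conj z)⁻¹ = m := by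
  rw [IsBarycenter, trace_inv_sub hr fun i => ne_conj_of_im_pos (hτ.root_im_pos hr i) hz]
  simp [hz]

/-- Each summand is 1 - (z - z̄)/(rᵢ - z̄). Since r ↦ (r - z)/(r - z̄) maps the half-plane to the
unit disc and z to 0, the condition says that the images of the eigenvalues have centre of mass 0.
-/
lemma isBarycenter_iff_sum {τ : Matrix (Fin m) (Fin m) ℂ} (hτ : UpperSpectrum τ) {r : Fin m → ℂ}
    (hr : ∀ ζ : ℂ, (τ - ζ • (1 : Matrix (Fin m) (Fin m) ℂ)).det = ∏ i, (r i - ζ)) {z : ℂ}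
    (hz : 0 < z.im) : IsBarycenter τ z ↔ ∑ i, (r i - z) / (r i - conj z) = 0 := by
  rw [isBarycenter_iff hτ hr hz]
  have : ∑ i, (r i - z) / (r i - conj z) = m - (z - conj z) * ∑ i, (r i - conj z)⁻¹ := by
    rw [Finset.mul_sum, show (m : ℂ) = ∑ _i : Fin m, (1 : ℂ) by simp, ← Finset.sum_sub_distrib]
    refine Finset.sum_congr rfl fun i _ => ?_
    have := sub_ne_zero.2 (ne_conj_of_im_pos (hτ.root_im_pos hr i) hz)
    field_simp
    ring
  rw [this, sub_eq_zero, eq_comm]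

lemma norm_sub_div_sub_conj_lt_one {r z : ℂ} (hr : 0 < r.im) (hz : 0 < z.im) :
    ‖(r - z) / (r - conj z)‖ < 1 := by
  have h := sub_ne_zero.2 (ne_conj_of_im_pos hr hz)
  rw [norm_div, div_lt_one (norm_pos_iff.2 h), ← sq_lt_sq₀ (norm_nonneg _) (norm_nonneg _),
    ← Complex.normSq_eq_norm_sq, ← Complex.normSq_eq_norm_sq, Complex.normSq_apply,
    Complex.normSq_apply]
  simp
  nlinarith [mul_pos hr hz]

/-- With κ = x + iy, the real part of (ρ² - κ²)(1 - κ̄) is (ρ² - x²)(1 - x) + y²(1 + x). -/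
lemma re_div_one_sub_pos {κ : ℂ} {ρ : ℝ} (hκ : ‖κ‖ < ρ) (hρ : ρ < 1) :
    0 < (((ρ : ℂ) ^ 2 - κ ^ 2) / (1 - κ)).re := by
  have h0 : 0 ≤ ‖κ‖ := norm_nonneg κ
  have hne : (1 - κ) ≠ 0 := by
    intro h
    rw [sub_eq_zero] at h
    rw [← h] at hκ
    simp at hκ
    linarith
  have hsq : κ.re ^ 2 + κ.im ^ 2 < ρ ^ 2 := by
    have := Complex.normSq_eq_norm_sq κ
    rw [Complex.normSq_apply] at this
    nlinarith
  have hx : |κ.re| < ρ := (Complex.abs_re_le_norm κ).trans_lt hκ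
  obtain ⟨hx1, hx2⟩ := abs_lt.1 hx
  rw [Complex.div_re]
  have hpos := Complex.normSq_pos.2 hne
  rw [← add_div]
  refine div_pos ?_ hpos
  simp [pow_two]
  nlinarith [mul_pos (show 0 < ρ ^ 2 - κ.re ^ 2 by nlinarith [sq_nonneg κ.im]) (show 0 < 1 - κ.re by linarith),
    mul_nonneg (sq_nonneg κ.im) (show 0 ≤ 1 + κ.re by linarith)]

/-- Uniqueness of the barycenter in the disc. If w ≠ 0, multiply the difference of the two sums by
w̄: with κ = w̄l the summands become (|w|² - κ²)/(1 - κ), all of positive real part. -/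
lemma eq_zero_of_sum_moebius_eq_zero (hm : 0 < m) {l : Fin m → ℂ} (hl : ∀ i, ‖l i‖ < 1) {w : ℂ}
    (hw : ‖w‖ < 1) (h1 : ∑ i, l i = 0) (h2 : ∑ i, (l i - w) / (1 - conj w * l i) = 0) : w = 0 := by
  by_contra hne
  have hw0 : 0 < ‖w‖ := norm_pos_iff.2 hne
  have hk : ∀ i, ‖conj w * l i‖ < ‖w‖ := fun i => by
    rw [norm_mul, RCLike.norm_conj]
    nlinarith [hl i]
  have h3 : ∑ i, (((‖w‖ : ℝ) : ℂ) ^ 2 - (conj w * l i) ^ 2) / (1 - conj w * l i) = 0 := by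
    have : ∑ i, (((‖w‖ : ℝ) : ℂ) ^ 2 - (conj w * l i) ^ 2) / (1 - conj w * l i) =
        conj w * (∑ i, l i - ∑ i, (l i - w) / (1 - conj w * l i)) := by
      rw [← Finset.sum_sub_distrib, Finset.mul_sum]
      refine Finset.sum_congr rfl fun i _ => ?_
      have hne : (1 - conj w * l i) ≠ 0 := by
        intro h
        have := hk i
        rw [← sub_eq_zero.1 h, norm_one] at this
        linarith
      have hww : ((‖w‖ : ℝ) : ℂ) ^ 2 = conj w * w := by
        rw [mul_comm, Complex.mul_conj, Complex.normSq_eq_norm_sq]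
        norm_cast
      rw [hww]
      field_simp
      ring
    rw [this, h1, h2]
    simp
  have h4 := congrArg Complex.re h3
  rw [Complex.re_sum, Complex.zero_re] at h4
  have : 0 < ∑ i, ((((‖w‖ : ℝ) : ℂ) ^ 2 - (conj w * l i) ^ 2) / (1 - conj w * l i)).re :=
    Finset.sum_pos (fun i _ => re_div_one_sub_pos (hk i) hw) ⟨⟨0, hm⟩, Finset.mem_univ _⟩
  linarith

lemma IsBarycenter.unique (hm : 0 < m) {τ : Matrix (Fin m) (Fin m) ℂ} (hτ : UpperSpectrum τ)
    {z z' : ℂ} (h : IsBarycenter τ z) (h' : IsBarycenter τ z') : z' = z := by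
  obtain ⟨r, hr⟩ := exists_det_sub_smul_one τ
  have hz := h.1
  have hz' := h'.1
  rw [isBarycenter_iff_sum hτ hr hz] at h
  rw [isBarycenter_iff_sum hτ hr hz'] at h'
  have hpos := hτ.root_im_pos hr
  have hzz : z' - conj z ≠ 0 := sub_ne_zero.2 (ne_conj_of_im_pos hz' hz)
  have hzz2 : z - conj z' ≠ 0 := sub_ne_zero.2 (ne_conj_of_im_pos hz hz')
  have hzz3 : z - conj z ≠ 0 := sub_ne_zero.2 (ne_conj_of_im_pos hz hz)
  have key : (z' - z) / (z' - conj z) = 0 := by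
    refine eq_zero_of_sum_moebius_eq_zero hm
      (fun i => norm_sub_div_sub_conj_lt_one (hpos i) hz) (norm_sub_div_sub_conj_lt_one hz' hz) h ?_
    -- The disc automorphism taking the image of z' to 0, composed with the Cayley transform centred
    -- at z, is the Cayley transform centred at z' up to a constant of modulus 1.
    have : ∀ i, ((r i - z) / (r i - conj z) - (z' - z) / (z' - conj z)) /
        (1 - conj ((z' - z) / (z' - conj z)) * ((r i - z) / (r i - conj z))) =
        ((z - conj z') / (z' - conj z)) * ((r i - z') / (r i - conj z')) := fun i => by
      have h1 := sub_ne_zero.2 (ne_conj_of_im_pos (hpos i) hz)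
      have h2 := sub_ne_zero.2 (ne_conj_of_im_pos (hpos i) hz')
      have h3 : conj z' - z ≠ 0 := by rwa [← neg_sub, neg_ne_zero]
      have e1 : (r i - z) / (r i - conj z) - (z' - z) / (z' - conj z) =
          (r i - z') * (z - conj z) / ((r i - conj z) * (z' - conj z)) := by
        field_simp
        ring
      have e2 : 1 - conj ((z' - z) / (z' - conj z)) * ((r i - z) / (r i - conj z)) =
          (r i - conj z') * (z - conj z) / ((z - conj z') * (r i - conj z)) := by
        simp only [map_div₀, map_sub, Complex.conj_conj]
        rw [eq_div_iff (mul_ne_zero hzz2 h1)]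
        field_simp
        ring
      rw [e1, e2]
      field_simp
    simp only [this]
    rw [← Finset.mul_sum, h', mul_zero]
  rcases div_eq_zero_iff.1 key with h | h
  · exact sub_eq_zero.1 h
  · exact absurd h hzz

end Barycenter

end GreatCircle

namespace GreatCircle

/-! ### Existence and smooth dependence of the conformal barycenter. -/

section Barycenter

open Matrix ComplexConjugate

variable {m : ℕ}

/-- Twice the hyperbolic cosine-like distance `|u + i v - (a - i b)|² / b` of two points
`u + i v`, `a + i b` of the upper half-plane, up to the factor `v`. -/
noncomputable def halfPlaneDist (r : ℂ) (a b : ℝ) : ℝ := ((r.re - a) ^ 2 + (r.im + b) ^ 2) / b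

lemma le_halfPlaneDist {r : ℂ} {a b : ℝ} (hb : 0 < b) : 4 * r.im ≤ halfPlaneDist r a b := by
  rw [halfPlaneDist, le_div_iff₀ hb]
  nlinarith [sq_nonneg (r.im - b), sq_nonneg (r.re - a)]

lemma continuousOn_sum_log_halfPlaneDist {r : Fin m → ℂ} (hr : ∀ i, 0 < (r i).im) :
    ContinuousOn (fun q : ℝ × ℝ => ∑ i, Real.log (halfPlaneDist (r i) q.1 q.2)) {q | 0 < q.2} := by
  refine continuousOn_finsetSum _ fun i _ => ContinuousOn.log ?_ fun q hq => ?_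
  · unfold halfPlaneDist
    refine ContinuousOn.div (by fun_prop) (by fun_prop) fun q hq => ?_
    exact ne_of_gt hq
  · have := le_halfPlaneDist (r := r i) (a := q.1) (b := q.2) hq
    have := hr i
    exact ne_of_gt (by linarith)

/-- Every term is bounded below by log(4 Im rᵢ), so on a sublevel set the single term of index `i₀`
is bounded above. This confines (a, b) to a compact rectangle away from b = 0, where the continuous
sum has a minimum. -/
lemma exists_minimizer_sum_log_halfPlaneDist (hm : 0 < m) {r : Fin m → ℂ}
    (hr : ∀ i, 0 < (r i).im) :
    ∃ a b : ℝ, 0 < b ∧ ∀ a' b' : ℝ, 0 < b' →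
      ∑ i, Real.log (halfPlaneDist (r i) a b) ≤ ∑ i, Real.log (halfPlaneDist (r i) a' b') := by
  set Λ : ℝ × ℝ → ℝ := fun q => ∑ i, Real.log (halfPlaneDist (r i) q.1 q.2) with hΛ
  set i₀ : Fin m := ⟨0, hm⟩
  set c := Λ (0, 1) - ∑ i ∈ Finset.univ.erase i₀, Real.log (4 * (r i).im) with hc
  set C := Real.exp c with hC
  have hCpos : 0 < C := Real.exp_pos c
  set K : Set (ℝ × ℝ) := Icc ((r i₀).re - C) ((r i₀).re + C) ×ˢ Icc ((r i₀).im ^ 2 / C) C with hK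
  have hKc : IsCompact K := isCompact_Icc.prod isCompact_Icc
  have hKpos : ∀ q ∈ K, 0 < q.2 := fun q hq =>
    (div_pos (pow_pos (hr i₀) 2) hCpos).trans_le hq.2.1
  have hmem : ∀ a b : ℝ, 0 < b → Λ (a, b) ≤ Λ (0, 1) → (a, b) ∈ K := by
    intro a b hb hle
    have h1 : Real.log (halfPlaneDist (r i₀) a b) ≤ c := by
      have h2 : ∑ i ∈ Finset.univ.erase i₀, Real.log (4 * (r i).im) ≤
          ∑ i ∈ Finset.univ.erase i₀, Real.log (halfPlaneDist (r i) a b) :=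
        Finset.sum_le_sum fun i _ => Real.log_le_log (by linarith [hr i]) (le_halfPlaneDist hb)
      have h3 := Finset.add_sum_erase Finset.univ
        (fun i => Real.log (halfPlaneDist (r i) a b)) (Finset.mem_univ i₀)
      simp only [hΛ] at hle
      rw [hc]
      simp only [hΛ]
      linarith
    have hd : 0 < halfPlaneDist (r i₀) a b := by
      linarith [le_halfPlaneDist (r := r i₀) (a := a) hb, hr i₀]
    have h4 : halfPlaneDist (r i₀) a b ≤ C := by
      rw [← Real.exp_log hd]
      exact Real.exp_le_exp.2 h1
    rw [halfPlaneDist, div_le_iff₀ hb] at h4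
    have hv := hr i₀
    -- From (u - a)² + (v + b)² ≤ Cb with v > 0: b² ≤ Cb, then (u - a)² ≤ C², and v² ≤ Cb bounds b
    -- from below.
    have hbC : b ≤ C := by
      by_contra! h
      nlinarith [sq_nonneg ((r i₀).re - a), mul_pos hv hb]
    have habs : |(r i₀).re - a| ≤ C := by
      refine abs_le_of_sq_le_sq ?_ hCpos.le
      nlinarith [sq_nonneg ((r i₀).im + b)]
    have := abs_le.1 habs
    refine ⟨⟨by linarith, by linarith⟩, ?_, hbC⟩
    rw [div_le_iff₀ hCpos]
    nlinarith [sq_nonneg ((r i₀).re - a), mul_pos hv hb]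
  obtain ⟨q, hq, hmin⟩ := hKc.exists_isMinOn ⟨(0, 1), hmem 0 1 one_pos le_rfl⟩
    ((continuousOn_sum_log_halfPlaneDist hr).mono hKpos)
  refine ⟨q.1, q.2, hKpos q hq, fun a' b' hb' => ?_⟩
  have hmin' : ∀ q' ∈ K, Λ q ≤ Λ q' := isMinOn_iff.1 hmin
  change Λ q ≤ Λ (a', b')
  clear_value Λ K
  rcases le_total (Λ (a', b')) (Λ (0, 1)) with h | h
  · exact hmin' _ (hmem a' b' hb' h)
  · exact (hmin' _ (hmem 0 1 one_pos le_rfl)).trans h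

/-- The barycenter minimises the sum of the functions log(|r - z̄|²/Im z): the two equations for a
critical point are the real and imaginary parts of the equation ∑ (rᵢ - z̄)⁻¹ = m/(z - z̄). -/
lemma UpperSpectrum.exists_isBarycenter (hm : 0 < m) {τ : Matrix (Fin m) (Fin m) ℂ}
    (hτ : UpperSpectrum τ) : ∃ z, IsBarycenter τ z := by
  obtain ⟨r, hr⟩ := exists_det_sub_smul_one τ
  have hpos := hτ.root_im_pos hr
  obtain ⟨a, b, hb, hmin⟩ := exists_minimizer_sum_log_halfPlaneDist hm hpos
  set q : Fin m → ℝ := fun i => ((r i).re - a) ^ 2 + ((r i).im + b) ^ 2 with hq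
  have hqpos : ∀ i, 0 < q i := fun i => by
    have := hpos i
    positivity
  have hne : ∀ i, halfPlaneDist (r i) a b ≠ 0 := fun i => (div_pos (hqpos i) hb).ne'
  have hA : ∑ i, -2 * ((r i).re - a) / q i = 0 := by
    have hd : HasDerivAt (fun s => ∑ i, Real.log (halfPlaneDist (r i) s b))
        (∑ i, -2 * ((r i).re - a) / q i) a := by
      refine HasDerivAt.fun_sum fun i _ => ?_
      have h1 : HasDerivAt (fun s => halfPlaneDist (r i) s b) ((-2 * ((r i).re - a)) / b) a := by
        refine HasDerivAt.div_const ?_ b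
        convert! (((hasDerivAt_id a).const_sub (r i).re).pow 2).add_const (((r i).im + b) ^ 2) using 1
        simp
      convert! h1.log (hne i) using 1
      rw [halfPlaneDist, div_div_div_cancel_right₀ hb.ne']
    have hl : IsLocalMin (fun s => ∑ i, Real.log (halfPlaneDist (r i) s b)) a :=
      Eventually.of_forall fun s => hmin s b hb
    exact hl.hasDerivAt_eq_zero hd
  have hB : ∑ i, (2 * ((r i).im + b) / q i - 1 / b) = 0 := by
    have hd : HasDerivAt (fun s => ∑ i, Real.log (halfPlaneDist (r i) a s))
        (∑ i, (2 * ((r i).im + b) / q i - 1 / b)) b := by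
      refine HasDerivAt.fun_sum fun i _ => ?_
      have h1 : HasDerivAt (fun s => halfPlaneDist (r i) a s)
          ((2 * ((r i).im + b) * b - q i * 1) / b ^ 2) b := by
        refine HasDerivAt.div ?_ (hasDerivAt_id b) hb.ne'
        convert! (((hasDerivAt_id b).const_add (r i).im).pow 2).const_add (((r i).re - a) ^ 2) using 1
        simp
      convert! h1.log (hne i) using 1
      have := (hqpos i).ne'
      rw [halfPlaneDist]
      change _ = _ / (q i / b)
      field_simp
    have hl : IsLocalMin (fun s => ∑ i, Real.log (halfPlaneDist (r i) a s)) b := by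
      filter_upwards [lt_mem_nhds hb] with s hs using hmin a s hs
    exact hl.hasDerivAt_eq_zero hd
  refine ⟨⟨a, b⟩, (isBarycenter_iff hτ hr hb).2 ?_⟩
  have hinv : ∀ i, (r i - conj (⟨a, b⟩ : ℂ))⁻¹ =
      ⟨((r i).re - a) / q i, -((r i).im + b) / q i⟩ := fun i => by
    have hn : Complex.normSq (r i - conj (⟨a, b⟩ : ℂ)) = q i := by
      rw [Complex.normSq_apply, hq]
      simp
      ring
    apply Complex.ext
    · rw [Complex.inv_re, hn]
      simp
    · rw [Complex.inv_im, hn]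
      simp
  have h1 : ∑ i, ((r i).re - a) / q i = 0 := by
    have : ∑ i, -2 * ((r i).re - a) / q i = -2 * ∑ i, ((r i).re - a) / q i := by
      rw [Finset.mul_sum]
      exact Finset.sum_congr rfl fun i _ => by ring
    rw [this] at hA
    linarith
  have h2 : ∑ i, ((r i).im + b) / q i = m / (2 * b) := by
    rw [Finset.sum_sub_distrib] at hB
    simp only [mul_div_assoc] at hB
    rw [← Finset.mul_sum] at hB
    simp at hB
    field_simp
    field_simp at hB
    linarith
  have h3 : ∑ i, (r i - conj (⟨a, b⟩ : ℂ))⁻¹ = ⟨0, -(m / (2 * b))⟩ := by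
    simp only [hinv]
    apply Complex.ext
    · rw [Complex.re_sum]
      exact h1
    · rw [Complex.im_sum, ← h2, ← Finset.sum_neg_distrib]
      exact Finset.sum_congr rfl fun i _ => neg_div _ _
  rw [h3]
  apply Complex.ext
  · simp
    field_simp
    ring
  · simp

/-- The implicit function theorem applies because the barycenter equation is nondegenerate at its
solution. Normalising the value to i suffices, since frames are only moved near ones that are
already normalised. -/
lemma IsBarycenter.exists_smooth {E : Type*} [NormedAddCommGroup E] [NormedSpace ℝ E]
    [CompleteSpace E] (hm : 0 < m) {τ : E → Matrix (Fin m) (Fin m) ℂ} {y₀ : E}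
    (hτ : ∀ i j, ContDiffAt ℝ ∞ (fun y => τ y i j) y₀) (hup : UpperSpectrum (τ y₀))
    (hb : IsBarycenter (τ y₀) Complex.I) :
    ∃ z : E → ℂ, z y₀ = Complex.I ∧ ContDiffAt ℝ ∞ z y₀ ∧ ∀ᶠ y in 𝓝 y₀, IsBarycenter (τ y) (z y) := by
  have hconj : ContDiff ℝ ∞ (fun z : ℂ => conj z) := Complex.conjCLE.contDiff
  set G : E × ℂ → ℂ := fun q =>
    (q.2 - conj q.2) * (τ q.1 - conj q.2 • (1 : Matrix (Fin m) (Fin m) ℂ))⁻¹.trace - m with hG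
  have hsm : ContDiffAt ℝ ∞ G (y₀, Complex.I) := by
    have hz : ContDiffAt ℝ ∞ (fun q : E × ℂ => q.2) (y₀, Complex.I) := contDiffAt_snd
    have hcz : ContDiffAt ℝ ∞ (fun q : E × ℂ => conj q.2) (y₀, Complex.I) :=
      hconj.contDiffAt.comp _ hz
    refine ((hz.sub hcz).mul ?_).sub contDiffAt_const
    simp only [Matrix.trace, Matrix.diag_apply]
    refine ContDiffAt.sum fun i _ => ?_
    refine contDiffAt_matrix_inv
      (M := fun q : E × ℂ => τ q.1 - conj q.2 • (1 : Matrix (Fin m) (Fin m) ℂ))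
      (fun i j => ?_) (hup (conj Complex.I) (by simp)) i i
    simp only [Matrix.sub_apply, Matrix.smul_apply, smul_eq_mul]
    exact (ContDiffAt.comp (g := fun y => τ y i j) (f := Prod.fst) (y₀, Complex.I) (hτ i j)
      contDiffAt_fst).sub (hcz.mul contDiffAt_const)
  obtain ⟨r, hr⟩ := exists_det_sub_smul_one (τ y₀)
  have hpos := hup.root_im_pos hr
  have hri : ∀ i, r i + Complex.I ≠ 0 := fun i h => by
    have := congrArg Complex.im h
    simp at this
    linarith [hpos i]
  have h0 : G (y₀, Complex.I) = 0 := sub_eq_zero.2 hb.2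
  have hb1 := (isBarycenter_iff hup hr (z := Complex.I) (by simp)).1 hb
  have hb2 := (isBarycenter_iff_sum hup hr (z := Complex.I) (by simp)).1 hb
  simp only [Complex.conj_I, sub_neg_eq_add] at hb1 hb2
  obtain ⟨φ, hφ0, hφ, hφG⟩ := exists_contDiffAt_implicit hsm h0 fun w hw => by
    have hz : HasDerivAt (fun s : ℝ => Complex.I + s • w) w 0 := by
      simpa using ((hasDerivAt_id (0 : ℝ)).smul_const w).const_add Complex.I
    have hcz : HasDerivAt (fun s : ℝ => conj (Complex.I + s • w)) (conj w) 0 :=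
      hz.star
    have hd : HasDerivAt (fun s : ℝ => ((Complex.I + s • w) - conj (Complex.I + s • w)) *
        ∑ i, (r i - conj (Complex.I + s • w))⁻¹ - m)
        ((w - conj w) * ∑ i, (r i + Complex.I)⁻¹ +
          (2 * Complex.I) * ∑ i, conj w / (r i + Complex.I) ^ 2) 0 := by
      have hsum : HasDerivAt (fun s : ℝ => ∑ i, (r i - conj (Complex.I + s • w))⁻¹)
          (∑ i, conj w / (r i + Complex.I) ^ 2) 0 := by
        refine HasDerivAt.fun_sum fun i _ => ?_
        have h1 := (hcz.const_sub (r i)).inv (by simpa using hri i)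
        convert! h1 using 1
        simp
      have h1 := ((hz.sub hcz).mul hsum).sub_const (m : ℂ)
      convert! h1 using 1
      simp only [Pi.sub_apply, zero_smul, add_zero, Complex.conj_I, sub_neg_eq_add]
      ring
    have heq : (fun s : ℝ => G (y₀, Complex.I + s • w)) =ᶠ[𝓝 0] fun s : ℝ =>
        ((Complex.I + s • w) - conj (Complex.I + s • w)) *
        ∑ i, (r i - conj (Complex.I + s • w))⁻¹ - m := by
      have hev : ∀ᶠ s : ℝ in 𝓝 0, 0 < (Complex.I + s • w).im := by
        have : ContinuousAt (fun s : ℝ => (Complex.I + s • w).im) 0 :=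
          Complex.continuous_im.continuousAt.comp hz.continuousAt
        exact this.eventually_const_lt (by simp)
      filter_upwards [hev] with s hs
      simp only [hG]
      rw [trace_inv_sub hr fun i => ne_conj_of_im_pos (hpos i) hs]
    have h2 := hd.unique (hw.congr_of_eventuallyEq heq.symm)
    have hS : ∑ i, (r i + Complex.I)⁻¹ = -(m : ℂ) * Complex.I / 2 := by
      linear_combination (-Complex.I / 2) * hb1 + (∑ i, (r i + Complex.I)⁻¹) * Complex.I_sq
    set l : Fin m → ℂ := fun i => (r i - Complex.I) / (r i + Complex.I) with hl
    have hli : ∀ i, ‖l i‖ < 1 := fun i => by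
      simpa [hl] using norm_sub_div_sub_conj_lt_one (z := Complex.I) (hpos i) (by simp)
    -- The kernel of the linearisation, rewritten through the Cayley transforms lᵢ, whose sum
    -- vanishes. As |∑ lᵢ²| < m, comparing norms leaves only w = 0.
    have hw2 : (m : ℂ) * w = -(∑ i, l i ^ 2) * conj w := by
      have e1 : ∀ i, (r i + Complex.I)⁻¹ ^ 2 = -(1 - l i) ^ 2 / 4 := fun i => by
        have : 1 - l i = 2 * Complex.I * (r i + Complex.I)⁻¹ := by
          have := hri i
          simp only [hl]
          field_simp
          ring
        rw [this, mul_pow, mul_pow, Complex.I_sq]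
        ring
      have e2 : ∑ i, conj w / (r i + Complex.I) ^ 2 =
          -conj w / 4 * (m + ∑ i, l i ^ 2) := by
        have : ∀ i, conj w / (r i + Complex.I) ^ 2 =
            -conj w / 4 * (1 + l i ^ 2) + conj w / 2 * l i := fun i => by
          rw [div_eq_mul_inv, ← inv_pow, e1]
          ring
        simp only [this]
        rw [Finset.sum_add_distrib, ← Finset.mul_sum, ← Finset.mul_sum, hb2,
          Finset.sum_add_distrib]
        simp
      rw [hS, e2] at h2
      linear_combination (2 * Complex.I) * h2 + (m * w + (∑ i, l i ^ 2) * conj w) * Complex.I_sq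
    by_contra hne
    have hwpos : 0 < ‖w‖ := norm_pos_iff.2 hne
    have h3 := congrArg norm hw2
    rw [norm_mul, norm_mul, norm_neg, RCLike.norm_conj, Complex.norm_natCast] at h3
    have h4 : ‖∑ i, l i ^ 2‖ < m := by
      calc ‖∑ i, l i ^ 2‖ ≤ ∑ i, ‖l i ^ 2‖ := norm_sum_le _ _
        _ < ∑ _i : Fin m, (1 : ℝ) := by
          refine Finset.sum_lt_sum_of_nonempty ⟨⟨0, hm⟩, Finset.mem_univ _⟩ fun i _ => ?_
          rw [norm_pow]
          exact pow_lt_one₀ (norm_nonneg _) (hli i) two_ne_zero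
        _ = m := by simp
    nlinarith
  refine ⟨φ, hφ0, hφ, ?_⟩
  have hev : ∀ᶠ y in 𝓝 y₀, 0 < (φ y).im := by
    have : ContinuousAt (fun y => (φ y).im) y₀ := Complex.continuous_im.continuousAt.comp hφ.continuousAt
    exact this.eventually_const_lt (by simp [hφ0])
  filter_upwards [hφG, hev] with y hy hy'
  exact ⟨hy', sub_eq_zero.1 hy⟩

end Barycenter

end GreatCircle

namespace GreatCircle

/-! ### Complex linear and antilinear parts of real block matrices -/

section Parts

open Matrix ComplexConjugate

variable {m : ℕ}

/-- Square complex matrices. -/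
abbrev CMatrix (m : ℕ) : Type := Matrix (Fin m) (Fin m) ℂ

/-- The entrywise complex conjugate. -/
noncomputable def conjM (A : CMatrix m) : CMatrix m := A.map (starRingEnd ℂ)

@[simp] lemma conjM_apply (A : CMatrix m) (i j) : conjM A i j = conj (A i j) := rfl
@[simp] lemma conjM_zero : conjM (0 : CMatrix m) = 0 := by ext; simp
@[simp] lemma conjM_one : conjM (1 : CMatrix m) = 1 := by
  ext i j
  by_cases h : i = j <;> simp [Matrix.one_apply, h]
lemma conjM_sub (A B : CMatrix m) : conjM (A - B) = conjM A - conjM B := by ext; simp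
lemma conjM_smul (c : ℂ) (A : CMatrix m) : conjM (c • A) = conj c • conjM A := by ext; simp
lemma det_conjM (A : CMatrix m) : (conjM A).det = conj A.det :=
  ((starRingEnd ℂ).map_det A).symm

/-- The complex linear part `Ω^{1,0}` of a real block matrix. -/
noncomputable def cPart (A : BlockMatrix m) : CMatrix m := Matrix.of fun P Q => Omega A P Q

/-- The antilinear part `Ω^{0,1}` of a real block matrix. -/
noncomputable def aPart (A : BlockMatrix m) : CMatrix m := Matrix.of fun P Q => OmegaBar A P Q

/-- The real block matrix with given complex linear and antilinear parts. -/
def ofParts (τ σ : CMatrix m) : BlockMatrix m := Matrix.of fun a b =>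
  !![(τ a.1 b.1).re - (σ a.1 b.1).im, (σ a.1 b.1).re - (τ a.1 b.1).im;
    (τ a.1 b.1).im + (σ a.1 b.1).re, (τ a.1 b.1).re + (σ a.1 b.1).im] a.2 b.2

@[simp] lemma cPart_apply (A : BlockMatrix m) (P Q) : cPart A P Q = Omega A P Q := rfl
@[simp] lemma aPart_apply (A : BlockMatrix m) (P Q) : aPart A P Q = OmegaBar A P Q := rfl

@[simp] lemma cPart_ofParts (τ σ : CMatrix m) : cPart (ofParts τ σ) = τ := by
  ext P Q
  apply Complex.ext <;> (simp [Omega, ofParts]; try ring)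

@[simp] lemma aPart_ofParts (τ σ : CMatrix m) : aPart (ofParts τ σ) = σ := by
  ext P Q
  apply Complex.ext <;> (simp [OmegaBar, ofParts]; try ring)

@[simp] lemma ofParts_parts (A : BlockMatrix m) : ofParts (cPart A) (aPart A) = A := by
  ext ⟨P, a⟩ ⟨Q, b⟩
  fin_cases a <;> fin_cases b <;> simp [Omega, OmegaBar, ofParts] <;> ring

lemma parts_ext {A B : BlockMatrix m} (h1 : cPart A = cPart B) (h2 : aPart A = aPart B) :
    A = B := by
  rw [← ofParts_parts A, h1, h2, ofParts_parts]

/-- As a real linear map of ℂᵐ a block matrix is τ + σK₀, where K₀ is z ↦ i z̄. The product rules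
follow from K₀² = 1 and K₀τ = τ̄K₀. -/
lemma cPart_mul (A B : BlockMatrix m) :
    cPart (A * B) = cPart A * cPart B + aPart A * conjM (aPart B) := by
  ext P Q
  simp only [cPart_apply, Matrix.add_apply, Matrix.mul_apply, conjM_apply, aPart_apply]
  rw [← Finset.sum_add_distrib]
  apply Complex.ext
  · simp only [Omega, OmegaBar, Complex.re_sum, Matrix.mul_apply, Fintype.sum_prod_type,
      Fin.sum_univ_two]
    rw [← Finset.sum_add_distrib, Finset.sum_div]
    refine Finset.sum_congr rfl fun i _ => ?_
    simp
    ring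
  · simp only [Omega, OmegaBar, Complex.im_sum, Matrix.mul_apply, Fintype.sum_prod_type,
      Fin.sum_univ_two]
    rw [← Finset.sum_sub_distrib, Finset.sum_div]
    refine Finset.sum_congr rfl fun i _ => ?_
    simp
    ring

lemma aPart_mul (A B : BlockMatrix m) :
    aPart (A * B) = cPart A * aPart B + aPart A * conjM (cPart B) := by
  ext P Q
  simp only [cPart_apply, Matrix.add_apply, Matrix.mul_apply, conjM_apply, aPart_apply]
  rw [← Finset.sum_add_distrib]
  apply Complex.ext
  · simp only [Omega, OmegaBar, Complex.re_sum, Matrix.mul_apply, Fintype.sum_prod_type,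
      Fin.sum_univ_two]
    rw [← Finset.sum_add_distrib, Finset.sum_div]
    refine Finset.sum_congr rfl fun i _ => ?_
    simp
    ring
  · simp only [Omega, OmegaBar, Complex.im_sum, Matrix.mul_apply, Fintype.sum_prod_type,
      Fin.sum_univ_two]
    rw [← Finset.sum_sub_distrib, Finset.sum_div]
    refine Finset.sum_congr rfl fun i _ => ?_
    simp
    ring

@[simp] lemma cPart_one : cPart (1 : BlockMatrix m) = 1 := by
  ext P Q
  by_cases h : P = Q <;> apply Complex.ext <;> simp [Omega, Matrix.one_apply, h]

@[simp] lemma aPart_one : aPart (1 : BlockMatrix m) = 0 := by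
  ext P Q
  by_cases h : P = Q <;> apply Complex.ext <;> simp [OmegaBar, h]

lemma cPart_add (A B : BlockMatrix m) : cPart (A + B) = cPart A + cPart B := by
  ext P Q
  apply Complex.ext <;> simp [Omega] <;> ring

lemma aPart_add (A B : BlockMatrix m) : aPart (A + B) = aPart A + aPart B := by
  ext P Q
  apply Complex.ext <;> simp [OmegaBar] <;> ring

@[simp] lemma cPart_stdJ : cPart (stdJ m) = Complex.I • (1 : CMatrix m) := by
  ext P Q
  by_cases h : P = Q <;> apply Complex.ext <;>
    simp [Omega, stdJ, h, Matrix.kroneckerMap_apply]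

@[simp] lemma aPart_stdJ : aPart (stdJ m) = 0 := by
  ext P Q
  by_cases h : P = Q <;> apply Complex.ext <;>
    simp [OmegaBar, stdJ, h, Matrix.kroneckerMap_apply]

lemma aPart_eq_zero_of_commute {A : BlockMatrix m} (h : stdJ m * A = A * stdJ m) :
    aPart A = 0 := by
  have h1 := congrArg aPart h
  rw [aPart_mul, aPart_mul] at h1
  simp only [cPart_stdJ, aPart_stdJ, conjM_smul, conjM_one, Complex.conj_I, zero_mul, mul_zero,
    add_zero, zero_add, smul_mul_assoc, one_mul, Matrix.mul_smul, mul_one, neg_smul, mul_neg] at h1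
  ext i j
  have h2 := congrFun (congrFun h1 i) j
  simp only [Matrix.smul_apply, Matrix.neg_apply, smul_eq_mul] at h2
  have : Complex.I * aPart A i j = 0 := by linear_combination h2 / 2
  simpa using this

lemma contDiffAt_ofParts {E : Type*} [NormedAddCommGroup E] [NormedSpace ℝ E]
    {τ σ : E → CMatrix m} {y₀ : E} (hτ : ∀ i j, ContDiffAt ℝ ∞ (fun y => τ y i j) y₀)
    (hσ : ∀ i j, ContDiffAt ℝ ∞ (fun y => σ y i j) y₀) (a b) :
    ContDiffAt ℝ ∞ (fun y => ofParts (τ y) (σ y) a b) y₀ := by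
  have hre : ∀ {f : E → ℂ}, ContDiffAt ℝ ∞ f y₀ → ContDiffAt ℝ ∞ (fun y => (f y).re) y₀ :=
    fun hf => Complex.reCLM.contDiff.contDiffAt.comp y₀ hf
  have him : ∀ {f : E → ℂ}, ContDiffAt ℝ ∞ f y₀ → ContDiffAt ℝ ∞ (fun y => (f y).im) y₀ :=
    fun hf => Complex.imCLM.contDiff.contDiffAt.comp y₀ hf
  obtain ⟨P, a⟩ := a
  obtain ⟨Q, b⟩ := b
  have h1 := hre (hτ P Q)
  have h2 := him (hτ P Q)
  have h3 := hre (hσ P Q)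
  have h4 := him (hσ P Q)
  fin_cases a <;> fin_cases b
  · exact h1.sub h4
  · exact h3.sub h2
  · exact h2.add h3
  · exact h1.add h4

lemma contDiffAt_mk_complex {E : Type*} [NormedAddCommGroup E] [NormedSpace ℝ E] {f g : E → ℝ}
    {y₀ : E} (hf : ContDiffAt ℝ ∞ f y₀) (hg : ContDiffAt ℝ ∞ g y₀) :
    ContDiffAt ℝ ∞ (fun y => (⟨f y, g y⟩ : ℂ)) y₀ :=
  (Complex.equivRealProdCLM.symm.contDiff.contDiffAt).comp y₀ (hf.prodMk hg)

lemma contDiffAt_cPart {E : Type*} [NormedAddCommGroup E] [NormedSpace ℝ E]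
    {A : E → BlockMatrix m} {y₀ : E} (hA : ∀ i j, ContDiffAt ℝ ∞ (fun y => A y i j) y₀) (P Q) :
    ContDiffAt ℝ ∞ (fun y => cPart (A y) P Q) y₀ :=
  contDiffAt_mk_complex (((hA _ _).add (hA _ _)).div_const 2) (((hA _ _).sub (hA _ _)).div_const 2)

lemma contDiffAt_aPart {E : Type*} [NormedAddCommGroup E] [NormedSpace ℝ E]
    {A : E → BlockMatrix m} {y₀ : E} (hA : ∀ i j, ContDiffAt ℝ ∞ (fun y => A y i j) y₀) (P Q) :
    ContDiffAt ℝ ∞ (fun y => aPart (A y) P Q) y₀ :=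
  contDiffAt_mk_complex (((hA _ _).add (hA _ _)).div_const 2) (((hA _ _).sub (hA _ _)).div_const 2)

lemma contDiffAt_conjM {E : Type*} [NormedAddCommGroup E] [NormedSpace ℝ E]
    {A : E → CMatrix m} {y₀ : E} (hA : ∀ i j, ContDiffAt ℝ ∞ (fun y => A y i j) y₀) (P Q) :
    ContDiffAt ℝ ∞ (fun y => conjM (A y) P Q) y₀ :=
  Complex.conjCLE.contDiff.contDiffAt.comp y₀ (hA P Q)

lemma det_ofParts_ne_zero {τ : CMatrix m} (h : τ.det ≠ 0) : (ofParts τ 0).det ≠ 0 := by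
  have : ofParts τ 0 * ofParts τ⁻¹ 0 = 1 := by
    apply parts_ext
    · simp [cPart_mul, Matrix.mul_nonsing_inv _ h.isUnit]
    · simp [aPart_mul]
  intro h0
  have := congrArg Matrix.det this
  rw [Matrix.det_mul, h0, Matrix.det_one] at this
  simp at this

/-! ### Matrices with spectrum in the upper half-plane -/

lemma UpperSpectrum.isUnit_det {τ : CMatrix m} (h : UpperSpectrum τ) {ζ : ℂ} (hζ : ζ.im ≤ 0) :
    IsUnit (τ - ζ • (1 : CMatrix m)).det := (h ζ hζ).isUnit

lemma upperSpectrum_iff {τ : CMatrix m} : UpperSpectrum τ ↔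
    ∀ ζ : ℂ, ζ.im ≤ 0 → ∀ v, τ.mulVec v = ζ • v → v = 0 := by
  refine forall₂_congr fun ζ _ => ?_
  rw [not_iff_comm, ← Matrix.exists_mulVec_eq_zero_iff]
  push Not
  refine exists_congr fun v => ?_
  rw [and_comm, Matrix.sub_mulVec, sub_eq_zero, Matrix.smul_mulVec, Matrix.one_mulVec]

/-- Sylvester's equation `τ X = X τ̄'` has only the zero solution. -/
lemma UpperSpectrum.eq_zero_of_mul_eq {τ τ' X : CMatrix m} (h : UpperSpectrum τ)
    (h' : UpperSpectrum τ') (hX : τ * X = X * conjM τ') : X = 0 := by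
  -- The intertwining passes to polynomials. For the characteristic polynomial of τ the left side
  -- vanishes by Cayley-Hamilton. On the right its value at τ̄' is invertible, since its roots lie
  -- in the upper half-plane and the spectrum of τ̄' in the lower one.
  have hcomm : ∀ p : Polynomial ℂ, (Polynomial.aeval τ p) * X =
      X * Polynomial.aeval (conjM τ') p := by
    intro p
    induction p using Polynomial.induction_on' with
    | add p q hp hq => simp [add_mul, mul_add, hp, hq]
    | monomial k a =>
      have hk : τ ^ k * X = X * conjM τ' ^ k := by
        induction k with
        | zero => simp
        | succ k ih => rw [pow_succ, mul_assoc, hX, ← mul_assoc, ih, mul_assoc, ← pow_succ]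
      simp [Polynomial.aeval_monomial, Algebra.algebraMap_eq_smul_one, hk]
  have h0 := hcomm τ.charpoly
  rw [Matrix.aeval_self_charpoly, zero_mul] at h0
  have hunit : ∀ s : Multiset ℂ, (∀ a ∈ s, 0 < a.im) →
      IsUnit (Polynomial.aeval (conjM τ') (s.map fun a => Polynomial.X - Polynomial.C a).prod) := by
    intro s
    induction s using Multiset.induction_on with
    | empty => simp
    | cons a s ih =>
      intro hs
      rw [Multiset.map_cons, Multiset.prod_cons, map_mul]
      refine IsUnit.mul ?_ (ih fun b hb => hs b (Multiset.mem_cons_of_mem hb))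
      rw [Matrix.isUnit_iff_isUnit_det, isUnit_iff_ne_zero]
      have : Polynomial.aeval (conjM τ') (Polynomial.X - Polynomial.C a) =
          conjM (τ' - conj a • (1 : CMatrix m)) := by
        simp [conjM_sub, conjM_smul, Algebra.algebraMap_eq_smul_one]
      rw [this, det_conjM]
      have ha := hs a (Multiset.mem_cons_self a s)
      simpa using h' (conj a) (by simpa using ha.le)
  have hroots : ∀ a ∈ τ.charpoly.roots, 0 < a.im := by
    intro a ha
    by_contra! hle
    refine h a hle ?_
    have h1 := (Polynomial.mem_roots'.1 ha).2
    rw [Polynomial.IsRoot, Matrix.eval_charpoly, Matrix.scalar_apply,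
      ← Matrix.smul_one_eq_diagonal] at h1
    rw [← neg_sub, Matrix.det_neg, h1, mul_zero]
  have h1 := hunit _ hroots
  rw [← (IsAlgClosed.splits τ.charpoly).eq_prod_roots_of_monic τ.charpoly_monic] at h1
  exact (h1.mul_left_eq_zero).1 h0.symm

/-- Read the eigenvalue equation at a coordinate of maximal norm. The bound is only needed to be
continuous in τ, to confine eigenvalues to a compact set. -/
lemma norm_le_of_mulVec_eq {τ : CMatrix m} {ζ : ℂ} {v : Fin m → ℂ} (hv : v ≠ 0)
    (h : τ.mulVec v = ζ • v) : ‖ζ‖ ≤ ∑ i, ∑ j, ‖τ i j‖ := by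
  obtain ⟨k, hk⟩ := Function.ne_iff.1 hv
  obtain ⟨i, -, hi⟩ := Finset.exists_max_image Finset.univ (fun i => ‖v i‖) ⟨k, Finset.mem_univ k⟩
  have hpos : 0 < ‖v i‖ := (norm_pos_iff.2 hk).trans_le (hi k (Finset.mem_univ k))
  have h1 : ‖ζ‖ * ‖v i‖ ≤ (∑ j, ‖τ i j‖) * ‖v i‖ := by
    rw [← norm_mul, ← smul_eq_mul, ← Pi.smul_apply, ← h, Finset.sum_mul]
    change ‖∑ j, τ i j * v j‖ ≤ _
    refine (norm_sum_le _ _).trans (Finset.sum_le_sum fun j _ => ?_)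
    rw [norm_mul]
    exact mul_le_mul_of_nonneg_left (hi j (Finset.mem_univ j)) (norm_nonneg _)
  refine (le_of_mul_le_mul_right h1 hpos).trans ?_
  exact Finset.single_le_sum (f := fun i => ∑ j, ‖τ i j‖)
    (fun i _ => Finset.sum_nonneg fun j _ => norm_nonneg _) (Finset.mem_univ i)

/-- Eigenvalues of nearby matrices stay in a fixed disc. Its part in the closed lower half-plane is
compact, and there the determinant, nonzero at `y₀`, remains nonzero nearby. -/
lemma UpperSpectrum.eventually {E : Type*} [TopologicalSpace E] {τ : E → CMatrix m} {y₀ : E}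
    (hτ : ∀ i j, ContinuousAt (fun y => τ y i j) y₀) (h : UpperSpectrum (τ y₀)) :
    ∀ᶠ y in 𝓝 y₀, UpperSpectrum (τ y) := by
  set R := 1 + ∑ i, ∑ j, ‖τ y₀ i j‖ with hR
  have h1 : ∀ᶠ y in 𝓝 y₀, ∑ i, ∑ j, ‖τ y i j‖ < R := by
    have : ContinuousAt (fun y => ∑ i, ∑ j, ‖τ y i j‖) y₀ := by
      refine tendsto_finsetSum _ fun i _ => tendsto_finsetSum _ fun j _ => ?_
      exact (hτ i j).norm
    exact this.eventually_lt_const (by rw [hR]; linarith)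
  have hK : IsCompact (Metric.closedBall (0 : ℂ) R ∩ {ζ | ζ.im ≤ 0}) :=
    (isCompact_closedBall _ _).inter_right (isClosed_le Complex.continuous_im continuous_const)
  have h2 : ∀ᶠ y in 𝓝 y₀, ∀ ζ ∈ Metric.closedBall (0 : ℂ) R ∩ {ζ | ζ.im ≤ 0},
      (τ y - ζ • (1 : CMatrix m)).det ≠ 0 := by
    refine hK.eventually_forall_of_forall_eventually fun ζ hζ => ?_
    have hc : ContinuousAt (fun q : E × ℂ => (τ q.1 - q.2 • (1 : CMatrix m)).det) (y₀, ζ) := by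
      have hM : ContinuousAt (fun q : E × ℂ => τ q.1 - q.2 • (1 : CMatrix m)) (y₀, ζ) := by
        refine tendsto_pi_nhds.2 fun i => tendsto_pi_nhds.2 fun j => ?_
        refine Tendsto.sub ?_ ?_
        · exact (hτ i j).tendsto.comp continuousAt_fst
        · exact (continuousAt_snd.mul continuousAt_const)
      exact (Continuous.matrix_det continuous_id).continuousAt.comp hM
    exact hc.eventually_ne (h ζ hζ.2)
  filter_upwards [h1, h2] with y hy1 hy2
  rw [upperSpectrum_iff]
  intro ζ hζ v hv
  by_contra hne
  have hn := norm_le_of_mulVec_eq hne hv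
  refine hy2 ζ ⟨by simpa using hn.trans hy1.le, hζ⟩ ?_
  rw [← Matrix.exists_mulVec_eq_zero_iff]
  exact ⟨v, hne, by rw [Matrix.sub_mulVec, hv, Matrix.smul_mulVec, Matrix.one_mulVec, sub_self]⟩

/-- A nonzero real linear combination of `1` and a matrix with spectrum in the upper half-plane is
invertible. -/
lemma UpperSpectrum.det_add_ne_zero {τ : CMatrix m} (h : UpperSpectrum τ) {a b c d : ℝ}
    (hdet : 0 < a * d - b * c) : ((a : ℂ) • (1 : CMatrix m) + (b : ℂ) • τ).det ≠ 0 := by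
  have hreal : ∀ (ζ : ℂ), ζ.im ≤ 0 → ∀ v, τ.mulVec v = ζ • v → v = 0 := upperSpectrum_iff.1 h
  rw [Ne, ← Matrix.exists_mulVec_eq_zero_iff]
  rintro ⟨v, hv, hv'⟩
  rw [Matrix.add_mulVec, Matrix.smul_mulVec, Matrix.smul_mulVec, Matrix.one_mulVec] at hv'
  refine hv ?_
  by_cases hb : b = 0
  · subst hb
    have ha : (a : ℂ) ≠ 0 := by
      intro ha
      rw [Complex.ofReal_eq_zero.1 ha] at hdet
      simp at hdet
    simpa [Complex.ofReal_eq_zero.not.1 ha] using hv'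
  · refine hreal ((-a / b : ℝ) : ℂ) (by simp) v ?_
    have hb' : (b : ℂ) ≠ 0 := by exact_mod_cast hb
    have : (b : ℂ) • τ.mulVec v = (b : ℂ) • (((-a / b : ℝ) : ℂ) • v) := by
      rw [smul_smul, eq_neg_of_add_eq_zero_right hv', ← neg_smul]
      congr 1
      push_cast
      field_simp
    exact smul_right_injective _ hb' this

/-- The fractional linear action of orientation preserving real matrices preserves the condition
on the spectrum. -/
lemma UpperSpectrum.moebius {τ τ' : CMatrix m} (h : UpperSpectrum τ) {a b c d : ℝ}
    (hdet : 0 < a * d - b * c)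
    (hτ' : τ' * ((a : ℂ) • (1 : CMatrix m) + (b : ℂ) • τ) =
      (c : ℂ) • (1 : CMatrix m) + (d : ℂ) • τ) :
    UpperSpectrum τ' := by
  have hreal : ∀ (ζ : ℂ), ζ.im ≤ 0 → ∀ v, τ.mulVec v = ζ • v → v = 0 := upperSpectrum_iff.1 h
  have hA := h.det_add_ne_zero hdet
  refine upperSpectrum_iff.2 fun ζ hζ v hv => ?_
  set B := (a : ℂ) • (1 : CMatrix m) + (b : ℂ) • τ with hB
  set u := B⁻¹.mulVec v with hu
  have hBu : B.mulVec u = v := by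
    rw [hu, Matrix.mulVec_mulVec, Matrix.mul_nonsing_inv _ hA.isUnit, Matrix.one_mulVec]
  suffices u = 0 by rw [← hBu, this, Matrix.mulVec_zero]
  rw [← hBu, Matrix.mulVec_mulVec, hτ', hB] at hv
  simp only [Matrix.add_mulVec, Matrix.smul_mulVec, Matrix.one_mulVec, smul_add, smul_smul] at hv
  have h1 : ((d : ℂ) - ζ * b) • τ.mulVec u = (ζ * a - c) • u := by
    rw [sub_smul, sub_smul]
    linear_combination (exp := 1) hv
  by_cases hd : (d : ℂ) - ζ * b = 0
  · rw [hd, zero_smul] at h1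
    rcases smul_eq_zero.1 h1.symm with h2 | h2
    · exfalso
      have : ((a * d - b * c : ℝ) : ℂ) = 0 := by
        push_cast
        linear_combination a * hd + b * h2
      exact hdet.ne' (by exact_mod_cast this)
    · exact h2
  · refine hreal ((ζ * a - c) / (d - ζ * b)) ?_ u ?_
    -- The imaginary part of (ζa - c)(d - ζ̄b) is (ad - bc) Im ζ.
    · rw [Complex.div_im]
      have hn := Complex.normSq_pos.2 hd
      rw [← sub_div]
      refine div_nonpos_of_nonpos_of_nonneg ?_ hn.le
      simp
      nlinarith
    · apply smul_right_injective _ hd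
      simp only
      rw [h1, smul_smul, mul_div_cancel₀ _ hd]

end Parts

end GreatCircle

namespace GreatCircle

/-! ### The complex structure associated with a real matrix without real eigenvalues -/

section Associated

open Matrix ComplexConjugate

variable {m : ℕ}

/-- The complexification of a real block matrix, acting on column vectors. -/
noncomputable def complexEnd (T : BlockMatrix m) : End ℂ (Fin m × Fin 2 → ℂ) :=
  Matrix.toLin' (T.map ((↑) : ℝ → ℂ))

lemma complexEnd_apply (T : BlockMatrix m) (z : Fin m × Fin 2 → ℂ) (a) :
    complexEnd T z a = ∑ b, (T a b : ℂ) * z b := by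
  simp [complexEnd, Matrix.mulVec, dotProduct]

lemma complexEnd_mul (A B : BlockMatrix m) : complexEnd (A * B) = complexEnd A * complexEnd B := by
  have h : (A * B).map ((↑) : ℝ → ℂ) = A.map ((↑) : ℝ → ℂ) * B.map ((↑) : ℝ → ℂ) :=
    Matrix.map_mul (f := Complex.ofRealHom)
  rw [complexEnd, h, Matrix.toLin'_mul]
  rfl

lemma complexEnd_star (T : BlockMatrix m) (z : Fin m × Fin 2 → ℂ) :
    complexEnd T (star z) = star (complexEnd T z) := by
  funext a
  simp [complexEnd_apply]

lemma star_mem_maxGenEigenspace {T : BlockMatrix m} {μ : ℂ} {z : Fin m × Fin 2 → ℂ}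
    (hz : z ∈ (complexEnd T).maxGenEigenspace μ) :
    star z ∈ (complexEnd T).maxGenEigenspace (conj μ) := by
  rw [End.mem_maxGenEigenspace] at hz ⊢
  obtain ⟨k, hk⟩ := hz
  refine ⟨k, ?_⟩
  have : ∀ k z, ((complexEnd T - conj μ • (1 : End ℂ (Fin m × Fin 2 → ℂ))) ^ k) (star z) =
      star (((complexEnd T - μ • (1 : End ℂ (Fin m × Fin 2 → ℂ))) ^ k) z) := by
    intro k
    induction k with
    | zero => simp
    | succ k ih =>
      intro z
      rw [pow_succ, pow_succ, Module.End.mul_apply, Module.End.mul_apply, ← ih]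
      congr 1
      simp [complexEnd_star, LinearMap.sub_apply]
  rw [this, hk, star_zero]

variable {T : BlockMatrix m}

lemma eq_zero_of_complexEnd_eq_smul (hT : ∀ r : ℝ, ¬ End.HasEigenvalue (Matrix.toLin' T) r)
    {r : ℝ} {z : Fin m × Fin 2 → ℂ} (hz : complexEnd T z = (r : ℂ) • z) : z = 0 := by
  have key : ∀ u : Fin m × Fin 2 → ℝ, T.mulVec u = r • u → u = 0 := by
    intro u hu
    by_contra hne
    refine hT r (End.hasEigenvalue_of_hasEigenvector (x := u) ?_)
    rw [End.hasEigenvector_iff, End.mem_eigenspace_iff]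
    exact ⟨by simpa using hu, hne⟩
  have hre : (fun a => (z a).re) = 0 := key _ (by
    funext a
    have := congrArg Complex.re (congrFun hz a)
    simpa [complexEnd_apply, Matrix.mulVec, dotProduct] using this)
  have him : (fun a => (z a).im) = 0 := key _ (by
    funext a
    have := congrArg Complex.im (congrFun hz a)
    simpa [complexEnd_apply, Matrix.mulVec, dotProduct] using this)
  funext a
  exact Complex.ext (congrFun hre a) (congrFun him a)

lemma maxGenEigenspace_ofReal_eq_bot
    (hT : ∀ r : ℝ, ¬ End.HasEigenvalue (Matrix.toLin' T) r) {μ : ℂ} (hμ : μ.im = 0) :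
    (complexEnd T).maxGenEigenspace μ = ⊥ := by
  obtain ⟨r, rfl⟩ : ∃ r : ℝ, (r : ℂ) = μ := ⟨μ.re, Complex.ext rfl (by simp [hμ])⟩
  rw [eq_bot_iff]
  intro z hz
  obtain ⟨k, hk⟩ := (End.mem_maxGenEigenspace _ _ _).1 hz
  clear hz
  induction k with
  | zero => simpa using hk
  | succ k ih =>
    rw [pow_succ', Module.End.mul_apply] at hk
    refine ih (eq_zero_of_complexEnd_eq_smul hT (r := r) ?_)
    rw [LinearMap.sub_apply, sub_eq_zero] at hk
    simpa using hk

/-- The sum of the generalized eigenspaces with eigenvalues in the upper half-plane. -/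
noncomputable def upperSpace (T : BlockMatrix m) : Submodule ℂ (Fin m × Fin 2 → ℂ) :=
  ⨆ μ ∈ {μ : ℂ | 0 < μ.im}, (complexEnd T).maxGenEigenspace μ

/-- The sum of the generalized eigenspaces with eigenvalues in the lower half-plane. -/
noncomputable def lowerSpace (T : BlockMatrix m) : Submodule ℂ (Fin m × Fin 2 → ℂ) :=
  ⨆ μ ∈ {μ : ℂ | μ.im < 0}, (complexEnd T).maxGenEigenspace μ

lemma upperSpace_le {W : Submodule ℂ (Fin m × Fin 2 → ℂ)}
    (h : ∀ μ : ℂ, 0 < μ.im → (complexEnd T).maxGenEigenspace μ ≤ W) : upperSpace T ≤ W :=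
  iSup₂_le h

lemma le_upperSpace {μ : ℂ} (h : 0 < μ.im) : (complexEnd T).maxGenEigenspace μ ≤ upperSpace T :=
  le_iSup₂_of_le μ h le_rfl

lemma le_lowerSpace {μ : ℂ} (h : μ.im < 0) : (complexEnd T).maxGenEigenspace μ ≤ lowerSpace T :=
  le_iSup₂_of_le μ h le_rfl

lemma isCompl_upperSpace_lowerSpace (hT : ∀ r : ℝ, ¬ End.HasEigenvalue (Matrix.toLin' T) r) :
    IsCompl (upperSpace T) (lowerSpace T) := by
  constructor
  · refine (End.independent_maxGenEigenspace (complexEnd T)).disjoint_biSup_biSup ?_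
    rw [Set.disjoint_left]
    intro μ h1 h2
    exact lt_asymm (show 0 < μ.im from h1) h2
  · rw [codisjoint_iff, eq_top_iff, ← End.iSup_maxGenEigenspace_eq_top (complexEnd T)]
    refine iSup_le fun μ => ?_
    rcases lt_trichotomy μ.im 0 with h | h | h
    · exact (le_lowerSpace h).trans le_sup_right
    · rw [maxGenEigenspace_ofReal_eq_bot hT h]
      exact bot_le
    · exact (le_upperSpace h).trans le_sup_left

lemma star_mem_lowerSpace {z : Fin m × Fin 2 → ℂ} (hz : z ∈ upperSpace T) :
    star z ∈ lowerSpace T := by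
  have : upperSpace T ≤ (lowerSpace T).comap
      ((starLinearEquiv ℂ (A := Fin m × Fin 2 → ℂ)).toLinearMap) := by
    refine upperSpace_le fun μ hμ z hz => ?_
    exact le_lowerSpace (by simpa using hμ) (star_mem_maxGenEigenspace hz)
  exact this hz

lemma star_mem_upperSpace {z : Fin m × Fin 2 → ℂ} (hz : z ∈ lowerSpace T) :
    star z ∈ upperSpace T := by
  have : lowerSpace T ≤ (upperSpace T).comap
      ((starLinearEquiv ℂ (A := Fin m × Fin 2 → ℂ)).toLinearMap) := by
    refine iSup₂_le fun μ hμ z hz => ?_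
    have hμ' : μ.im < 0 := hμ
    exact le_upperSpace (by simpa using hμ') (star_mem_maxGenEigenspace hz)
  exact this hz

/-- Complex conjugation exchanges the upper and lower spaces semilinearly, so each has half the
dimension of ℂ²ᵐ. -/
lemma finrank_upperSpace (hT : ∀ r : ℝ, ¬ End.HasEigenvalue (Matrix.toLin' T) r) :
    finrank ℂ (upperSpace T) = m := by
  have h1 := Submodule.finrank_add_eq_of_isCompl (isCompl_upperSpace_lowerSpace hT)
  let j : upperSpace T ≃+ lowerSpace T :=
    { toFun := fun z => ⟨star z.1, star_mem_lowerSpace z.2⟩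
      invFun := fun z => ⟨star z.1, star_mem_upperSpace z.2⟩
      left_inv := fun z => by simp
      right_inv := fun z => by simp
      map_add' := fun z w => by ext; simp }
  have h2 := rank_eq_of_equiv_equiv (starRingEnd ℂ) j (Function.Involutive.bijective Complex.conj_conj)
    (fun r z => Subtype.ext (by simp [j]))
  have h3 : finrank ℂ (upperSpace T) = finrank ℂ (lowerSpace T) := by
    rw [finrank, finrank, h2]
  rw [← h3] at h1
  simp at h1
  omega

lemma mapsTo_upperSpace {z : Fin m × Fin 2 → ℂ} (hz : z ∈ upperSpace T) :
    complexEnd T z ∈ upperSpace T := by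
  have : upperSpace T ≤ (upperSpace T).comap (complexEnd T) := by
    refine upperSpace_le fun μ hμ z hz => ?_
    exact le_upperSpace hμ (End.mapsTo_maxGenEigenspace_of_comm (Commute.refl _) μ hz)
  exact this hz

/-- The contraction `z ↦ (z_{p,0} - i z_{p,1})_p`, whose kernel is the `i`-eigenspace of `J₀`. -/
noncomputable def antiContraction : (Fin m × Fin 2 → ℂ) →ₗ[ℂ] (Fin m → ℂ) where
  toFun z p := z (p, 0) - Complex.I * z (p, 1)
  map_add' z w := by
    funext p
    simp
    ring
  map_smul' c z := by
    funext p
    simp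
    ring

/-- The contraction identifies the quotient by the i-eigenspace of J₀ with ℂᵐ; on it the
complexification of the complex matrix τ acts as τ̄. Hence upper eigenvalues of the complexification
can only come from τ itself when τ̄ has none. -/
lemma antiContraction_complexEnd (τ : CMatrix m) (z : Fin m × Fin 2 → ℂ) :
    antiContraction (complexEnd (ofParts τ 0) z) = (conjM τ).mulVec (antiContraction z) := by
  funext p
  simp only [antiContraction, LinearMap.coe_mk, AddHom.coe_mk, complexEnd_apply,
    Fintype.sum_prod_type, Fin.sum_univ_two, Matrix.mulVec, dotProduct, conjM_apply]
  rw [Finset.mul_sum, ← Finset.sum_sub_distrib]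
  refine Finset.sum_congr rfl fun q _ => ?_
  have : conj (τ p q) = ((τ p q).re : ℂ) - (τ p q).im * Complex.I := by
    apply Complex.ext <;> simp
  rw [this]
  simp [ofParts]
  linear_combination (-((τ p q).im : ℂ) * z (q, 1)) * Complex.I_sq

lemma complexEnd_stdJ_eq_iff {z : Fin m × Fin 2 → ℂ} :
    complexEnd (stdJ m) z = Complex.I • z ↔ antiContraction z = 0 := by
  have h0 : ∀ p, complexEnd (stdJ m) z (p, 0) = -z (p, 1) := fun p => by
    simp [complexEnd_apply, Fintype.sum_prod_type, stdJ, Matrix.kroneckerMap_apply,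
      Matrix.one_apply, apply_ite Complex.ofReal, ite_mul]
  have h1 : ∀ p, complexEnd (stdJ m) z (p, 1) = z (p, 0) := fun p => by
    simp [complexEnd_apply, Fintype.sum_prod_type, stdJ, Matrix.kroneckerMap_apply,
      Matrix.one_apply, apply_ite Complex.ofReal, ite_mul]
  constructor
  · intro h
    funext p
    have := congrFun h (p, 1)
    rw [h1] at this
    simp [antiContraction, this]
  · intro h
    have hp : ∀ p, z (p, 0) = Complex.I * z (p, 1) := fun p => sub_eq_zero.1 (congrFun h p)
    funext ⟨p, ε⟩
    fin_cases ε
    · simp only [Fin.zero_eta, h0, Pi.smul_apply, smul_eq_mul, hp]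
      linear_combination (-z (p, 1)) * Complex.I_sq
    · simp only [Fin.mk_one, h1, Pi.smul_apply, smul_eq_mul, hp]

lemma ext_of_complexEnd {A B : BlockMatrix m} (h : complexEnd A = complexEnd B) : A = B := by
  ext a b
  have := congrFun (congrFun (congrArg DFunLike.coe h) (Pi.single b 1)) a
  simpa [complexEnd_apply, Pi.single_apply] using this

/-- J₀ is the scalar i on each upper generalized eigenspace, which T preserves, so the commutator
vanishes on the upper space; by reality it vanishes on the lower space too. -/
lemma IsAssociatedComplexStructure.commute
    (h : IsAssociatedComplexStructure T (stdJ m)) : stdJ m * T = T * stdJ m := by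
  obtain ⟨hT, hJ⟩ := h
  refine ext_of_complexEnd ?_
  rw [complexEnd_mul, complexEnd_mul, ← sub_eq_zero, ← LinearMap.ker_eq_top]
  set D := complexEnd (stdJ m) * complexEnd T - complexEnd T * complexEnd (stdJ m) with hD
  have hup : upperSpace T ≤ LinearMap.ker D := by
    refine upperSpace_le fun μ hμ z hz => ?_
    have h1 : complexEnd (stdJ m) z = Complex.I • z := hJ μ hμ z hz
    have h2 : complexEnd (stdJ m) (complexEnd T z) = Complex.I • complexEnd T z :=
      hJ μ hμ _ (End.mapsTo_maxGenEigenspace_of_comm (Commute.refl _) μ hz)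
    rw [LinearMap.mem_ker, hD, LinearMap.sub_apply, Module.End.mul_apply, Module.End.mul_apply, h1,
      h2, map_smul, sub_self]
  have hlow : lowerSpace T ≤ LinearMap.ker D := by
    intro z hz
    have h1 := hup (star_mem_upperSpace hz)
    rw [LinearMap.mem_ker, hD, LinearMap.sub_apply, Module.End.mul_apply, Module.End.mul_apply,
      complexEnd_star, complexEnd_star, complexEnd_star, complexEnd_star, ← star_sub,
      star_eq_zero] at h1
    exact h1
  rw [eq_top_iff, ← (isCompl_upperSpace_lowerSpace hT).sup_eq_top]
  exact sup_le hup hlow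

lemma antiContraction_apply_pow (τ : CMatrix m) (μ : ℂ) (k : ℕ) (z : Fin m × Fin 2 → ℂ) :
    antiContraction
      (((complexEnd (ofParts τ 0) - μ • (1 : End ℂ (Fin m × Fin 2 → ℂ))) ^ k) z) =
      ((conjM τ - μ • (1 : CMatrix m)) ^ k).mulVec (antiContraction z) := by
  induction k generalizing z with
  | zero => simp
  | succ k ih =>
    rw [pow_succ, pow_succ, Module.End.mul_apply, ih, ← Matrix.mulVec_mulVec]
    congr 1
    rw [LinearMap.sub_apply, map_sub, antiContraction_complexEnd, Matrix.sub_mulVec]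
    simp [Matrix.smul_mulVec]

/-- The matrices with associated complex structure `J₀` are the complex matrices with spectrum in
the upper half-plane. -/
lemma isAssociatedComplexStructure_stdJ_iff :
    IsAssociatedComplexStructure T (stdJ m) ↔ aPart T = 0 ∧ UpperSpectrum (cPart T) := by
  constructor
  · intro h
    have ha := aPart_eq_zero_of_commute h.commute
    refine ⟨ha, upperSpectrum_iff.2 fun ζ hζ v hv => ?_⟩
    have hT : T = ofParts (cPart T) 0 := by rw [← ha, ofParts_parts]
    set τ := cPart T
    -- The conjugate of v, placed in the -i-eigenspace of J₀, is an eigenvector of the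
    -- complexification with eigenvalue ζ̄. If Im ζ̄ > 0 it must also lie in the i-eigenspace; if ζ
    -- is real it contradicts the absence of real eigenvalues.
    set z : Fin m × Fin 2 → ℂ := fun a => ![conj (v a.1), Complex.I * conj (v a.1)] a.2 with hz
    have hvz : ∀ p, z (p, 0) = conj (v p) := fun p => rfl
    have hvz' : ∀ p, z (p, 1) = Complex.I * conj (v p) := fun p => rfl
    have hTz : complexEnd T z = conj ζ • z := by
      have hconj : ∀ p, ∑ q, conj (τ p q) * conj (v q) = conj ζ * conj (v p) := fun p => by
        have := congrArg conj (congrFun hv p)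
        simpa [Matrix.mulVec, dotProduct] using this
      rw [hT]
      funext ⟨p, ε⟩
      have e : ∀ q, conj (τ p q) = ((τ p q).re : ℂ) - (τ p q).im * Complex.I := fun q => by
        apply Complex.ext <;> simp
      fin_cases ε
      · simp only [Fin.zero_eta, complexEnd_apply, Fintype.sum_prod_type, Fin.sum_univ_two, hvz,
          hvz', Pi.smul_apply, smul_eq_mul, ← hconj, e]
        refine Finset.sum_congr rfl fun q _ => ?_
        simp [ofParts]
        ring
      · simp only [Fin.mk_one, complexEnd_apply, Fintype.sum_prod_type, Fin.sum_univ_two, hvz,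
          hvz', Pi.smul_apply, smul_eq_mul]
        rw [mul_left_comm, ← hconj, Finset.mul_sum]
        refine Finset.sum_congr rfl fun q _ => ?_
        simp [ofParts, e]
        linear_combination (((τ p q).im : ℂ) * conj (v q)) * Complex.I_sq
    have hz0 : z = 0 := by
      rcases hζ.lt_or_eq with h1 | h1
      · have h2 : complexEnd (stdJ m) z = Complex.I • z := by
          refine h.2 (conj ζ) (by simpa using h1) z ?_
          exact End.eigenspace_le_maxGenEigenspace (End.mem_eigenspace_iff.2 hTz)
        have h3 := complexEnd_stdJ_eq_iff.1 h2
        have h4 : ∀ p, conj (v p) = 0 := fun p => by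
          have h5 := congrFun h3 p
          simp only [antiContraction, LinearMap.coe_mk, AddHom.coe_mk, hvz, hvz',
            Pi.zero_apply] at h5
          linear_combination h5 / 2 + (conj (v p) / 2) * Complex.I_sq
        funext ⟨p, ε⟩
        fin_cases ε <;> simp [hz, h4]
      · refine eq_zero_of_complexEnd_eq_smul h.1 (r := ζ.re) ?_
        rw [hTz]
        congr 1
        apply Complex.ext <;> simp [h1]
    funext p
    have := hvz p
    rw [hz0] at this
    simpa using this.symm
  · rintro ⟨ha, hup⟩
    have hT : T = ofParts (cPart T) 0 := by rw [← ha, ofParts_parts]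
    set τ := cPart T
    have hup' := upperSpectrum_iff.1 hup
    have hdet : ∀ μ : ℂ, 0 ≤ μ.im → IsUnit (conjM τ - μ • (1 : CMatrix m)) := fun μ hμ => by
      rw [Matrix.isUnit_iff_isUnit_det, isUnit_iff_ne_zero]
      have : conjM τ - μ • (1 : CMatrix m) = conjM (τ - conj μ • (1 : CMatrix m)) := by
        simp [conjM_sub, conjM_smul]
      rw [this, det_conjM]
      simpa using hup (conj μ) (by simpa using hμ)
    constructor
    · intro r hr
      obtain ⟨u, hu⟩ := hr.exists_hasEigenvector
      rw [End.hasEigenvector_iff, End.mem_eigenspace_iff] at hu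
      refine hu.2 ?_
      set z : Fin m × Fin 2 → ℂ := fun a => (u a : ℂ) with hz
      have hTz : complexEnd T z = (r : ℂ) • z := by
        funext a
        have := congrArg (fun x : ℝ => (x : ℂ)) (congrFun hu.1 a)
        simpa [complexEnd_apply, Matrix.mulVec, dotProduct, hz] using this
      have h1 := antiContraction_complexEnd τ z
      rw [← hT, hTz, map_smul] at h1
      have h2 : (conjM τ - (r : ℂ) • (1 : CMatrix m)).mulVec (antiContraction z) = 0 := by
        rw [Matrix.sub_mulVec, ← h1, Matrix.smul_mulVec, Matrix.one_mulVec, sub_self]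
      have h3 : antiContraction z = 0 :=
        (Matrix.mulVec_injective_of_isUnit (hdet r (by simp))) (by rw [h2, Matrix.mulVec_zero])
      funext ⟨p, ε⟩
      have h4 := congrFun h3 p
      have hre := congrArg Complex.re h4
      have him := congrArg Complex.im h4
      simp [antiContraction, hz] at hre him
      fin_cases ε
      · exact hre
      · exact him
    · intro μ hμ z hz
      refine complexEnd_stdJ_eq_iff.2 ?_
      obtain ⟨k, hk⟩ := (End.mem_maxGenEigenspace _ _ _).1 hz
      have h1 := antiContraction_apply_pow τ μ k z
      rw [← hT] at h1
      -- The contraction of an upper generalized eigenvector is killed by a power of τ̄ - μ, which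
      -- is invertible; so the vector lies in the i-eigenspace of J₀.
      have h2 : ((conjM τ - μ • (1 : CMatrix m)) ^ k).mulVec (antiContraction z) = 0 := by
        rw [← h1]
        erw [hk]
        rw [map_zero]
      exact (Matrix.mulVec_injective_of_isUnit ((hdet μ hμ.le).pow k))
        (by rw [h2, Matrix.mulVec_zero])

end Associated

end GreatCircle

namespace GreatCircle

/-! ### Conjugation to the normal form `J₀`, for one matrix and for smooth families. -/

section Associated

open Matrix ComplexConjugate

variable {m : ℕ}

/-- A real matrix without real eigenvalues is conjugate to a complex matrix with spectrum in the
upper half-plane. -/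
lemma exists_conj_isAssociated {T : BlockMatrix m}
    (hT : ∀ r : ℝ, ¬ End.HasEigenvalue (Matrix.toLin' T) r) :
    ∃ M : BlockMatrix m, M.det ≠ 0 ∧ IsAssociatedComplexStructure (M⁻¹ * T * M) (stdJ m) := by
  let u : Basis (Fin m) ℂ (upperSpace T) := finBasisOfFinrankEq ℂ _ (finrank_upperSpace hT)
  set U : Fin m → Fin m × Fin 2 → ℂ := fun p => (u p : Fin m × Fin 2 → ℂ) with hU
  -- For a basis Uₚ of the upper space the columns are Re Uₚ and -Im Uₚ, so that M c is the real
  -- part of ∑ cₚUₚ with cₚ = c_{p,0} + i c_{p,1}. Then T becomes the complex matrix of its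
  -- restriction to the upper space.
  set M : BlockMatrix m := Matrix.of fun a b => ![(U b.1 a).re, -(U b.1 a).im] b.2 with hM
  set lin : (Fin m → ℂ) → Fin m × Fin 2 → ℂ := fun v => ∑ p, v p • U p with hlin
  have hmem : ∀ v, lin v ∈ upperSpace T := fun v =>
    Submodule.sum_mem _ fun p _ => Submodule.smul_mem _ _ (u p).2
  have hinj : ∀ v, lin v = 0 → v = 0 := by
    intro v hv
    have h1 : ∑ p, v p • u p = 0 := Subtype.ext (by simpa [hlin, hU] using hv)
    exact funext fun p => Fintype.linearIndependent_iff.1 u.linearIndependent v h1 p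
  have hre : ∀ (c : Fin m × Fin 2 → ℝ) a,
      (lin (fun p => ⟨c (p, 0), c (p, 1)⟩) a).re = M.mulVec c a := by
    intro c a
    simp only [hlin, Finset.sum_apply, Complex.re_sum, Pi.smul_apply, smul_eq_mul, Complex.mul_re,
      Matrix.mulVec, dotProduct, Fintype.sum_prod_type, Fin.sum_univ_two]
    refine Finset.sum_congr rfl fun p _ => ?_
    simp [hM]
    ring
  have hdet : M.det ≠ 0 := by
    rw [Ne, ← Matrix.exists_mulVec_eq_zero_iff]
    rintro ⟨c, hc, hMc⟩
    set y := lin (fun p => ⟨c (p, 0), c (p, 1)⟩) with hy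
    -- A vector of the upper space with zero real part is minus its conjugate, hence also in the
    -- lower space.
    have h1 : star y = -y := by
      funext a
      have := hre c a
      rw [hMc] at this
      apply Complex.ext
      · simp [hy, this]
      · simp
    have h2 : y ∈ lowerSpace T := by
      have := star_mem_lowerSpace (hmem (fun p => ⟨c (p, 0), c (p, 1)⟩))
      rw [← hy, h1] at this
      simpa using this
    have h3 : y = 0 := Submodule.disjoint_def.1 (isCompl_upperSpace_lowerSpace hT).disjoint y
      (hmem _) h2
    have h4 := hinj _ h3
    refine hc (funext fun a => ?_)
    obtain ⟨p, ε⟩ := a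
    have h5 := congrFun h4 p
    fin_cases ε
    · exact congrArg Complex.re h5
    · exact congrArg Complex.im h5
  set τ : CMatrix m := Matrix.of fun q p => u.repr ⟨complexEnd T (U p), mapsTo_upperSpace (u p).2⟩ q
    with hτ
  have hTU : ∀ p, complexEnd T (U p) = ∑ q, τ q p • U q := by
    intro p
    have := congrArg Subtype.val (u.sum_repr ⟨complexEnd T (U p), mapsTo_upperSpace (u p).2⟩)
    simp only [Submodule.coe_sum, Submodule.coe_smul] at this
    exact this.symm
  have hTM : T * M = M * ofParts τ 0 := by
    ext a ⟨p, ε⟩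
    have h1 := congrFun (hTU p) a
    rw [complexEnd_apply] at h1
    fin_cases ε
    · have h2 := congrArg Complex.re h1
      simp only [Complex.re_sum, Finset.sum_apply, Pi.smul_apply, smul_eq_mul, Complex.mul_re,
        Complex.ofReal_re, Complex.ofReal_im, zero_mul, sub_zero] at h2
      simp only [Fin.zero_eta, Matrix.mul_apply]
      rw [show ∑ j, T a j * M j (p, 0) = ∑ j, T a j * (U p j).re from rfl, h2,
        Fintype.sum_prod_type]
      refine Finset.sum_congr rfl fun q _ => ?_
      simp [hM, ofParts]
      ring
    · have h2 := congrArg Complex.im h1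
      simp only [Complex.im_sum, Finset.sum_apply, Pi.smul_apply, smul_eq_mul, Complex.mul_im,
        Complex.ofReal_re, Complex.ofReal_im, zero_mul, add_zero] at h2
      simp only [Fin.mk_one, Matrix.mul_apply]
      rw [show ∑ j, T a j * M j (p, 1) = -∑ j, T a j * (U p j).im by
        rw [← Finset.sum_neg_distrib]
        exact Finset.sum_congr rfl fun j _ => by simp [hM], h2, Fintype.sum_prod_type,
        ← Finset.sum_neg_distrib]
      refine Finset.sum_congr rfl fun q _ => ?_
      simp [hM, ofParts]
      ring
  refine ⟨M, hdet, ?_⟩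
  rw [mul_assoc, hTM, ← mul_assoc, Matrix.nonsing_inv_mul _ hdet.isUnit, one_mul,
    isAssociatedComplexStructure_stdJ_iff]
  refine ⟨aPart_ofParts _ _, ?_⟩
  rw [cPart_ofParts, upperSpectrum_iff]
  intro ζ hζ v hv
  refine hinj v ?_
  have h1 : complexEnd T (lin v) = ζ • lin v := by
    simp only [hlin, map_sum, map_smul, hTU]
    simp only [Finset.smul_sum, smul_smul]
    rw [Finset.sum_comm]
    refine Finset.sum_congr rfl fun q _ => ?_
    rw [← Finset.sum_smul]
    congr 1
    have := congrFun hv q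
    simp only [Matrix.mulVec, dotProduct, Pi.smul_apply, smul_eq_mul] at this
    rw [← this]
    exact Finset.sum_congr rfl fun _ _ => mul_comm _ _
  have h2 : lin v ∈ (complexEnd T).maxGenEigenspace ζ :=
    End.eigenspace_le_maxGenEigenspace (End.mem_eigenspace_iff.2 h1)
  rcases hζ.lt_or_eq with h | h
  · exact Submodule.disjoint_def.1 (isCompl_upperSpace_lowerSpace hT).disjoint _ (hmem v)
      (le_lowerSpace h h2)
  · rwa [maxGenEigenspace_ofReal_eq_bot hT h] at h2

/-- A matrix conjugating two matrices with associated complex structure `J₀` is complex. -/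
lemma aPart_eq_zero_of_isAssociated {T T' N : BlockMatrix m}
    (h : IsAssociatedComplexStructure T (stdJ m)) (h' : IsAssociatedComplexStructure T' (stdJ m))
    (hN : T * N = N * T') : aPart N = 0 := by
  rw [isAssociatedComplexStructure_stdJ_iff] at h h'
  refine h.2.eq_zero_of_mul_eq h'.2 ?_
  have := congrArg aPart hN
  rw [aPart_mul, aPart_mul, h.1, h'.1] at this
  simpa using this

/-- A smooth family of matrices can be conjugated smoothly so as to have associated complex
structure `J₀`, if one member of the family has. -/
lemma exists_smooth_conj_isAssociated {E : Type*} [NormedAddCommGroup E] [NormedSpace ℝ E]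
    [CompleteSpace E] {T : E → BlockMatrix m} {y₀ : E}
    (hT : ∀ i j, ContDiffAt ℝ ∞ (fun y => T y i j) y₀)
    (h : IsAssociatedComplexStructure (T y₀) (stdJ m)) :
    ∃ M : E → BlockMatrix m, M y₀ = 1 ∧ (∀ i j, ContDiffAt ℝ ∞ (fun y => M y i j) y₀) ∧
      ∀ᶠ y in 𝓝 y₀, (M y).det ≠ 0 ∧
        IsAssociatedComplexStructure ((M y)⁻¹ * T y * M y) (stdJ m) := by
  rw [isAssociatedComplexStructure_stdJ_iff] at h
  obtain ⟨ha, hup⟩ := h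
  -- Look for a conjugating matrix 1 + σK₀ with T(1 + σK₀) = (1 + σK₀)τ and τ complex. The linear
  -- part gives τ, and the antilinear part is the equation G = 0 for σ. At `y₀` its linearisation in
  -- σ is the Sylvester operator X ↦ Xτ̄ - τX, which is injective.
  let G : E × (Fin m → Fin m → ℂ) → (Fin m → Fin m → ℂ) := fun q =>
    (Matrix.of q.2 * conjM (cPart (T q.1) + aPart (T q.1) * conjM (Matrix.of q.2)) -
      (cPart (T q.1) * Matrix.of q.2 + aPart (T q.1)) : CMatrix m)
  have hG : ContDiffAt ℝ ∞ G (y₀, 0) := by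
    have hT' : ∀ i j, ContDiffAt ℝ ∞
        (fun q : E × (Fin m → Fin m → ℂ) => T q.1 i j) (y₀, 0) := fun i j =>
      ContDiffAt.comp (g := fun y => T y i j) (f := Prod.fst)
        ((y₀, 0) : E × (Fin m → Fin m → ℂ)) (hT i j) contDiffAt_fst
    have hσ : ∀ i j, ContDiffAt ℝ ∞
        (fun q : E × (Fin m → Fin m → ℂ) => (Matrix.of q.2 : CMatrix m) i j) (y₀, 0) := fun i j =>
      contDiffAt_pi.1 (contDiffAt_pi.1 contDiffAt_snd i) j
    have hc := contDiffAt_cPart hT'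
    have ha := contDiffAt_aPart hT'
    refine contDiffAt_pi.2 fun i => contDiffAt_pi.2 fun j => ?_
    refine ContDiffAt.sub ?_ ?_
    · refine contDiffAt_matrix_mul hσ (contDiffAt_conjM fun i j => ?_) i j
      exact (hc i j).add (contDiffAt_matrix_mul ha (contDiffAt_conjM hσ) i j)
    · exact (contDiffAt_matrix_mul hc hσ i j).add (ha i j)
  have h0 : G (y₀, 0) = 0 := by
    change (Matrix.of 0 * conjM (cPart (T y₀) + aPart (T y₀) * conjM (Matrix.of 0)) -
      (cPart (T y₀) * Matrix.of 0 + aPart (T y₀)) : CMatrix m) = 0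
    rw [ha]
    simp
  obtain ⟨φ, hφ0, hφ, hφG⟩ := exists_contDiffAt_implicit hG h0 fun X hX => by
    let D : Fin m → Fin m → ℂ :=
      (Matrix.of X * conjM (cPart (T y₀)) - cPart (T y₀) * Matrix.of X : CMatrix m)
    have h1 : (fun s : ℝ => G (y₀, 0 + s • X)) = fun s : ℝ => s • D := by
      funext s
      change (Matrix.of (0 + s • X) * conjM (cPart (T y₀) + aPart (T y₀) *
        conjM (Matrix.of (0 + s • X))) -
        (cPart (T y₀) * Matrix.of (0 + s • X) + aPart (T y₀)) : CMatrix m) =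
        s • (Matrix.of X * conjM (cPart (T y₀)) - cPart (T y₀) * Matrix.of X : CMatrix m)
      have : (Matrix.of (0 + s • X) : CMatrix m) = s • (Matrix.of X : CMatrix m) := by
        rw [zero_add]
        rfl
      rw [ha, this]
      simp only [zero_mul, add_zero, smul_sub, Matrix.smul_mul, Matrix.mul_smul]
    rw [h1] at hX
    have h2 : HasDerivAt (fun s : ℝ => s • D) D 0 := by
      simpa using (hasDerivAt_id (0 : ℝ)).smul_const D
    have h3 : (Matrix.of X * conjM (cPart (T y₀)) - cPart (T y₀) * Matrix.of X : CMatrix m) = 0 :=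
      h2.unique hX
    have h4 : (Matrix.of X : CMatrix m) = 0 := hup.eq_zero_of_mul_eq hup (sub_eq_zero.1 h3).symm
    exact h4
  set σ : E → CMatrix m := fun y => Matrix.of (φ y) with hσ
  have hσs : ∀ i j, ContDiffAt ℝ ∞ (fun y => σ y i j) y₀ := fun i j =>
    contDiffAt_pi.1 (contDiffAt_pi.1 hφ i) j
  have hσ0 : σ y₀ = 0 := by
    rw [hσ]
    simp only [hφ0]
    rfl
  set τ : E → CMatrix m := fun y => cPart (T y) + aPart (T y) * conjM (σ y) with hτ
  have hτs : ∀ i j, ContDiffAt ℝ ∞ (fun y => τ y i j) y₀ := by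
    intro i j
    refine ContDiffAt.add (f := fun y => cPart (T y) i j)
      (g := fun y => (aPart (T y) * conjM (σ y)) i j) (contDiffAt_cPart hT i j) ?_
    exact contDiffAt_matrix_mul (contDiffAt_aPart hT) (contDiffAt_conjM hσs) i j
  have hMs := contDiffAt_ofParts (τ := fun _ => (1 : CMatrix m)) (σ := σ) (y₀ := y₀)
    (fun i j => contDiffAt_const (c := (1 : CMatrix m) i j)) hσs
  have hM0 : ofParts (1 : CMatrix m) (σ y₀) = 1 := by
    rw [hσ0]
    exact parts_ext (by simp) (by simp)
  refine ⟨fun y => ofParts 1 (σ y), hM0, hMs, ?_⟩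
  have hτ0 : τ y₀ = cPart (T y₀) := by simp [hτ, ha]
  have hev := UpperSpectrum.eventually (τ := τ) (y₀ := y₀) (fun i j => (hτs i j).continuousAt)
    (by rwa [hτ0])
  have hdet := eventually_det_ne_zero (M := fun y => ofParts 1 (σ y)) hMs (by simp [hM0])
  filter_upwards [hφG, hev, hdet] with y h1 h2 h3
  refine ⟨h3, ?_⟩
  have h4 : σ y * conjM (τ y) = cPart (T y) * σ y + aPart (T y) := sub_eq_zero.1 h1
  have h5 : T y * ofParts 1 (σ y) = ofParts 1 (σ y) * ofParts (τ y) 0 := by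
    apply parts_ext
    · simp [cPart_mul, hτ]
    · simp [aPart_mul, h4]
  rw [mul_assoc, h5, ← mul_assoc, Matrix.nonsing_inv_mul _ h3.isUnit, one_mul,
    isAssociatedComplexStructure_stdJ_iff]
  simpa using h2

end Associated

end GreatCircle

namespace GreatCircle

/-! ### Frames and the Maurer-Cartan form -/

section Frames

open Matrix

variable {n : ℕ}

/-- The right action of invertible matrices on frames. -/
noncomputable def frameMul (g : Frame n) (N : BlockMatrix (n + 1)) : Frame n :=
  if h : N.det ≠ 0 then g.map (Matrix.toLinearEquiv g N h.isUnit) else g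

lemma frameMul_apply (g : Frame n) {N : BlockMatrix (n + 1)} (h : N.det ≠ 0) (b) :
    frameMul g N b = ∑ a, N a b • g a := by
  rw [frameMul, dif_pos h, Basis.map_apply]
  exact Matrix.toLin_self g g N b

@[simp] lemma frameMul_one (g : Frame n) : frameMul g 1 = g := by
  refine Basis.eq_of_apply_eq fun b => ?_
  rw [frameMul_apply g (by simp)]
  simp [Matrix.one_apply]

lemma frameMul_frameMul (g : Frame n) {A B : BlockMatrix (n + 1)} (hA : A.det ≠ 0)
    (hB : B.det ≠ 0) : frameMul (frameMul g A) B = frameMul g (A * B) := by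
  refine Basis.eq_of_apply_eq fun b => ?_
  rw [frameMul_apply _ hB, frameMul_apply _ (by rw [Matrix.det_mul]; exact mul_ne_zero hA hB)]
  simp only [frameMul_apply g hA, Finset.smul_sum, smul_smul, Matrix.mul_apply, Finset.sum_smul]
  rw [Finset.sum_comm]
  exact Finset.sum_congr rfl fun a _ => Finset.sum_congr rfl fun c _ =>
    congrArg (· • g a) (mul_comm _ _)

lemma frameMul_mul_inv (g : Frame n) {A : BlockMatrix (n + 1)} (hA : A.det ≠ 0) :
    frameMul (frameMul g A) A⁻¹ = g := by
  rw [frameMul_frameMul g hA (by simpa [Matrix.det_nonsing_inv] using hA),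
    Matrix.mul_nonsing_inv _ hA.isUnit, frameMul_one]

lemma det_toMatrix_ne_zero (g g' : Frame n) : (g.toMatrix g').det ≠ 0 := by
  have h : g.toMatrix g' * g'.toMatrix g = 1 := by simp
  intro h0
  have := congrArg Matrix.det h
  rw [Matrix.det_mul, h0, Matrix.det_one, zero_mul] at this
  exact zero_ne_one this

@[simp] lemma frameMul_toMatrix (g g' : Frame n) : frameMul g (g.toMatrix g') = g' := by
  refine Basis.eq_of_apply_eq fun b => ?_
  rw [frameMul_apply _ (det_toMatrix_ne_zero g g')]
  exact Basis.sum_toMatrix_smul_self g g' b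

lemma toMatrix_frameMul (g : Frame n) {N : BlockMatrix (n + 1)} (h : N.det ≠ 0) :
    g.toMatrix (frameMul g N) = N := by
  ext a b
  rw [Basis.toMatrix_apply, frameMul_apply g h]
  simp [Finsupp.single_apply]

lemma frameMul_map (g : Frame n) (φ : V n ≃ₗ[ℝ] V n) {N : BlockMatrix (n + 1)} (h : N.det ≠ 0) :
    frameMul (g.map φ) N = (frameMul g N).map φ := by
  refine Basis.eq_of_apply_eq fun b => ?_
  rw [frameMul_apply _ h, Basis.map_apply, frameMul_apply _ h]
  simp

/-- Writing a curve of frames through g as g·N(s) with N(0) = 1, the Maurer-Cartan form is just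
N'(0). -/
lemma mem_maurerCartan_iff {B : Set (Frame n)} {g : Frame n} {A : BlockMatrix (n + 1)} :
    A ∈ maurerCartan B g ↔ ∃ N : ℝ → BlockMatrix (n + 1), N 0 = 1 ∧
      (∀ i j, ContDiffAt ℝ ∞ (fun s => N s i j) 0) ∧ (∀ᶠ s in 𝓝 0, frameMul g (N s) ∈ B) ∧
      ∀ i j, HasDerivAt (fun s => N s i j) (A i j) 0 := by
  constructor
  · rintro ⟨γ, h0, hB, hγ, rfl⟩
    have hL : ∀ a (v : V n), g.repr v a = (g.coord a).toContinuousLinearMap v := fun a v => rfl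
    have hγb : ∀ b, ContDiffAt ℝ ∞ (fun s => γ s b) 0 := fun b => contDiffAt_pi.1 hγ b
    refine ⟨fun s => g.toMatrix (γ s), by simp [h0], fun i j => ?_, by simpa using hB,
      fun i j => ?_⟩
    · simp only [Basis.toMatrix_apply, hL]
      exact (ContinuousLinearMap.contDiff _).contDiffAt.comp (0 : ℝ) (hγb j)
    · simp only [Basis.toMatrix_apply, hL]
      exact (ContinuousLinearMap.hasFDerivAt _).comp_hasDerivAt (0 : ℝ)
        ((hγb j).differentiableAt (by simp)).hasDerivAt
  · rintro ⟨N, h0, hN, hB, hA⟩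
    have hdet : ∀ᶠ s in 𝓝 (0 : ℝ), (N s).det ≠ 0 := eventually_det_ne_zero hN (by simp [h0])
    have heq : ∀ b, (fun s => frameMul g (N s) b) =ᶠ[𝓝 0] fun s => ∑ a, N s a b • g a := fun b => by
      filter_upwards [hdet] with s hs
      exact frameMul_apply g hs b
    refine ⟨fun s => frameMul g (N s), by simp [h0], hB, contDiffAt_pi.2 fun b => ?_, ?_⟩
    · refine ContDiffAt.congr_of_eventuallyEq ?_ (heq b)
      exact ContDiffAt.sum fun a _ => (hN a b).smul contDiffAt_const
    · ext a b
      rw [(heq b).deriv_eq, (HasDerivAt.fun_sum fun a _ => (hA a b).smul_const (g a)).deriv]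
      simp [Finsupp.single_apply]

lemma maurerCartan_mono {B B' : Set (Frame n)} (h : B ⊆ B') (g : Frame n) :
    maurerCartan B g ⊆ maurerCartan B' g := by
  rintro A ⟨γ, h0, hB, hγ, hA⟩
  exact ⟨γ, h0, hB.mono fun s hs => h hs, hγ, hA⟩

lemma hasDerivAt_const_mul_mul {N : ℝ → BlockMatrix (n + 1)} {A P Q : BlockMatrix (n + 1)}
    (hA : ∀ i j, HasDerivAt (fun s => N s i j) (A i j) 0) (i j) :
    HasDerivAt (fun s => (P * N s * Q) i j) ((P * A * Q) i j) 0 := by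
  simp only [Matrix.mul_apply]
  exact HasDerivAt.fun_sum fun k _ => (HasDerivAt.fun_sum fun l _ =>
    (hA l k).const_mul (P i l)).mul_const (Q k j)

/-- Right translation acts on g⁻¹dg by conjugation: the curve g·N(s)·M is (g·M)·(M⁻¹N(s)M). -/
lemma maurerCartan_frameMul {B B' : Set (Frame n)} {g : Frame n} {A M : BlockMatrix (n + 1)}
    (hM : M.det ≠ 0) (hB : ∀ g ∈ B, frameMul g M ∈ B') (hA : A ∈ maurerCartan B g) :
    M⁻¹ * A * M ∈ maurerCartan B' (frameMul g M) := by
  rw [mem_maurerCartan_iff] at hA ⊢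
  obtain ⟨N, h0, hN, hNB, hNA⟩ := hA
  have hdet : ∀ᶠ s in 𝓝 (0 : ℝ), (N s).det ≠ 0 := eventually_det_ne_zero hN (by simp [h0])
  have hc : ∀ (P : BlockMatrix (n + 1)) i j, ContDiffAt ℝ ∞ (fun _ : ℝ => P i j) 0 :=
    fun P i j => contDiffAt_const
  refine ⟨fun s => M⁻¹ * N s * M, ?_, ?_, ?_, hasDerivAt_const_mul_mul hNA⟩
  · beta_reduce
    rw [h0, mul_one, Matrix.nonsing_inv_mul _ hM.isUnit]
  · exact contDiffAt_matrix_mul (contDiffAt_matrix_mul (hc _) hN) (hc _)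
  · filter_upwards [hNB, hdet] with s hs hs'
    have hM' : (M⁻¹).det ≠ 0 := by simpa [Matrix.det_nonsing_inv] using hM
    have h3 : (M⁻¹ * N s * M).det ≠ 0 := by
      rw [Matrix.det_mul, Matrix.det_mul]
      exact mul_ne_zero (mul_ne_zero hM' hs') hM
    rw [frameMul_frameMul g hM h3, ← mul_assoc, ← mul_assoc, Matrix.mul_nonsing_inv _ hM.isUnit,
      one_mul, ← frameMul_frameMul g hs' hM]
    exact hB _ hs

/-- The form g⁻¹dg does not see linear maps applied to the whole frame; this is the source of
equivariance. -/
lemma maurerCartan_map {B B' : Set (Frame n)} {g : Frame n} {φ : V n ≃ₗ[ℝ] V n}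
    (hB : ∀ g ∈ B, g.map φ ∈ B') {A : BlockMatrix (n + 1)} (hA : A ∈ maurerCartan B g) :
    A ∈ maurerCartan B' (g.map φ) := by
  rw [mem_maurerCartan_iff] at hA ⊢
  obtain ⟨N, h0, hN, hNB, hNA⟩ := hA
  have hdet : ∀ᶠ s in 𝓝 (0 : ℝ), (N s).det ≠ 0 := eventually_det_ne_zero hN (by simp [h0])
  refine ⟨N, h0, hN, ?_, hNA⟩
  filter_upwards [hNB, hdet] with s hs hs'
  rw [frameMul_map _ _ hs']
  exact hB _ hs

/-- Block diagonal matrices, with blocks indexed by `{0}` and `{1, …, n}`. -/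
def blockDiag (h : Matrix (Fin 2) (Fin 2) ℝ) (M : BlockMatrix n) : BlockMatrix (n + 1) :=
  Matrix.of fun a b => Fin.cases (motive := fun _ => ℝ)
    (Fin.cases (motive := fun _ => ℝ) (h a.2 b.2) (fun _ => 0) b.1)
    (fun p => Fin.cases (motive := fun _ => ℝ) 0 (fun q => M (p, a.2) (q, b.2)) b.1) a.1

section

variable (h : Matrix (Fin 2) (Fin 2) ℝ) (M : BlockMatrix n) (p q : Fin n) (ε δ : Fin 2)

@[simp] lemma blockDiag_zero_zero : blockDiag h M (0, ε) (0, δ) = h ε δ := rfl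
@[simp] lemma blockDiag_zero_succ : blockDiag h M (0, ε) (q.succ, δ) = 0 := rfl
@[simp] lemma blockDiag_succ_zero : blockDiag h M (p.succ, ε) (0, δ) = 0 := rfl
@[simp] lemma blockDiag_succ_succ :
    blockDiag h M (p.succ, ε) (q.succ, δ) = M (p, ε) (q, δ) := rfl

end

lemma blockDiag_mul (h h' : Matrix (Fin 2) (Fin 2) ℝ) (M M' : BlockMatrix n) :
    blockDiag h M * blockDiag h' M' = blockDiag (h * h') (M * M') := by
  ext ⟨a, ε⟩ ⟨b, δ⟩
  refine Fin.cases ?_ (fun p => ?_) a <;> refine Fin.cases ?_ (fun q => ?_) b <;>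
    simp [Matrix.mul_apply, Fintype.sum_prod_type, Fin.sum_univ_succ]

lemma blockDiag_one : blockDiag (1 : Matrix (Fin 2) (Fin 2) ℝ) (1 : BlockMatrix n) = 1 := by
  ext ⟨a, ε⟩ ⟨b, δ⟩
  refine Fin.cases ?_ (fun p => ?_) a <;> refine Fin.cases ?_ (fun q => ?_) b <;>
    simp [Matrix.one_apply, Fin.succ_ne_zero, (Fin.succ_ne_zero _).symm]

lemma det_blockDiag_ne_zero {h : Matrix (Fin 2) (Fin 2) ℝ} {M : BlockMatrix n} (hh : h.det ≠ 0)
    (hM : M.det ≠ 0) : (blockDiag h M).det ≠ 0 := by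
  have : blockDiag h M * blockDiag h⁻¹ M⁻¹ = 1 := by
    rw [blockDiag_mul, Matrix.mul_nonsing_inv _ hh.isUnit, Matrix.mul_nonsing_inv _ hM.isUnit,
      blockDiag_one]
  intro h0
  have := congrArg Matrix.det this
  rw [Matrix.det_mul, h0, Matrix.det_one, zero_mul] at this
  exact zero_ne_one this

/-- The upper left `2 × 2` block. -/
def headBlock (N : BlockMatrix (n + 1)) : Matrix (Fin 2) (Fin 2) ℝ :=
  Matrix.of fun ε δ => N (0, ε) (0, δ)

/-- The lower right block. -/
def tailBlock (N : BlockMatrix (n + 1)) : BlockMatrix n :=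
  Matrix.of fun a b => N (a.1.succ, a.2) (b.1.succ, b.2)

/-- The part of the column `(0, δ)` below the head block. -/
def tailCol (N : BlockMatrix (n + 1)) (δ : Fin 2) : Fin n × Fin 2 → ℝ :=
  fun i => N (i.1.succ, i.2) (0, δ)

/-- The invertible matrices mapping the oriented plane spanned by the first two basis vectors to
itself. -/
structure IsParabolic (N : BlockMatrix (n + 1)) : Prop where
  det_ne_zero : N.det ≠ 0
  tailCol_eq_zero : ∀ δ, tailCol N δ = 0
  head_pos : 0 < (headBlock N).det

lemma IsParabolic.apply_succ_zero {N : BlockMatrix (n + 1)} (hN : IsParabolic N) (p ε δ) :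
    N (Fin.succ p, ε) (0, δ) = 0 := congrFun (hN.tailCol_eq_zero δ) (p, ε)

/-- A left null vector of the tail block, extended by zero, is a left null vector of N because the
lower left block vanishes. -/
lemma IsParabolic.det_tail_ne_zero {N : BlockMatrix (n + 1)} (hN : IsParabolic N) :
    (tailBlock N).det ≠ 0 := by
  rw [Ne, ← Matrix.exists_vecMul_eq_zero_iff]
  rintro ⟨u, hu, hu0⟩
  refine hN.det_ne_zero ?_
  rw [← Matrix.exists_vecMul_eq_zero_iff]
  refine ⟨fun a => Fin.cases (motive := fun _ => ℝ) 0 (fun p => u (p, a.2)) a.1, fun h => hu ?_, ?_⟩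
  · funext ⟨p, ε⟩
    exact congrFun h (p.succ, ε)
  · funext ⟨b, δ⟩
    refine Fin.cases ?_ (fun q => ?_) b
    · simp [Matrix.vecMul, dotProduct, Fintype.sum_prod_type, Fin.sum_univ_succ,
        hN.apply_succ_zero]
    · have := congrFun hu0 (q, δ)
      simpa [Matrix.vecMul, dotProduct, Fintype.sum_prod_type, Fin.sum_univ_succ,
        tailBlock] using this

lemma isParabolic_blockDiag {h : Matrix (Fin 2) (Fin 2) ℝ} {M : BlockMatrix n} (hh : 0 < h.det)
    (hM : M.det ≠ 0) : IsParabolic (blockDiag h M) :=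
  ⟨det_blockDiag_ne_zero hh.ne' hM, fun _ => rfl, hh⟩

@[simp] lemma tailBlock_blockDiag (h : Matrix (Fin 2) (Fin 2) ℝ) (M : BlockMatrix n) :
    tailBlock (blockDiag h M) = M := rfl

/-- The lower left block transforms by `m⁻¹ (·) h` under conjugation with a parabolic matrix. -/
lemma IsParabolic.tailBlock_mulVec_tailCol {N A : BlockMatrix (n + 1)} (hN : IsParabolic N) (δ) :
    (tailBlock N).mulVec (tailCol (N⁻¹ * A * N) δ) =
      N (0, 0) (0, δ) • tailCol A 0 + N (0, 1) (0, δ) • tailCol A 1 := by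
  have h : N * (N⁻¹ * A * N) = A * N := by
    rw [← mul_assoc, ← mul_assoc, Matrix.mul_nonsing_inv _ hN.det_ne_zero.isUnit, one_mul]
  funext ⟨p, ε⟩
  have h1 := congrFun (congrFun h (p.succ, ε)) (0, δ)
  rw [Matrix.mul_apply, Matrix.mul_apply, Fintype.sum_prod_type, Fintype.sum_prod_type] at h1
  simp only [Fin.sum_univ_two, Fin.sum_univ_succ (n := n), hN.apply_succ_zero, zero_mul, mul_zero,
    Finset.sum_const_zero, zero_add, add_zero] at h1
  simp only [Matrix.mulVec, dotProduct, Fintype.sum_prod_type, tailBlock, tailCol, Matrix.of_apply,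
    Pi.add_apply, Pi.smul_apply, smul_eq_mul, Fin.sum_univ_two]
  rw [h1]
  ring

end Frames

/-! ### Positive frames of oriented planes. -/

namespace OrientedPlane

variable {n : ℕ} {P Q : OrientedPlane n} {u v u' v' : V n}

lemma IsPositiveFrame.mem_left (h : P.IsPositiveFrame u v) : u ∈ P.carrier := by
  obtain ⟨b, rfl, -, -⟩ := h
  exact (b 0).2

lemma IsPositiveFrame.mem_right (h : P.IsPositiveFrame u v) : v ∈ P.carrier := by
  obtain ⟨b, -, rfl, -⟩ := h
  exact (b 1).2

lemma IsPositiveFrame.eq_zero_of_add_eq_zero (h : P.IsPositiveFrame u v) {a b : ℝ}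
    (hab : a • u + b • v = 0) : a = 0 ∧ b = 0 := by
  obtain ⟨e, rfl, rfl, -⟩ := h
  have h1 : a • e 0 + b • e 1 = 0 := Subtype.ext (by simpa using hab)
  have h2 := Fintype.linearIndependent_iff.1 e.linearIndependent ![a, b] (by
    simpa [Fin.sum_univ_two] using h1)
  exact ⟨h2 0, h2 1⟩

lemma IsPositiveFrame.exists_of_mem (h : P.IsPositiveFrame u v) {w : V n} (hw : w ∈ P.carrier) :
    ∃ a b : ℝ, w = a • u + b • v := by
  obtain ⟨e, rfl, rfl, -⟩ := h
  refine ⟨e.repr ⟨w, hw⟩ 0, e.repr ⟨w, hw⟩ 1, ?_⟩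
  have := congrArg Subtype.val (e.sum_repr ⟨w, hw⟩)
  rw [Fin.sum_univ_two] at this
  exact this.symm

lemma IsPositiveFrame.carrier_eq_span (h : P.IsPositiveFrame u v) :
    P.carrier = Submodule.span ℝ {u, v} := by
  refine le_antisymm (fun w hw => ?_) (Submodule.span_le.2 ?_)
  · obtain ⟨a, b, rfl⟩ := h.exists_of_mem hw
    exact Submodule.mem_span_pair.2 ⟨a, b, rfl⟩
  · rintro w (rfl | rfl)
    · exact h.mem_left
    · exact h.mem_right

lemma IsPositiveFrame.left_ne_zero (h : P.IsPositiveFrame u v) : u ≠ 0 := by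
  rintro rfl
  have := h.eq_zero_of_add_eq_zero (a := 1) (b := 0) (by simp)
  simp at this

lemma isPositiveFrame_combination_iff (h : P.IsPositiveFrame u v) {a b c d : ℝ} :
    P.IsPositiveFrame (a • u + b • v) (c • u + d • v) ↔ 0 < a * d - b * c := by
  obtain ⟨e, rfl, rfl, he⟩ := h
  have hdet : ∀ e' : Basis (Fin 2) ℝ P.carrier, (e' 0 : V n) = a • (e 0 : V n) + b • (e 1 : V n) →
      (e' 1 : V n) = c • (e 0 : V n) + d • (e 1 : V n) → e.det e' = a * d - b * c := by
    intro e' h0 h1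
    have h0' : e' 0 = a • e 0 + b • e 1 := Subtype.ext (by simpa using h0)
    have h1' : e' 1 = c • e 0 + d • e 1 := Subtype.ext (by simpa using h1)
    rw [Basis.det_apply, Matrix.det_fin_two]
    simp [Basis.toMatrix_apply, h0', h1']
    ring
  constructor
  · rintro ⟨e', h0, h1, he'⟩
    rw [← hdet e' h0 h1, ← Basis.orientation_eq_iff_det_pos, he', he]
  · intro hpos
    let M : Matrix (Fin 2) (Fin 2) ℝ := !![a, c; b, d]
    have hM : M.det = a * d - b * c := by
      rw [Matrix.det_fin_two]
      simp [M]
      ring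
    let e' : Basis (Fin 2) ℝ P.carrier :=
      e.map (Matrix.toLinearEquiv e M (by rw [hM]; exact hpos.ne'.isUnit))
    have h0 : e' 0 = a • e 0 + b • e 1 := by
      have : e' 0 = Matrix.toLin e e M (e 0) := rfl
      rw [this, Matrix.toLin_self]
      simp [M, Fin.sum_univ_two]
    have h1 : e' 1 = c • e 0 + d • e 1 := by
      have : e' 1 = Matrix.toLin e e M (e 1) := rfl
      rw [this, Matrix.toLin_self]
      simp [M, Fin.sum_univ_two]
    have h0' : (e' 0 : V n) = a • (e 0 : V n) + b • (e 1 : V n) := by rw [h0]; rfl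
    have h1' : (e' 1 : V n) = c • (e 0 : V n) + d • (e 1 : V n) := by rw [h1]; rfl
    refine ⟨e', h0', h1', ?_⟩
    rw [← he, eq_comm, Basis.orientation_eq_iff_det_pos, hdet e' h0' h1']
    exact hpos

lemma eq_of_isPositiveFrame (hP : P.IsPositiveFrame u v) (hQ : Q.IsPositiveFrame u v) : P = Q := by
  have hc : P.carrier = Q.carrier := by rw [hP.carrier_eq_span, hQ.carrier_eq_span]
  obtain ⟨P, hP2, oP⟩ := P
  obtain ⟨Q, hQ2, oQ⟩ := Q
  obtain rfl : P = Q := hc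
  obtain ⟨b, hb0, hb1, hb⟩ := hP
  obtain ⟨b', hb0', hb1', hb'⟩ := hQ
  have : b = b' := by
    refine Basis.eq_of_apply_eq fun i => Subtype.ext ?_
    fin_cases i
    · exact hb0.trans hb0'.symm
    · exact hb1.trans hb1'.symm
  subst this
  have : oP = oQ := hb.symm.trans hb'
  rw [this]

lemma exists_isPositiveFrame (P : OrientedPlane n) : ∃ u v, P.IsPositiveFrame u v := by
  have hP := P.finrank_eq
  let b : Basis (Fin 2) ℝ P.carrier := finBasisOfFinrankEq ℝ _ hP
  refine ⟨_, _, b.adjustToOrientation P.orientation, rfl, rfl, ?_⟩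
  exact b.orientation_adjustToOrientation P.orientation

lemma isPositiveFrame_map (φ : V n ≃ₗ[ℝ] V n) :
    (P.map φ).IsPositiveFrame (φ u) (φ v) ↔ P.IsPositiveFrame u v := by
  have key : ∀ u v, P.IsPositiveFrame u v → (P.map φ).IsPositiveFrame (φ u) (φ v) := by
    rintro u v ⟨b, rfl, rfl, hb⟩
    refine ⟨b.map (φ.submoduleMap P.carrier), rfl, rfl, ?_⟩
    exact (Basis.orientation_map b _).trans (by rw [hb]; rfl)
  refine ⟨fun h => ?_, key u v⟩
  obtain ⟨a, b, hab⟩ := P.exists_isPositiveFrame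
  have h1 := key a b hab
  have hmem : ∀ w, φ w ∈ (P.map φ).carrier → w ∈ P.carrier := by
    rintro w ⟨w', hw', h⟩
    rwa [← φ.injective h]
  obtain ⟨p, q, rfl⟩ := hab.exists_of_mem (hmem u h.mem_left)
  obtain ⟨r, s, rfl⟩ := hab.exists_of_mem (hmem v h.mem_right)
  rw [isPositiveFrame_combination_iff hab]
  simp only [map_add, map_smul] at h
  exact (isPositiveFrame_combination_iff h1).1 h

end OrientedPlane

end GreatCircle

namespace GreatCircle

/-! ### Local sections of submersions -/

section LocalSection

variable {E E' M N : Type*} [NormedAddCommGroup E] [NormedSpace ℝ E] [NormedAddCommGroup E']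
  [NormedSpace ℝ E'] [TopologicalSpace M] [ChartedSpace E M] [TopologicalSpace N]
  [ChartedSpace E' N]

/-- A submersion has smooth local sections through every point. -/
lemma exists_local_section [IsManifold 𝓘(ℝ, E) ∞ M] [IsManifold 𝓘(ℝ, E') ∞ N] {f : M → N} {p : M}
    (h : IsSubmersionAt 𝓘(ℝ, E) 𝓘(ℝ, E') ∞ f p) :
    ∃ s : N → M, s (f p) = p ∧ ContMDiffAt 𝓘(ℝ, E') 𝓘(ℝ, E) ∞ s (f p) ∧
      ∀ᶠ x in 𝓝 (f p), f (s x) = x := by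
  have key : ∀ w ∈ h.domChart.target, h.codChart (f (h.domChart.symm w)) = (h.equiv w).1 := by
    intro w hw
    have h0 := h.writtenInCharts
    have h1 := h0 (show w ∈ (h.domChart.extend 𝓘(ℝ, E)).target by simpa using hw)
    simpa using h1
  have hp := h.mem_domChart_source
  have hq := h.mem_codChart_source
  have h1 : (h.equiv (h.domChart p)).1 = h.codChart (f p) := by
    rw [← key _ (h.domChart.map_source hp), h.domChart.left_inv hp]
  -- In the charts of the normal form a submersion is the first projection; the section keeps the
  -- complementary coordinate of p fixed.
  let u : N → E := fun x => h.equiv.symm (h.codChart x, (h.equiv (h.domChart p)).2)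
  have hu : u (f p) = h.domChart p := by
    simp only [u, ← h1, Prod.mk.eta, ContinuousLinearEquiv.symm_apply_apply]
  have huc : ContMDiffAt 𝓘(ℝ, E') 𝓘(ℝ, E) ∞ u (f p) := by
    have h2 : ContDiff ℝ ∞ (fun w : E' => h.equiv.symm (w, (h.equiv (h.domChart p)).2)) :=
      h.equiv.symm.contDiff.comp (contDiff_id.prodMk contDiff_const)
    exact h2.contMDiff.contMDiffAt.comp (f p)
      (contMDiffAt_of_mem_maximalAtlas h.codChart_mem_maximalAtlas hq)
  have hut : u (f p) ∈ h.domChart.target := by rw [hu]; exact h.domChart.map_source hp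
  have hsc : ContMDiffAt 𝓘(ℝ, E') 𝓘(ℝ, E) ∞ (fun x => h.domChart.symm (u x)) (f p) :=
    (contMDiffAt_symm_of_mem_maximalAtlas h.domChart_mem_maximalAtlas hut).comp (f p) huc
  refine ⟨fun x => h.domChart.symm (u x), ?_, hsc, ?_⟩
  · beta_reduce
    rw [hu, h.domChart.left_inv hp]
  · filter_upwards [huc.continuousAt.preimage_mem_nhds (h.domChart.open_target.mem_nhds hut),
      h.codChart.open_source.mem_nhds hq] with x hx hx'
    refine h.codChart.injOn (h.source_subset_preimage_source (h.domChart.map_target hx)) hx' ?_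
    rw [key _ hx]
    simp [u]

end LocalSection

section Radial

variable {n : ℕ}

lemma contMDiff_coe_sphere_V :
    ContMDiff (𝓡 (2 * n + 1)) 𝓘(ℝ, V n) ∞ ((↑) : S n → V n) :=
  haveI : Fact (finrank ℝ (V n) = 2 * n + 1 + 1) := ⟨finrank_euclideanSpace_fin⟩
  contMDiff_coe_sphere

/-- The radial projection `V ∖ 0 → S`. -/
noncomputable def toSphere (v : V n) : S n :=
  if h : v ≠ 0 then ⟨‖v‖⁻¹ • v, by simp [norm_smul, h]⟩
  else ⟨EuclideanSpace.single 0 1, by simp⟩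

lemma coe_toSphere {v : V n} (h : v ≠ 0) : (toSphere v : V n) = ‖v‖⁻¹ • v := by
  rw [toSphere, dif_pos h]

@[simp] lemma coe_ne_zero_of_sphere (p : S n) : (p : V n) ≠ 0 := ne_zero_of_mem_unit_sphere p

@[simp] lemma toSphere_coe (p : S n) : toSphere (p : V n) = p := by
  refine Subtype.ext ?_
  rw [coe_toSphere (by simp)]
  simp

lemma contMDiffAt_toSphere {v : V n} (h : v ≠ 0) :
    ContMDiffAt 𝓘(ℝ, V n) (𝓡 (2 * n + 1)) ∞ toSphere v := by
  let U : TopologicalSpace.Opens (V n) := ⟨{0}ᶜ, isOpen_compl_singleton⟩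
  have hne : ∀ x : U, (x : V n) ≠ 0 := fun x => x.2
  have h1 : ContMDiff 𝓘(ℝ, V n) 𝓘(ℝ, V n) ∞ (fun x : U => ‖(x : V n)‖⁻¹ • (x : V n)) := by
    intro x
    have h2 : ContDiffAt ℝ ∞ (fun w : V n => ‖w‖⁻¹ • w) x :=
      ((contDiffAt_norm ℝ (hne x)).inv (norm_ne_zero_iff.2 (hne x))).smul contDiffAt_id
    exact h2.contMDiffAt.comp x contMDiff_subtype_val.contMDiffAt
  have : Fact (finrank ℝ (V n) = 2 * n + 1 + 1) := ⟨finrank_euclideanSpace_fin⟩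
  have h3 := h1.codRestrict_sphere (n := 2 * n + 1) (fun x => by simp [norm_smul, hne x])
  have h4 : (fun x : U => toSphere (x : V n)) = Set.codRestrict _ _
      (fun x : U => by simp [norm_smul, hne x] :
        ∀ x : U, ‖(x : V n)‖⁻¹ • (x : V n) ∈ Metric.sphere (0 : V n) 1) := by
    funext x
    exact Subtype.ext (coe_toSphere (hne x))
  rw [← contMDiffAt_subtype_iff (U := U) (x := ⟨v, h⟩), h4]
  exact h3.contMDiffAt

end Radial

namespace Fibration

variable {n : ℕ} {X : Type*} [TopologicalSpace X]
  [ChartedSpace (EuclideanSpace ℝ (Fin (2 * n))) X] (F : Fibration n X)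

/-- The base point of the circle through the direction of `v`. -/
noncomputable def base (v : V n) : X := F.proj (toSphere v)

lemma base_eq_iff {v : V n} (h : v ≠ 0) {x : X} : F.base v = x ↔ v ∈ (F.plane x).carrier := by
  rw [base, ← F.mem_plane_iff, coe_toSphere h,
    Submodule.smul_mem_iff _ (inv_ne_zero (norm_ne_zero_iff.2 h))]

lemma mem_plane_base {v : V n} (h : v ≠ 0) : v ∈ (F.plane (F.base v)).carrier :=
  (F.base_eq_iff h).1 rfl

lemma contMDiffAt_base {v : V n} (h : v ≠ 0) :
    ContMDiffAt 𝓘(ℝ, V n) (𝓡 (2 * n)) ∞ F.base v :=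
  (F.isSubmersion_proj.contMDiff _).comp v (contMDiffAt_toSphere h)

variable [IsManifold (𝓡 (2 * n)) ∞ X]

lemma exists_section {v : V n} (h : v ≠ 0) {x : X} (hv : v ∈ (F.plane x).carrier) :
    ∃ s : X → V n, s x = v ∧ ContMDiffAt (𝓡 (2 * n)) 𝓘(ℝ, V n) ∞ s x ∧
      ∀ᶠ y in 𝓝 x, s y ≠ 0 ∧ s y ∈ (F.plane y).carrier := by
  obtain ⟨s, hs, hsc, hse⟩ := exists_local_section
    (F.isSubmersion_proj.isSubmersionAt (toSphere v))
  have hx : F.proj (toSphere v) = x := (F.base_eq_iff h).2 hv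
  rw [hx] at hs hsc hse
  have hv0 : ‖v‖ ≠ 0 := norm_ne_zero_iff.2 h
  refine ⟨fun y => ‖v‖ • (s y : V n), ?_, ?_, ?_⟩
  · beta_reduce
    rw [hs, coe_toSphere h, smul_smul, mul_inv_cancel₀ hv0, one_smul]
  · have h1 : ContDiff ℝ ∞ (fun w : V n => ‖v‖ • w) := contDiff_const_smul _
    exact h1.contMDiff.contMDiffAt.comp x ((contMDiff_coe_sphere_V _).comp x hsc)
  · filter_upwards [hse] with y hy
    refine ⟨smul_ne_zero hv0 (by simp), Submodule.smul_mem _ _ ?_⟩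
    exact (F.mem_plane_iff _ _).2 hy

end Fibration

end GreatCircle

namespace GreatCircle

namespace Fibration

/-! ### The fibration in a chart of the base -/

variable {n : ℕ} {X : Type*} [TopologicalSpace X]
  [ChartedSpace (EuclideanSpace ℝ (Fin (2 * n))) X] (F : Fibration n X)

/-- The bundle projection in the preferred chart at `x₀`. -/
noncomputable def chartBase (x₀ : X) (v : V n) : EuclideanSpace ℝ (Fin (2 * n)) :=
  chartAt (EuclideanSpace ℝ (Fin (2 * n))) x₀ (F.base v)

lemma chartBase_eq {F : Fibration n X} {x₀ : X} {v : V n} {y : EuclideanSpace ℝ (Fin (2 * n))} (hv : v ≠ 0)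
    (hy : y ∈ (chartAt (EuclideanSpace ℝ (Fin (2 * n))) x₀).target)
    (hvy : v ∈ (F.plane ((chartAt (EuclideanSpace ℝ (Fin (2 * n))) x₀).symm y)).carrier) :
    F.chartBase x₀ v = y := by
  rw [chartBase, (F.base_eq_iff hv).2 hvy, OpenPartialHomeomorph.right_inv _ hy]

variable [IsManifold (𝓡 (2 * n)) ∞ X] {F} {x₀ x : X} {v : V n}

lemma contDiffAt_chartBase (hv : v ≠ 0)
    (hx : F.base v ∈ (chartAt (EuclideanSpace ℝ (Fin (2 * n))) x₀).source) :
    ContDiffAt ℝ ∞ (F.chartBase x₀) v := by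
  rw [← contMDiffAt_iff_contDiffAt]
  exact (contMDiffAt_of_mem_maximalAtlas (I := 𝓡 (2 * n)) (n := ∞)
    (IsManifold.chart_mem_maximalAtlas x₀) hx).comp v (F.contMDiffAt_base hv)

lemma exists_chart_section (hv : v ≠ 0) (hvx : v ∈ (F.plane x).carrier)
    (hx : x ∈ (chartAt (EuclideanSpace ℝ (Fin (2 * n))) x₀).source) :
    ∃ ς : EuclideanSpace ℝ (Fin (2 * n)) → V n, ς (chartAt _ x₀ x) = v ∧
      ContDiffAt ℝ ∞ ς (chartAt _ x₀ x) ∧ ∀ᶠ y in 𝓝 (chartAt _ x₀ x), ς y ≠ 0 ∧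
        ς y ∈ (F.plane ((chartAt (EuclideanSpace ℝ (Fin (2 * n))) x₀).symm y)).carrier := by
  obtain ⟨s, hs, hsc, hse⟩ := F.exists_section hv hvx
  set e := chartAt (EuclideanSpace ℝ (Fin (2 * n))) x₀
  have hy := e.map_source hx
  have hc : ContMDiffAt (𝓡 (2 * n)) (𝓡 (2 * n)) ∞ e.symm (e x) :=
    contMDiffAt_symm_of_mem_maximalAtlas (IsManifold.chart_mem_maximalAtlas x₀) hy
  have hxx : e.symm (e x) = x := e.left_inv hx
  refine ⟨fun y => s (e.symm y), by beta_reduce; rw [hxx, hs], ?_, ?_⟩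
  · rw [← contMDiffAt_iff_contDiffAt]
    refine ContMDiffAt.comp (g := s) (f := e.symm) (e x) ?_ hc
    rwa [hxx]
  · have : Tendsto e.symm (𝓝 (e x)) (𝓝 x) := by
      have := hc.continuousAt.tendsto
      rwa [hxx] at this
    exact this.eventually hse

lemma fderiv_chartBase_section {y : EuclideanSpace ℝ (Fin (2 * n))}
    (hy : y ∈ (chartAt (EuclideanSpace ℝ (Fin (2 * n))) x₀).target)
    {ς : EuclideanSpace ℝ (Fin (2 * n)) → V n} (hς : DifferentiableAt ℝ ς y)
    (h : ∀ᶠ y in 𝓝 y, ς y ≠ 0 ∧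
        ς y ∈ (F.plane ((chartAt (EuclideanSpace ℝ (Fin (2 * n))) x₀).symm y)).carrier)
    (w : EuclideanSpace ℝ (Fin (2 * n))) :
    fderiv ℝ (F.chartBase x₀) (ς y) (fderiv ℝ ς y w) = w := by
  have hy' := h.self_of_nhds
  have hx : F.base (ς y) ∈ (chartAt (EuclideanSpace ℝ (Fin (2 * n))) x₀).source := by
    rw [(F.base_eq_iff hy'.1).2 hy'.2]
    exact OpenPartialHomeomorph.map_target _ hy
  have h1 : (F.chartBase x₀ ∘ ς) =ᶠ[𝓝 y] id := by
    filter_upwards [h, (chartAt _ x₀).open_target.mem_nhds hy] with z hz hz'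
    exact chartBase_eq hz.1 hz' hz.2
  have h2 := h1.fderiv_eq (𝕜 := ℝ)
  rw [fderiv_comp y ((contDiffAt_chartBase hy'.1 hx).differentiableAt (by simp))
    hς, fderiv_id] at h2
  exact DFunLike.congr_fun h2 w

/-- The base point is constant along nonzero vectors of the plane, so the plane lies in the kernel.
A local section makes the derivative surjective onto dimension 2n, so the kernel has dimension
exactly 2. -/
lemma ker_fderiv_chartBase (hv : v ≠ 0) (hvx : v ∈ (F.plane x).carrier)
    (hx : x ∈ (chartAt (EuclideanSpace ℝ (Fin (2 * n))) x₀).source) :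
    (fderiv ℝ (F.chartBase x₀) v).ker = (F.plane x).carrier := by
  have hb : F.base v = x := (F.base_eq_iff hv).2 hvx
  have hd : DifferentiableAt ℝ (F.chartBase x₀) v :=
    (contDiffAt_chartBase hv (by rwa [hb])).differentiableAt (by simp)
  symm
  refine Submodule.eq_of_le_of_finrank_eq (fun w hw => ?_) ?_
  · have h1 : HasDerivAt (fun s : ℝ => v + s • w) w 0 := by
      simpa using ((hasDerivAt_id (0 : ℝ)).smul_const w).const_add v
    have h2 : HasFDerivAt (F.chartBase x₀) (fderiv ℝ (F.chartBase x₀) v) (v + (0 : ℝ) • w) := by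
      simpa using hd.hasFDerivAt
    have h3 := h2.comp_hasDerivAt (0 : ℝ) h1
    have h4 : (F.chartBase x₀ ∘ fun s : ℝ => v + s • w) =ᶠ[𝓝 0] fun _ => F.chartBase x₀ v := by
      have : ∀ᶠ s in 𝓝 (0 : ℝ), v + s • w ≠ 0 :=
        h1.continuousAt.eventually_ne (by simpa using hv)
      filter_upwards [this] with s hs
      simp only [chartBase, Function.comp_apply]
      rw [hb, (F.base_eq_iff hs).2 (Submodule.add_mem _ hvx (Submodule.smul_mem _ _ hw))]
    exact h3.unique ((hasDerivAt_const (0 : ℝ) _).congr_of_eventuallyEq h4)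
  · obtain ⟨ς, h0, hς, hςe⟩ := F.exists_chart_section hv hvx hx
    have hs : Function.Surjective (fderiv ℝ (F.chartBase x₀) v) := fun w => ⟨_, by
      have := fderiv_chartBase_section (OpenPartialHomeomorph.map_source _ hx)
        (hς.differentiableAt (by simp)) hςe w
      rwa [h0] at this⟩
    have h5 := LinearMap.finrank_range_add_finrank_ker (fderiv ℝ (F.chartBase x₀) v).toLinearMap
    rw [LinearMap.range_eq_top.2 hs, finrank_top, finrank_euclideanSpace_fin,
      finrank_euclideanSpace_fin] at h5
    rw [(F.plane x).finrank_eq]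
    have h6 : finrank ℝ (fderiv ℝ (F.chartBase x₀) v).ker = 2 := by omega
    exact h6.symm

end Fibration

end GreatCircle

namespace GreatCircle

/-! ### Transverse velocities of `e₀`, `e₁` and the motion of the base point. -/

open Matrix

variable {n : ℕ}

lemma sum_block {M : Type*} [AddCommMonoid M] (f : Fin (n + 1) × Fin 2 → M) :
    ∑ a, f a = f (0, 0) + f (0, 1) + ∑ i : Fin n × Fin 2, f (i.1.succ, i.2) := by
  rw [Fintype.sum_prod_type, Fintype.sum_prod_type, Fin.sum_univ_succ, Fin.sum_univ_two]

/-- The linear combinations of all frame vectors but the first two. -/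
noncomputable def tailVec (g : Frame n) : (Fin n × Fin 2 → ℝ) →ₗ[ℝ] V n :=
  Fintype.linearCombination ℝ fun i : Fin n × Fin 2 => g (i.1.succ, i.2)

lemma tailVec_apply (g : Frame n) (u) : tailVec g u = ∑ i, u i • g (i.1.succ, i.2) :=
  Fintype.linearCombination_apply ..

lemma eq_add_tailVec (g : Frame n) (w : V n) :
    w = g.repr w (0, 0) • g (0, 0) + g.repr w (0, 1) • g (0, 1) +
      tailVec g fun i => g.repr w (i.1.succ, i.2) := by
  conv_lhs => rw [← g.sum_repr w, sum_block]
  rw [tailVec_apply]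

lemma repr_tailVec (g : Frame n) (u) (i : Fin n × Fin 2) :
    g.repr (tailVec g u) (i.1.succ, i.2) = u i := by
  rw [tailVec_apply]
  simp only [map_sum, map_smul, Basis.repr_self, Finsupp.coe_finsetSum, Finset.sum_apply,
    Finsupp.smul_apply, smul_eq_mul]
  rw [Finset.sum_eq_single i]
  · simp
  · rintro ⟨p, ε⟩ - hj
    rw [Finsupp.single_eq_of_ne, mul_zero]
    rintro h
    apply hj
    obtain ⟨q, δ⟩ := i
    simp only [Prod.mk.injEq, Fin.succ_inj] at h
    rw [h.1, h.2]
  · simp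

lemma eq_zero_of_tailVec_mem {P : OrientedPlane n} {g : Frame n}
    (h : P.IsPositiveFrame (g (0, 0)) (g (0, 1))) {u} (hu : tailVec g u ∈ P.carrier) : u = 0 := by
  obtain ⟨a, b, hab⟩ := h.exists_of_mem hu
  funext i
  rw [← repr_tailVec g u i, hab]
  have h1 : ∀ δ : Fin 2, ((0 : Fin (n + 1)), δ) ≠ (i.1.succ, i.2) := fun δ h =>
    Fin.succ_ne_zero i.1 (congrArg Prod.fst h).symm
  simp [Finsupp.single_eq_of_ne' (h1 _)]

lemma exists_block_cases (b : Fin (n + 1) × Fin 2) :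
    b = (0, 0) ∨ b = (0, 1) ∨ ∃ i : Fin n × Fin 2, b = (i.1.succ, i.2) := by
  obtain ⟨b, δ⟩ := b
  refine Fin.cases ?_ (fun q => Or.inr (Or.inr ⟨(q, δ), rfl⟩)) b
  fin_cases δ <;> simp

namespace Fibration

variable {X : Type*} [TopologicalSpace X]
  [ChartedSpace (EuclideanSpace ℝ (Fin (2 * n))) X] {F : Fibration n X}

lemma isT_iff {g : Frame n} {t : BlockMatrix n} :
    F.IsT g t ↔ ∀ A ∈ maurerCartan F.frames₁ g, tailCol A 1 = t *ᵥ tailCol A 0 :=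
  forall₂_congr fun _ _ => funext_iff.symm

variable [IsManifold (𝓡 (2 * n)) ∞ X] {x₀ x : X} {g : Frame n}

/-- The tail vectors span a complement of the plane, which is the kernel of the derivative at any
nonzero vector v of the plane. -/
lemma eq_zero_of_fderiv_tailVec_eq_zero {v : V n} (hv : v ≠ 0) (hvx : v ∈ (F.plane x).carrier)
    (hx : x ∈ (chartAt (EuclideanSpace ℝ (Fin (2 * n))) x₀).source)
    (hg : (F.plane x).IsPositiveFrame (g (0, 0)) (g (0, 1))) {u : Fin n × Fin 2 → ℝ}
    (hu : fderiv ℝ (F.chartBase x₀) v (tailVec g u) = 0) : u = 0 := by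
  refine eq_zero_of_tailVec_mem hg ?_
  rw [← ker_fderiv_chartBase hv hvx hx]
  exact hu

/-- All the curves `a e₀ + b e₁` project to the same curve in the base. -/
lemma fderiv_chartBase_maurerCartan {A : BlockMatrix (n + 1)} (hA : A ∈ maurerCartan F.frames₁ g)
    (hx : x ∈ (chartAt (EuclideanSpace ℝ (Fin (2 * n))) x₀).source)
    (hg : (F.plane x).IsPositiveFrame (g (0, 0)) (g (0, 1))) {a b : ℝ} (hab : ¬ (a = 0 ∧ b = 0)) :
    fderiv ℝ (F.chartBase x₀) (a • g (0, 0) + b • g (0, 1))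
        (tailVec g (a • tailCol A 0 + b • tailCol A 1)) =
      fderiv ℝ (F.chartBase x₀) (g (0, 0)) (tailVec g (tailCol A 0)) := by
  obtain ⟨N, h0, hN, hNB, hNA⟩ := mem_maurerCartan_iff.1 hA
  have hdet : ∀ᶠ s in 𝓝 (0 : ℝ), (N s).det ≠ 0 := eventually_det_ne_zero hN (by simp [h0])
  let γ : Fin 2 → ℝ → V n := fun δ s => ∑ a, N s a (0, δ) • g a
  have hγ0 : ∀ δ, γ δ 0 = g (0, δ) := fun δ => by
    simp [γ, h0, Matrix.one_apply]
  have hγ : ∀ δ, HasDerivAt (γ δ) (∑ a, A a (0, δ) • g a) 0 := fun δ =>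
    HasDerivAt.fun_sum fun a _ => (hNA a (0, δ)).smul_const (g a)
  have hsum : ∀ δ, ∃ w ∈ (F.plane x).carrier,
      ∑ a, A a (0, δ) • g a = w + tailVec g (tailCol A δ) := fun δ =>
    ⟨_, Submodule.add_mem _ (Submodule.smul_mem _ _ hg.mem_left)
      (Submodule.smul_mem _ _ hg.mem_right), by rw [sum_block, tailVec_apply]; rfl⟩
  -- The derivative of the base point along the curve a e₀ + b e₁. Components of the velocity in the
  -- plane are killed, so only the tail contributes.
  have key : ∀ a b : ℝ, ¬ (a = 0 ∧ b = 0) →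
      HasDerivAt (fun s => F.chartBase x₀ (a • γ 0 s + b • γ 1 s))
        (fderiv ℝ (F.chartBase x₀) (a • g (0, 0) + b • g (0, 1))
          (tailVec g (a • tailCol A 0 + b • tailCol A 1))) 0 := by
    intro a b hab
    have hv : a • g (0, 0) + b • g (0, 1) ≠ 0 := fun h => hab (hg.eq_zero_of_add_eq_zero h)
    have hvx : a • g (0, 0) + b • g (0, 1) ∈ (F.plane x).carrier :=
      Submodule.add_mem _ (Submodule.smul_mem _ _ hg.mem_left) (Submodule.smul_mem _ _ hg.mem_right)
    have hd : DifferentiableAt ℝ (F.chartBase x₀) (a • g (0, 0) + b • g (0, 1)) :=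
      (contDiffAt_chartBase hv (by rwa [(F.base_eq_iff hv).2 hvx])).differentiableAt (by simp)
    have h2 : HasFDerivAt (F.chartBase x₀) (fderiv ℝ (F.chartBase x₀)
        (a • g (0, 0) + b • g (0, 1))) (a • γ 0 0 + b • γ 1 0) := by
      rw [hγ0, hγ0]
      exact hd.hasFDerivAt
    have h3 := h2.comp_hasDerivAt (0 : ℝ) (((hγ 0).const_smul a).add ((hγ 1).const_smul b))
    convert! h3 using 1
    obtain ⟨w₀, hw₀, e₀⟩ := hsum 0
    obtain ⟨w₁, hw₁, e₁⟩ := hsum 1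
    have hk : fderiv ℝ (F.chartBase x₀) (a • g (0, 0) + b • g (0, 1)) (a • w₀ + b • w₁) = 0 := by
      have hw : a • w₀ + b • w₁ ∈ (F.plane x).carrier :=
        Submodule.add_mem _ (Submodule.smul_mem _ _ hw₀) (Submodule.smul_mem _ _ hw₁)
      rw [← ker_fderiv_chartBase hv hvx hx] at hw
      exact hw
    rw [e₀, e₁, smul_add, smul_add, add_add_add_comm, map_add (tailVec g), map_smul (tailVec g),
      map_smul (tailVec g), map_add _ (a • w₀ + b • w₁), hk, zero_add]
  have k1 := key a b hab
  have k2 := key 1 0 (by simp)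
  simp only [one_smul, zero_smul, add_zero] at k2
  refine k1.unique (k2.congr_of_eventuallyEq ?_)
  filter_upwards [hNB, hdet] with s hs hs'
  obtain ⟨z, hz⟩ := hs
  rw [frameMul_apply g hs', frameMul_apply g hs'] at hz
  have hz' : (F.plane z).IsPositiveFrame (γ 0 s) (γ 1 s) := hz
  have e1 : F.base (a • γ 0 s + b • γ 1 s) = z :=
    (F.base_eq_iff fun h => hab (hz'.eq_zero_of_add_eq_zero h)).2
      (Submodule.add_mem _ (Submodule.smul_mem _ _ hz'.mem_left)
        (Submodule.smul_mem _ _ hz'.mem_right))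
  have e2 : F.base (γ 0 s) = z := (F.base_eq_iff hz'.left_ne_zero).2 hz'.mem_left
  rw [chartBase, chartBase, e1, e2]

end Fibration

end GreatCircle

namespace GreatCircle

open Matrix

/-- Linear forms on all of V give an area form that can also be evaluated on nearby planes; it
serves to compare orientations by continuity. -/
lemma OrientedPlane.IsPositiveFrame.exists_area_eq_one {n : ℕ} {P : OrientedPlane n} {u v : V n}
    (h : P.IsPositiveFrame u v) : ∃ α β : V n →ₗ[ℝ] ℝ, α u * β v - β u * α v = 1 := by
  obtain ⟨e, h0, h1, -⟩ := h
  obtain ⟨p, hp⟩ := P.carrier.exists_isCompl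
  let π := P.carrier.projectionOnto p hp
  have hπ : ∀ i, π (e i : V n) = e i := fun i => Submodule.projectionOnto_apply_left hp _
  refine ⟨e.coord 0 ∘ₗ π, e.coord 1 ∘ₗ π, ?_⟩
  rw [← h0, ← h1]
  simp [hπ]

namespace Fibration

/-! ### Local sections of the bundles of frames -/

variable {n : ℕ} {X : Type*} [TopologicalSpace X]
  [ChartedSpace (EuclideanSpace ℝ (Fin (2 * n))) X] {F : Fibration n X} {x : X} {g : Frame n}

/-- `y ↦ g · Θ(y)` is a smooth local section through `g` of the set `B` of frames, in the chart of
`X` at `x`. -/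
structure IsLocalSection (F : Fibration n X) (B : Set (Frame n)) (x : X) (g : Frame n)
    (Θ : EuclideanSpace ℝ (Fin (2 * n)) → BlockMatrix (n + 1)) : Prop where
  apply_base : Θ (chartAt _ x x) = 1
  contDiffAt : ∀ i j, ContDiffAt ℝ ∞ (fun y => Θ y i j) (chartAt _ x x)
  eventually_mem : ∀ᶠ y in 𝓝 (chartAt _ x x), frameMul g (Θ y) ∈ B
  eventually_frame : ∀ᶠ y in 𝓝 (chartAt _ x x),
    (F.plane ((chartAt (EuclideanSpace ℝ (Fin (2 * n))) x).symm y)).IsPositiveFrame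
      (frameMul g (Θ y) (0, 0)) (frameMul g (Θ y) (0, 1))
  exists_hasDerivAt : ∀ u : Fin n × Fin 2 → ℝ, ∃ v, ∀ i,
    HasDerivAt (fun s : ℝ => Θ (chartAt _ x x + s • v) (i.1.succ, i.2) (0, 0)) (u i) 0

namespace IsLocalSection

variable {B : Set (Frame n)} {Θ : EuclideanSpace ℝ (Fin (2 * n)) → BlockMatrix (n + 1)}

lemma eventually_det_ne_zero (h : IsLocalSection F B x g Θ) :
    ∀ᶠ y in 𝓝 (chartAt _ x x), (Θ y).det ≠ 0 :=
  GreatCircle.eventually_det_ne_zero h.contDiffAt (by simp [h.apply_base])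

lemma exists_mem_maurerCartan (h : IsLocalSection F B x g Θ) (u : Fin n × Fin 2 → ℝ) :
    ∃ A ∈ maurerCartan B g, tailCol A 0 = u := by
  obtain ⟨v, hv⟩ := h.exists_hasDerivAt u
  have hl : ContDiffAt ℝ ∞ (fun s : ℝ => chartAt (EuclideanSpace ℝ (Fin (2 * n))) x x + s • v) 0 :=
    contDiffAt_const.add (contDiffAt_id.smul contDiffAt_const)
  have h0 : chartAt (EuclideanSpace ℝ (Fin (2 * n))) x x + (0 : ℝ) • v = chartAt _ x x := by simp
  have hsm : ∀ i j, ContDiffAt ℝ ∞ (fun s : ℝ => Θ (chartAt _ x x + s • v) i j) 0 := fun i j => by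
    refine ContDiffAt.comp (g := fun y => Θ y i j) (0 : ℝ) ?_ hl
    rw [h0]
    exact h.contDiffAt i j
  refine ⟨fun i j => deriv (fun s : ℝ => Θ (chartAt _ x x + s • v) i j) 0,
    mem_maurerCartan_iff.2 ⟨fun s => Θ (chartAt _ x x + s • v), ?_, hsm, ?_, fun i j =>
      ((hsm i j).differentiableAt (by simp)).hasDerivAt⟩, ?_⟩
  · beta_reduce
    rw [h0, h.apply_base]
  · have := hl.continuousAt.tendsto
    rw [h0] at this
    exact this.eventually h.eventually_mem
  · funext i
    exact (hv i).deriv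

end IsLocalSection

/-- A positive frame of each plane of a continuous family of oriented planes, depending continuously
on the base point and positive at one point, is positive at all nearby points. -/
lemma eventually_isPositiveFrame {Y : Type*} [TopologicalSpace Y] {f : Y → X} {y : Y}
    (hf : ContinuousAt f y) {u v : Y → V n} (hu : ContinuousAt u y) (hv : ContinuousAt v y)
    (huv : ∀ᶠ z in 𝓝 y, u z ∈ (F.plane (f z)).carrier ∧ v z ∈ (F.plane (f z)).carrier)
    (hg : (F.plane (f y)).IsPositiveFrame (u y) (v y)) :
    ∀ᶠ z in 𝓝 y, (F.plane (f z)).IsPositiveFrame (u z) (v z) := by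
  obtain ⟨U, hU, a, b, ha, hb, hab⟩ := F.continuous_orientation (f y)
  obtain ⟨α, β, hα⟩ := hg.exists_area_eq_one
  have hαc : Continuous α := α.continuous_of_finiteDimensional
  have hβc : Continuous β := β.continuous_of_finiteDimensional
  have hac : ContinuousAt (fun z => a (f z)) y :=
    ContinuousAt.comp (g := a) (ha.continuousAt hU) hf
  have hbc : ContinuousAt (fun z => b (f z)) y :=
    ContinuousAt.comp (g := b) (hb.continuousAt hU) hf
  let D : V n → V n → ℝ := fun u v => α u * β v - β u * α v
  have hD : ∀ (u v : V n) (p q r s : ℝ),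
      D (p • u + q • v) (r • u + s • v) = (p * s - q * r) * D u v := by
    intro u v p q r s
    simp only [D, map_add, map_smul, smul_eq_mul]
    ring
  have hDc : ∀ {u v : Y → V n}, ContinuousAt u y → ContinuousAt v y →
      ContinuousAt (fun z => D (u z) (v z)) y := fun {u v} hu hv =>
    (((hαc.continuousAt.comp hu).mul (hβc.continuousAt.comp hv)).sub
      ((hβc.continuousAt.comp hu).mul (hαc.continuousAt.comp hv)))
  have h1 : ∀ᶠ z in 𝓝 y, 0 < D (u z) (v z) :=
    continuousAt_const.eventually_lt (hDc hu hv) (by simp only [D]; rw [hα]; exact one_pos)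
  -- The area form is positive on (u, v) at y, hence on the continuous positive frame (a, b) there;
  -- both values stay positive nearby, so their ratio, the change of basis determinant, is positive.
  have h2 : ∀ᶠ z in 𝓝 y, 0 < D (a (f z)) (b (f z)) := by
    refine continuousAt_const.eventually_lt (hDc hac hbc) ?_
    have hy := hab _ (mem_of_mem_nhds hU)
    obtain ⟨p, q, hpq⟩ := hg.exists_of_mem hy.mem_left
    obtain ⟨r, s, hrs⟩ := hg.exists_of_mem hy.mem_right
    rw [hpq, hrs, OrientedPlane.isPositiveFrame_combination_iff hg] at hy
    rw [hpq, hrs, hD]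
    simp only [D]
    rwa [hα, mul_one]
  filter_upwards [h1, h2, huv, hf.preimage_mem_nhds hU] with z hz1 hz2 hz3 hz4
  have hz := hab _ hz4
  obtain ⟨p, q, hpq⟩ := hz.exists_of_mem hz3.1
  obtain ⟨r, s, hrs⟩ := hz.exists_of_mem hz3.2
  rw [hpq, hrs, OrientedPlane.isPositiveFrame_combination_iff hz]
  rw [hpq, hrs, hD] at hz1
  exact pos_of_mul_pos_left hz1 hz2.le

variable [IsManifold (𝓡 (2 * n)) ∞ X]

/-- Through every frame there is a local section along which the invariant `t` is smooth. -/
theorem exists_isLocalSection₁ (hg : (F.plane x).IsPositiveFrame (g (0, 0)) (g (0, 1))) :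
    ∃ (Θ : EuclideanSpace ℝ (Fin (2 * n)) → BlockMatrix (n + 1))
      (t : EuclideanSpace ℝ (Fin (2 * n)) → BlockMatrix n), IsLocalSection F F.frames₁ x g Θ ∧
      (∀ i j, ContDiffAt ℝ ∞ (fun y => t y i j) (chartAt _ x x)) ∧
      ∀ᶠ y in 𝓝 (chartAt _ x x), F.IsT (frameMul g (Θ y)) (t y) := by
  have hx := mem_chart_source (EuclideanSpace ℝ (Fin (2 * n))) x
  obtain ⟨E₀, hE0, hE0c, hE0e⟩ := F.exists_chart_section hg.left_ne_zero hg.mem_left hx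
  set e := chartAt (EuclideanSpace ℝ (Fin (2 * n))) x with he
  set y₀ := e x with hy₀
  have hey₀ : e.symm y₀ = x := e.left_inv hx
  have hyt : y₀ ∈ e.target := e.map_source hx
  have htar : ∀ᶠ y in 𝓝 y₀, y ∈ e.target := e.open_target.mem_nhds hyt
  let D : V n → V n →L[ℝ] EuclideanSpace ℝ (Fin (2 * n)) := fderiv ℝ (F.chartBase x)
  have hDs : ∀ {ς : EuclideanSpace ℝ (Fin (2 * n)) → V n} {y}, ContDiffAt ℝ ∞ ς y → y ∈ e.target →
      (ς y ≠ 0 ∧ ς y ∈ (F.plane (e.symm y)).carrier) → ContDiffAt ℝ ∞ (fun y => D (ς y)) y := by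
    intro ς y hς hy h
    have h1 : ContDiffAt ℝ ∞ (F.chartBase x) (ς y) :=
      contDiffAt_chartBase h.1 (by rw [(F.base_eq_iff h.1).2 h.2]; exact e.map_target hy)
    exact (h1.fderiv_right (m := ∞) (by simp)).comp y hς
  have hDE0 : ContDiffAt ℝ ∞ (fun y => D (E₀ y)) y₀ := hDs hE0c hyt hE0e.self_of_nhds
  have hdE0 : ContDiffAt ℝ ∞ (fun y => fderiv ℝ E₀ y) y₀ := hE0c.fderiv_right (by simp)
  -- The derivative of the section E₀ is a right inverse of D(E₀). Subtracting dE₀(D(E₀)e₁)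
  -- therefore projects the constant vector e₁ to the kernel of D(E₀), which is the moving plane. At
  -- the centre e₁ already lies in the plane and is unchanged.
  let E₁ : EuclideanSpace ℝ (Fin (2 * n)) → V n := fun y =>
    g (0, 1) - fderiv ℝ E₀ y (D (E₀ y) (g (0, 1)))
  have hE1c : ContDiffAt ℝ ∞ E₁ y₀ :=
    contDiffAt_const.sub (hdE0.clm_apply (hDE0.clm_apply contDiffAt_const))
  have hE1 : E₁ y₀ = g (0, 1) := by
    have : D (E₀ y₀) (g (0, 1)) = 0 := by
      have h1 := hg.mem_right
      rw [← ker_fderiv_chartBase hg.left_ne_zero hg.mem_left hx] at h1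
      rw [hE0]
      exact h1
    simp only [E₁, this, map_zero, sub_zero]
  have hdiff : ∀ {f : EuclideanSpace ℝ (Fin (2 * n)) → V n}, ContDiffAt ℝ ∞ f y₀ →
      ∀ᶠ y in 𝓝 y₀, DifferentiableAt ℝ f y := fun hf => by
    filter_upwards [(hf.of_le (m := 1) (by exact_mod_cast le_top)).eventually (by simp)] with y hy
    exact hy.differentiableAt (by simp)
  have hE0s := hdiff hE0c
  have hE1e : ∀ᶠ y in 𝓝 y₀, E₁ y ∈ (F.plane (e.symm y)).carrier := by
    filter_upwards [hE0s, hE0e.eventually_nhds, htar] with y h1 h2 h3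
    rw [← ker_fderiv_chartBase h2.self_of_nhds.1 h2.self_of_nhds.2 (e.map_target h3)]
    change D (E₀ y) (E₁ y) = 0
    rw [map_sub, sub_eq_zero]
    exact (fderiv_chartBase_section h3 h1 h2 _).symm
  have hE1n : ∀ᶠ y in 𝓝 y₀, E₁ y ≠ 0 ∧ E₁ y ∈ (F.plane (e.symm y)).carrier := by
    have h1 : E₁ y₀ ≠ 0 := by rw [hE1]; exact g.ne_zero _
    filter_upwards [hE1c.continuousAt.eventually_ne h1, hE1e] with y h2 h3 using ⟨h2, h3⟩
  have hpos : ∀ᶠ y in 𝓝 y₀, (F.plane (e.symm y)).IsPositiveFrame (E₀ y) (E₁ y) := by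
    refine eventually_isPositiveFrame (f := e.symm) (e.continuousAt_symm hyt) hE0c.continuousAt
      hE1c.continuousAt ?_ (by rwa [hey₀, hE0, hE1])
    filter_upwards [hE0e, hE1e] with y h1 h2 using ⟨h1.2, h2⟩
  let w : EuclideanSpace ℝ (Fin (2 * n)) → Fin (n + 1) × Fin 2 → V n := fun y b =>
    Fin.cases (motive := fun _ => V n) (![E₀ y, E₁ y] b.2) (fun p => g (p.succ, b.2)) b.1
  have hw0 : w y₀ = g := by
    funext b
    obtain rfl | rfl | ⟨i, rfl⟩ := exists_block_cases b
    · exact hE0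
    · exact hE1
    · rfl
  have hwc : ∀ b, ContDiffAt ℝ ∞ (fun y => w y b) y₀ := by
    intro b
    obtain rfl | rfl | ⟨i, rfl⟩ := exists_block_cases b
    · exact hE0c
    · exact hE1c
    · exact contDiffAt_const
  let Θ : EuclideanSpace ℝ (Fin (2 * n)) → BlockMatrix (n + 1) := fun y => g.toMatrix (w y)
  have hL : ∀ a (v : V n), g.repr v a = (g.coord a).toContinuousLinearMap v := fun a v => rfl
  have hLc : ∀ a {f : EuclideanSpace ℝ (Fin (2 * n)) → V n}, ContDiffAt ℝ ∞ f y₀ →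
      ContDiffAt ℝ ∞ (fun y => g.repr (f y) a) y₀ := fun a f hf => by
    simp only [hL]
    exact (ContinuousLinearMap.contDiff _).contDiffAt.comp y₀ hf
  have hΘ0 : Θ y₀ = 1 := by simp [Θ, hw0]
  have hΘc : ∀ i j, ContDiffAt ℝ ∞ (fun y => Θ y i j) y₀ := fun i j => hLc i (hwc j)
  have hΘd : ∀ᶠ y in 𝓝 y₀, (Θ y).det ≠ 0 :=
    GreatCircle.eventually_det_ne_zero hΘc (by simp [hΘ0])
  have hΘw : ∀ᶠ y in 𝓝 y₀, ∀ b, frameMul g (Θ y) b = w y b := by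
    filter_upwards [hΘd] with y hy b
    rw [frameMul_apply g hy]
    exact g.sum_toMatrix_smul_self (w y) b
  have hfr : ∀ᶠ y in 𝓝 y₀, (F.plane (e.symm y)).IsPositiveFrame
      (frameMul g (Θ y) (0, 0)) (frameMul g (Θ y) (0, 1)) := by
    filter_upwards [hpos, hΘw] with y h1 h2
    rw [h2, h2]
    exact h1
  -- A transverse velocity of e₀ is pushed to the base by D(E₀) and lifted by dE₁ to a velocity of
  -- e₁; its tail coordinates in the frame g·Θ(y) give t. The inverse of Θ(y) passes from
  -- coordinates in g to that frame.
  let t : EuclideanSpace ℝ (Fin (2 * n)) → BlockMatrix n := fun y i j =>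
    ((Θ y)⁻¹ *ᵥ g.repr (fderiv ℝ E₁ y (D (E₀ y) (g (j.1.succ, j.2))))) (i.1.succ, i.2)
  refine ⟨Θ, t, ⟨hΘ0, hΘc, ?_, hfr, ?_⟩, ?_, ?_⟩
  · filter_upwards [hfr] with y hy using ⟨_, hy⟩
  · intro u
    refine ⟨D (E₀ y₀) (tailVec g u), fun i => ?_⟩
    have h1 : HasDerivAt (fun s : ℝ => y₀ + s • D (E₀ y₀) (tailVec g u))
        (D (E₀ y₀) (tailVec g u)) 0 := by
      simpa using ((hasDerivAt_id (0 : ℝ)).smul_const _).const_add y₀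
    have h2 : HasFDerivAt E₀ (fderiv ℝ E₀ y₀) (y₀ + (0 : ℝ) • D (E₀ y₀) (tailVec g u)) := by
      simpa using (hE0c.differentiableAt (by simp)).hasFDerivAt
    have h3 := (ContinuousLinearMap.hasFDerivAt
      (g.coord (i.1.succ, i.2)).toContinuousLinearMap).comp_hasDerivAt (0 : ℝ)
        (h2.comp_hasDerivAt (0 : ℝ) h1)
    convert! h3 using 1
    change u i = g.repr (fderiv ℝ E₀ y₀ (D (E₀ y₀) (tailVec g u))) (i.1.succ, i.2)
    -- The vectors dE₀(D(E₀)w) and w have the same image in the base, so they differ by a vector of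
    -- the plane, invisible in the tail coordinates.
    have h4 : D (g (0, 0)) (fderiv ℝ E₀ y₀ (D (E₀ y₀) (tailVec g u)) - tailVec g u) = 0 := by
      rw [map_sub, sub_eq_zero, ← hE0]
      exact fderiv_chartBase_section hyt (hE0c.differentiableAt (by simp)) hE0e _
    have h5 : fderiv ℝ E₀ y₀ (D (E₀ y₀) (tailVec g u)) - tailVec g u ∈ (F.plane x).carrier := by
      rw [← ker_fderiv_chartBase hg.left_ne_zero hg.mem_left hx]
      exact h4
    obtain ⟨a, b, hab⟩ := hg.exists_of_mem h5
    rw [sub_eq_iff_eq_add] at hab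
    rw [hab, map_add, Finsupp.add_apply, repr_tailVec]
    have h6 : ∀ δ : Fin 2, ((0 : Fin (n + 1)), δ) ≠ (i.1.succ, i.2) := fun δ h =>
      Fin.succ_ne_zero i.1 (congrArg Prod.fst h).symm
    simp [Finsupp.single_eq_of_ne' (h6 _)]
  · intro i j
    simp only [t, Matrix.mulVec, dotProduct]
    refine ContDiffAt.sum fun a _ => ContDiffAt.mul ?_ ?_
    · exact contDiffAt_matrix_inv hΘc (by simp [hΘ0]) _ _
    · have hdE1 : ContDiffAt ℝ ∞ (fun y => fderiv ℝ E₁ y) y₀ := hE1c.fderiv_right (by simp)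
      exact hLc a (hdE1.clm_apply (hDE0.clm_apply contDiffAt_const))
  · filter_upwards [hfr, hΘw, hΘd, hE1n.eventually_nhds, hdiff hE1c, htar]
      with y h1 h2 h3 h4 h5 h6
    rw [isT_iff]
    intro A hA
    set G := frameMul g (Θ y) with hG
    have hG0 : G (0, 0) = E₀ y := h2 (0, 0)
    have hG1 : G (0, 1) = E₁ y := h2 (0, 1)
    have hxy := e.map_target h6
    have hk := fderiv_chartBase_maurerCartan hA hxy h1 (a := 0) (b := 1) (by simp)
    simp only [zero_smul, one_smul, zero_add] at hk
    have hrepr : ∀ v a, G.repr v a = ((Θ y)⁻¹ *ᵥ g.repr v) a := by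
      intro v a
      have h7 : g.toMatrix G *ᵥ G.repr v = g.repr v := Basis.toMatrix_mulVec_repr G g v
      rw [hG, toMatrix_frameMul g h3] at h7
      rw [← h7, Matrix.mulVec_mulVec, Matrix.nonsing_inv_mul _ h3.isUnit, Matrix.one_mulVec]
    let T : (Fin n × Fin 2 → ℝ) → V n := fun u => fderiv ℝ E₁ y (D (E₀ y) (tailVec G u))
    have ht : ∀ u, t y *ᵥ u = fun i => G.repr (T u) (i.1.succ, i.2) := by
      intro u
      funext i
      simp only [Matrix.mulVec, dotProduct, t, T]
      rw [tailVec_apply, map_sum, map_sum, map_sum, Finsupp.finsetSum_apply]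
      refine Finset.sum_congr rfl fun j _ => ?_
      rw [map_smul, map_smul, map_smul, Finsupp.smul_apply, smul_eq_mul, mul_comm, hrepr, h2]
      rfl
    have hD1 : ∀ u, D (E₁ y) (tailVec G (t y *ᵥ u)) = D (E₀ y) (tailVec G u) := by
      intro u
      have h8 : D (E₁ y) (T u) = D (E₀ y) (tailVec G u) :=
        fderiv_chartBase_section h6 h5 h4 _
      rw [← h8, ht]
      conv_rhs => rw [eq_add_tailVec G (T u), map_add]
      have h9 : G.repr (T u) (0, 0) • G (0, 0) + G.repr (T u) (0, 1) • G (0, 1) ∈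
          (F.plane (e.symm y)).carrier :=
        Submodule.add_mem _ (Submodule.smul_mem _ _ h1.mem_left)
          (Submodule.smul_mem _ _ h1.mem_right)
      rw [← ker_fderiv_chartBase h4.self_of_nhds.1 h4.self_of_nhds.2 hxy] at h9
      have h10 : D (E₁ y) (G.repr (T u) (0, 0) • G (0, 0) + G.repr (T u) (0, 1) • G (0, 1)) = 0 :=
        h9
      rw [h10, zero_add]
    rw [← sub_eq_zero]
    refine eq_zero_of_fderiv_tailVec_eq_zero h4.self_of_nhds.1 h4.self_of_nhds.2 hxy h1 ?_
    change D (E₁ y) _ = 0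
    rw [map_sub, map_sub, hD1, ← hG0, ← hG1]
    exact sub_eq_zero.2 hk

end Fibration

end GreatCircle

namespace GreatCircle

open Matrix

/-! ### Changes of frame over a fixed plane; the invariant `t` and sections of `frames₂`. -/

section Parabolic

variable {n : ℕ} {N : BlockMatrix (n + 1)}

lemma headBlock_one : headBlock (1 : BlockMatrix (n + 1)) = 1 := by
  ext ε δ
  simp [headBlock, Matrix.one_apply]

lemma tailCol_one (δ) : tailCol (1 : BlockMatrix (n + 1)) δ = 0 := by
  funext i
  simp [tailCol, Fin.succ_ne_zero]

lemma IsParabolic.mul_apply_zero (hN : IsParabolic N) (L : BlockMatrix (n + 1)) (i δ) :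
    (L * N) i (0, δ) = L i (0, 0) * N (0, 0) (0, δ) + L i (0, 1) * N (0, 1) (0, δ) := by
  rw [Matrix.mul_apply, sum_block]
  simp [hN.apply_succ_zero]

lemma IsParabolic.headBlock_mul (hN : IsParabolic N) (L : BlockMatrix (n + 1)) :
    headBlock (L * N) = headBlock L * headBlock N := by
  ext ε δ
  simp only [headBlock, Matrix.of_apply]
  rw [hN.mul_apply_zero, Matrix.mul_apply, Fin.sum_univ_two]
  rfl

lemma IsParabolic.tailCol_mul (hN : IsParabolic N) (L : BlockMatrix (n + 1)) (δ) :
    tailCol (L * N) δ = N (0, 0) (0, δ) • tailCol L 0 + N (0, 1) (0, δ) • tailCol L 1 := by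
  funext i
  simp only [tailCol, Pi.add_apply, Pi.smul_apply, smul_eq_mul]
  rw [hN.mul_apply_zero]
  ring

lemma IsParabolic.inv (hN : IsParabolic N) : IsParabolic N⁻¹ := by
  have h1 : N⁻¹ * N = 1 := Matrix.nonsing_inv_mul _ hN.det_ne_zero.isUnit
  have h2 : headBlock N⁻¹ * headBlock N = 1 := by
    rw [← hN.headBlock_mul, h1, headBlock_one]
  refine ⟨?_, ?_, ?_⟩
  · simpa [Matrix.det_nonsing_inv] using hN.det_ne_zero
  · have h3 : ∀ i : Fin n × Fin 2, (fun δ => tailCol N⁻¹ δ i) ᵥ* headBlock N = 0 := by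
      intro i
      funext δ
      have := congrFun (hN.tailCol_mul N⁻¹ δ) i
      rw [h1, tailCol_one] at this
      simp only [Matrix.vecMul, dotProduct, Fin.sum_univ_two, headBlock, Matrix.of_apply]
      simp only [Pi.add_apply, Pi.smul_apply, smul_eq_mul, Pi.zero_apply] at this ⊢
      linarith
    intro δ
    funext i
    by_contra hne
    refine hN.head_pos.ne' ?_
    rw [← Matrix.exists_vecMul_eq_zero_iff]
    exact ⟨_, fun h => hne (congrFun h δ), h3 i⟩
  · have := congrArg Matrix.det h2
    rw [Matrix.det_mul, Matrix.det_one] at this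
    exact pos_of_mul_pos_left (this ▸ one_pos) hN.head_pos.le

variable {P : OrientedPlane n} {g g' : Frame n}

lemma IsParabolic.frameMul_zero (hN : IsParabolic N) (g : Frame n) (δ) :
    frameMul g N (0, δ) = N (0, 0) (0, δ) • g (0, 0) + N (0, 1) (0, δ) • g (0, 1) := by
  rw [frameMul_apply g hN.det_ne_zero, sum_block]
  simp [hN.apply_succ_zero]

lemma IsParabolic.isPositiveFrame (hN : IsParabolic N)
    (hg : P.IsPositiveFrame (g (0, 0)) (g (0, 1))) :
    P.IsPositiveFrame (frameMul g N (0, 0)) (frameMul g N (0, 1)) := by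
  rw [hN.frameMul_zero, hN.frameMul_zero, OrientedPlane.isPositiveFrame_combination_iff hg]
  have := hN.head_pos
  rw [Matrix.det_fin_two] at this
  simp only [headBlock, Matrix.of_apply] at this
  linarith

lemma isParabolic_toMatrix (hg : P.IsPositiveFrame (g (0, 0)) (g (0, 1)))
    (hg' : P.IsPositiveFrame (g' (0, 0)) (g' (0, 1))) : IsParabolic (g.toMatrix g') := by
  have h6 : ∀ (ε : Fin 2) (i : Fin n × Fin 2), ((0 : Fin (n + 1)), ε) ≠ (i.1.succ, i.2) :=
    fun ε i h => Fin.succ_ne_zero i.1 (congrArg Prod.fst h).symm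
  obtain ⟨a, b, hab⟩ := hg.exists_of_mem hg'.mem_left
  obtain ⟨c, d, hcd⟩ := hg.exists_of_mem hg'.mem_right
  rw [hab, hcd, OrientedPlane.isPositiveFrame_combination_iff hg] at hg'
  refine ⟨det_toMatrix_ne_zero _ _, ?_, ?_⟩
  · rw [Fin.forall_fin_two]
    constructor <;> funext i <;>
      simp [tailCol, Basis.toMatrix_apply, hab, hcd, Finsupp.single_eq_of_ne' (h6 _ i)]
  · rw [Matrix.det_fin_two]
    simp only [headBlock, Matrix.of_apply, Basis.toMatrix_apply, hab, hcd]
    simpa [mul_comm] using hg'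

end Parabolic

namespace Fibration

variable {n : ℕ} {X : Type*} [TopologicalSpace X]
  [ChartedSpace (EuclideanSpace ℝ (Fin (2 * n))) X] {F : Fibration n X} {x : X} {g : Frame n}

lemma frameMul_mem_frames₁ {N : BlockMatrix (n + 1)} (hN : IsParabolic N) (hg : g ∈ F.frames₁) :
    frameMul g N ∈ F.frames₁ := by
  obtain ⟨x, hx⟩ := hg
  exact ⟨x, hN.isPositiveFrame hx⟩

/-- The Maurer-Cartan form of a bundle of frames stable under right multiplication by a parabolic
matrix. -/
lemma exists_maurerCartan_frameMul {B B' : Set (Frame n)} {N : BlockMatrix (n + 1)}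
    (hN : IsParabolic N) (hB : ∀ g ∈ B', frameMul g N⁻¹ ∈ B) {A : BlockMatrix (n + 1)}
    (hA : A ∈ maurerCartan B' (frameMul g N)) :
    ∃ A' ∈ maurerCartan B g, A = N⁻¹ * A' * N := by
  have h := maurerCartan_frameMul hN.inv.det_ne_zero hB hA
  rw [frameMul_mul_inv g hN.det_ne_zero, Matrix.nonsing_inv_nonsing_inv _ hN.det_ne_zero.isUnit]
    at h
  refine ⟨_, h, ?_⟩
  simp only [← mul_assoc]
  rw [Matrix.nonsing_inv_mul _ hN.det_ne_zero.isUnit, one_mul, mul_assoc,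
    Matrix.nonsing_inv_mul _ hN.det_ne_zero.isUnit, mul_one]

/-- The transformation law t' = m⁻¹(c + d t)(a + b t)⁻¹ m for the head block (a, c; b, d) and tail
block m, written without inverting a + b t. -/
lemma IsT.frameMul {N : BlockMatrix (n + 1)} (hN : IsParabolic N) {t t' : BlockMatrix n}
    (ht : F.IsT g t) (h : t' * ((tailBlock N)⁻¹ * (N (0, 0) (0, 0) • 1 + N (0, 1) (0, 0) • t)) =
      (tailBlock N)⁻¹ * (N (0, 0) (0, 1) • 1 + N (0, 1) (0, 1) • t)) :
    F.IsT (frameMul g N) t' := by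
  rw [isT_iff] at ht ⊢
  intro A' hA'
  obtain ⟨A, hA, rfl⟩ := exists_maurerCartan_frameMul hN
    (fun g hg => frameMul_mem_frames₁ hN.inv hg) hA'
  have h1 : ∀ δ, tailCol (N⁻¹ * A * N) δ =
      ((tailBlock N)⁻¹ * (N (0, 0) (0, δ) • 1 + N (0, 1) (0, δ) • t)) *ᵥ tailCol A 0 := by
    intro δ
    rw [← Matrix.mulVec_mulVec, Matrix.add_mulVec, Matrix.smul_mulVec, Matrix.smul_mulVec,
      Matrix.one_mulVec, ← ht A hA, ← hN.tailBlock_mulVec_tailCol, Matrix.mulVec_mulVec,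
      Matrix.nonsing_inv_mul _ hN.det_tail_ne_zero.isUnit, Matrix.one_mulVec]
  rw [h1, h1, Matrix.mulVec_mulVec, h]

/-- The set of frames characterised by the normalisation `J_t = J₀`. -/
lemma mem_frames₂_iff (hg : (F.plane x).IsPositiveFrame (g (0, 0)) (g (0, 1))) :
    g ∈ F.frames₂ ↔ ∃ τ : CMatrix n, F.IsT g (ofParts τ 0) ∧ UpperSpectrum τ := by
  constructor
  · rintro ⟨-, t, ht, hJ⟩
    rw [isAssociatedComplexStructure_stdJ_iff] at hJ
    refine ⟨cPart t, ?_, hJ.2⟩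
    rwa [← hJ.1, ofParts_parts]
  · rintro ⟨τ, ht, hτ⟩
    refine ⟨⟨x, hg⟩, _, ht, ?_⟩
    rw [isAssociatedComplexStructure_stdJ_iff, cPart_ofParts, aPart_ofParts]
    exact ⟨rfl, hτ⟩

lemma IsLocalSection.isT_unique {Θ} (h : IsLocalSection F F.frames₁ x g Θ) {t t' : BlockMatrix n}
    (ht : F.IsT g t) (ht' : F.IsT g t') : t = t' := by
  rw [isT_iff] at ht ht'
  refine Matrix.toLin'.injective (LinearMap.ext fun u => ?_)
  obtain ⟨A, hA, rfl⟩ := h.exists_mem_maurerCartan u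
  rw [Matrix.toLin'_apply, Matrix.toLin'_apply, ← ht A hA, ← ht' A hA]

/-- A local section may be renormalised by block diagonal matrices. The first column (1, 0) of the
head block keeps e₀ itself, so the surjectivity of its transverse derivative is inherited. -/
lemma IsLocalSection.mul_blockDiag {B B' : Set (Frame n)} {Θ} (hΘ : IsLocalSection F B x g Θ)
    {h : EuclideanSpace ℝ (Fin (2 * n)) → Matrix (Fin 2) (Fin 2) ℝ}
    {M : EuclideanSpace ℝ (Fin (2 * n)) → BlockMatrix n} (h0 : h (chartAt _ x x) = 1)
    (h1 : ∀ᶠ y in 𝓝 (chartAt _ x x), h y 0 0 = 1 ∧ h y 1 0 = 0)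
    (hc : ∀ i j, ContDiffAt ℝ ∞ (fun y => h y i j) (chartAt _ x x))
    (hM0 : M (chartAt _ x x) = 1) (hMc : ∀ i j, ContDiffAt ℝ ∞ (fun y => M y i j) (chartAt _ x x))
    (hB : ∀ᶠ y in 𝓝 (chartAt _ x x),
      frameMul (frameMul g (Θ y)) (blockDiag (h y) (M y)) ∈ B') :
    IsLocalSection F B' x g fun y => Θ y * blockDiag (h y) (M y) := by
  have hbc : ∀ i j, ContDiffAt ℝ ∞ (fun y => blockDiag (h y) (M y) i j) (chartAt _ x x) := by
    rintro ⟨a, ε⟩ ⟨b, δ⟩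
    refine Fin.cases ?_ (fun p => ?_) a <;> refine Fin.cases ?_ (fun q => ?_) b <;> simp
    · exact hc ε δ
    · exact contDiffAt_const
    · exact contDiffAt_const
    · exact hMc _ _
  have hdc : ContinuousAt (fun y => (h y).det) (chartAt _ x x) := by
    simp only [Matrix.det_fin_two]
    exact ((hc 0 0).continuousAt.mul (hc 1 1).continuousAt).sub
      ((hc 0 1).continuousAt.mul (hc 1 0).continuousAt)
  have hdet : ∀ᶠ y in 𝓝 (chartAt _ x x), 0 < (h y).det :=
    continuousAt_const.eventually_lt hdc (by simp [h0])
  have hMd : ∀ᶠ y in 𝓝 (chartAt _ x x), (M y).det ≠ 0 :=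
    GreatCircle.eventually_det_ne_zero hMc (by simp [hM0])
  have hpar : ∀ᶠ y in 𝓝 (chartAt _ x x), IsParabolic (blockDiag (h y) (M y)) := by
    filter_upwards [hdet, hMd] with y h2 h3 using isParabolic_blockDiag h2 h3
  have heq : ∀ᶠ y in 𝓝 (chartAt _ x x), frameMul g (Θ y * blockDiag (h y) (M y)) =
      frameMul (frameMul g (Θ y)) (blockDiag (h y) (M y)) := by
    filter_upwards [hpar, hΘ.eventually_det_ne_zero] with y h2 h3
    rw [frameMul_frameMul g h3 h2.det_ne_zero]
  refine ⟨?_, contDiffAt_matrix_mul hΘ.contDiffAt hbc, ?_, ?_, ?_⟩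
  · rw [hΘ.apply_base, h0, hM0, blockDiag_one, one_mul]
  · filter_upwards [heq, hB] with y h2 h3
    rwa [h2]
  · filter_upwards [heq, hpar, hΘ.eventually_frame] with y h2 h3 h4
    rw [h2]
    exact h3.isPositiveFrame h4
  · intro u
    obtain ⟨v, hv⟩ := hΘ.exists_hasDerivAt u
    refine ⟨v, fun i => (hv i).congr_of_eventuallyEq ?_⟩
    have hl : Tendsto (fun s : ℝ => chartAt (EuclideanSpace ℝ (Fin (2 * n))) x x + s • v) (𝓝 0)
        (𝓝 (chartAt _ x x)) := by
      have : Continuous (fun s : ℝ => chartAt (EuclideanSpace ℝ (Fin (2 * n))) x x + s • v) := by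
        fun_prop
      simpa using this.tendsto 0
    filter_upwards [hl.eventually hpar, hl.eventually h1] with s h2 h3
    rw [h2.mul_apply_zero, blockDiag_zero_zero, blockDiag_zero_zero, h3.1, h3.2]
    simp

variable [IsManifold (𝓡 (2 * n)) ∞ X]

lemma isT_unique (hg : g ∈ F.frames₁) {t t' : BlockMatrix n} (ht : F.IsT g t) (ht' : F.IsT g t') :
    t = t' := by
  obtain ⟨x, hx⟩ := hg
  obtain ⟨Θ, -, h, -⟩ := exists_isLocalSection₁ hx
  exact h.isT_unique ht ht'

/-- If t u = r u, a curve of frames with transverse velocity u of e₀ gives e₁ - r e₀ no transverse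
velocity. The base point would then be stationary, although e₀ shows that it moves unless u = 0. -/
lemma IsT.not_hasEigenvalue (hg : g ∈ F.frames₁) {t : BlockMatrix n} (ht : F.IsT g t) (r : ℝ) :
    ¬ End.HasEigenvalue (Matrix.toLin' t) r := by
  obtain ⟨x, hx⟩ := hg
  obtain ⟨Θ, -, h, -⟩ := exists_isLocalSection₁ hx
  intro hr
  obtain ⟨u, hu⟩ := hr.exists_hasEigenvector
  obtain ⟨A, hA, rfl⟩ := h.exists_mem_maurerCartan u
  have h1 : tailCol A 1 = r • tailCol A 0 := by
    rw [isT_iff.1 ht A hA, ← Matrix.toLin'_apply]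
    exact hu.apply_eq_smul
  have h2 := fderiv_chartBase_maurerCartan (x₀ := x) hA (mem_chart_source _ x) hx (a := -r) (b := 1)
    (by simp)
  have h3 : -r • tailCol A 0 + (1 : ℝ) • r • tailCol A 0 = 0 := by module
  rw [h1, h3, map_zero, map_zero] at h2
  exact hu.2 (eq_zero_of_fderiv_tailVec_eq_zero hx.left_ne_zero hx.mem_left
    (mem_chart_source _ x) hx h2.symm)

/-- Through every frame in `frames₂` there is a local section of `frames₂` along which `t` is
smooth. -/
theorem exists_isLocalSection₂ (hg : (F.plane x).IsPositiveFrame (g (0, 0)) (g (0, 1)))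
    (hg2 : g ∈ F.frames₂) :
    ∃ (Θ : EuclideanSpace ℝ (Fin (2 * n)) → BlockMatrix (n + 1))
      (τ : EuclideanSpace ℝ (Fin (2 * n)) → CMatrix n), IsLocalSection F F.frames₂ x g Θ ∧
      (∀ i j, ContDiffAt ℝ ∞ (fun y => τ y i j) (chartAt _ x x)) ∧
      ∀ᶠ y in 𝓝 (chartAt _ x x), F.IsT (GreatCircle.frameMul g (Θ y)) (ofParts (τ y) 0) ∧
        UpperSpectrum (τ y) := by
  obtain ⟨Θ, t, hΘ, htc, ht⟩ := exists_isLocalSection₁ hg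
  obtain ⟨-, t₀, ht₀, hJ⟩ := hg2
  have ht0 : t (chartAt _ x x) = t₀ := by
    have h1 := ht.self_of_nhds
    rw [hΘ.apply_base, frameMul_one] at h1
    exact hΘ.isT_unique h1 ht₀
  obtain ⟨M, hM0, hMc, hM⟩ := exists_smooth_conj_isAssociated htc (by rwa [ht0])
  -- With trivial head block, changing the tail vectors by M conjugates t by M.
  have hT : ∀ᶠ y in 𝓝 (chartAt _ x x),
      F.IsT (GreatCircle.frameMul (GreatCircle.frameMul g (Θ y)) (blockDiag 1 (M y)))
        ((M y)⁻¹ * t y * M y) := by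
    filter_upwards [ht, hM] with y h1 h2
    refine h1.frameMul (isParabolic_blockDiag (by simp) h2.1) ?_
    simp only [tailBlock_blockDiag, blockDiag_zero_zero, Matrix.one_apply]
    simp only [mul_assoc, Matrix.mul_nonsing_inv_cancel_left _ _ h2.1.isUnit]
    simp
  have hsec : IsLocalSection F F.frames₂ x g fun y => Θ y * blockDiag 1 (M y) := by
    refine hΘ.mul_blockDiag rfl (by simp) (fun i j => contDiffAt_const) hM0 hMc ?_
    filter_upwards [hT, hM, hΘ.eventually_mem] with y h1 h2 h3
    exact ⟨frameMul_mem_frames₁ (isParabolic_blockDiag (by simp) h2.1) h3, _, h1, h2.2⟩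
  refine ⟨_, fun y => cPart ((M y)⁻¹ * t y * M y), hsec, contDiffAt_cPart
    (contDiffAt_matrix_mul (contDiffAt_matrix_mul (contDiffAt_matrix_inv hMc (by simp [hM0])) htc)
      hMc), ?_⟩
  filter_upwards [hT, hM, hΘ.eventually_det_ne_zero] with y h1 h2 h3
  have h4 := isAssociatedComplexStructure_stdJ_iff.1 h2.2
  refine ⟨?_, h4.2⟩
  rw [← h4.1, ofParts_parts, ← frameMul_frameMul g h3 (det_blockDiag_ne_zero (by simp) h2.1)]
  exact h1

end Fibration

end GreatCircle

namespace GreatCircle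

open Matrix ComplexConjugate

/-! ### Möbius covariance of the barycenter, and the trace of `s`. -/

section Parts

variable {m : ℕ}

lemma cPart_smul (c : ℝ) (A : BlockMatrix m) : cPart (c • A) = (c : ℂ) • cPart A := by
  ext P Q
  apply Complex.ext <;> (simp [Omega]; ring)

lemma aPart_smul (c : ℝ) (A : BlockMatrix m) : aPart (c • A) = (c : ℂ) • aPart A := by
  ext P Q
  apply Complex.ext <;> (simp [OmegaBar]; ring)

/-- The complex vector with the given real and imaginary parts. -/
noncomputable def complexVec (u : Fin m × Fin 2 → ℝ) : Fin m → ℂ := fun p => ⟨u (p, 0), u (p, 1)⟩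

lemma complexVec_surjective : Function.Surjective (complexVec (m := m)) := fun v =>
  ⟨fun a => ![(v a.1).re, (v a.1).im] a.2, by
    funext p
    apply Complex.ext <;> simp [complexVec]⟩

lemma complexVec_injective : Function.Injective (complexVec (m := m)) := fun u v h => by
  funext ⟨p, ε⟩
  have := congrFun h p
  rw [Complex.ext_iff] at this
  fin_cases ε
  · exact this.1
  · exact this.2

lemma complexVec_ofParts_mulVec (τ : CMatrix m) (u : Fin m × Fin 2 → ℝ) :
    complexVec (ofParts τ 0 *ᵥ u) = τ *ᵥ complexVec u := by
  funext p
  apply Complex.ext <;>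
    simp [complexVec, ofParts, Matrix.mulVec, dotProduct, Fintype.sum_prod_type,
      Complex.mul_re, Complex.mul_im, Finset.sum_add_distrib, sub_eq_add_neg, add_comm]

/-- Conformal naturality: an orientation preserving real fractional linear map carries barycenters
to barycenters. The proof works with the resolvent: with w the conjugate of the new point, τ' - w is
a scalar multiple of (τ - z̄)(a + bτ)⁻¹. -/
lemma IsBarycenter.moebius {τ τ' : CMatrix m} (h : UpperSpectrum τ) {z : ℂ}
    (hb : IsBarycenter τ z) {a b c d : ℝ} (hdet : 0 < a * d - b * c)
    (hτ' : τ' * ((a : ℂ) • (1 : CMatrix m) + (b : ℂ) • τ) =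
      (c : ℂ) • (1 : CMatrix m) + (d : ℂ) • τ) :
    IsBarycenter τ' ((c + d * z) / (a + b * z)) := by
  obtain ⟨hz, htr⟩ := hb
  have hne : ∀ w : ℂ, w.im ≠ 0 → (a : ℂ) + b * w ≠ 0 := by
    intro w hw h0
    rw [Complex.ext_iff] at h0
    simp at h0
    rcases h0.2 with h1 | h1
    · rw [h1] at h0
      simp at h0
      rw [h0, h1] at hdet
      simp at hdet
    · exact hw h1
  have hz0 := hne z hz.ne'
  have hz1 : (a : ℂ) + b * conj z ≠ 0 := hne _ (by simpa using hz.ne')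
  have hD : ((a * d - b * c : ℝ) : ℂ) ≠ 0 := by exact_mod_cast hdet.ne'
  have hzz : z - conj z ≠ 0 := by
    rw [Complex.sub_conj]
    simp [hz.ne']
  refine ⟨?_, ?_⟩
  · rw [Complex.div_im, ← sub_div]
    refine div_pos ?_ (Complex.normSq_pos.2 hz0)
    simp
    nlinarith [mul_pos hdet hz]
  set B := (a : ℂ) • (1 : CMatrix m) + (b : ℂ) • τ with hB
  set K := τ - conj z • (1 : CMatrix m) with hK
  have hKd : K.det ≠ 0 := h _ (by simpa using hz.le)
  have hBd : B.det ≠ 0 := h.det_add_ne_zero hdet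
  have hw : conj ((c + d * z) / (a + b * z)) = (c + d * conj z) / (a + b * conj z) := by simp
  rw [hw]
  set w := (c + d * conj z) / (a + b * conj z) with hw
  have hBK : B = (b : ℂ) • K + (a + b * conj z) • (1 : CMatrix m) := by
    rw [hB, hK]
    module
  have h1 : (τ' - w • (1 : CMatrix m)) * B = (((a * d - b * c : ℝ) : ℂ) / (a + b * conj z)) • K := by
    rw [sub_mul, hτ', smul_mul_assoc, one_mul, hB, hK, hw]
    have e : ∀ a b c d z : ℂ, a + b * z ≠ 0 →
        c - (c + d * z) / (a + b * z) * a = -((a * d - b * c) / (a + b * z) * z) ∧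
        d - (c + d * z) / (a + b * z) * b = (a * d - b * c) / (a + b * z) := fun a b c d z h => by
      obtain ⟨P, hP⟩ : ∃ P, P = a + b * z := ⟨_, rfl⟩
      rw [← hP] at h ⊢
      obtain rfl : a = P - b * z := by rw [hP]; ring
      constructor <;> field_simp <;> ring
    obtain ⟨e1, e2⟩ := e a b c d (conj z) hz1
    push_cast
    rw [smul_sub, smul_smul]
    rw [← neg_eq_iff_eq_neg] at e1
    rw [← e1, ← e2]
    module
  have h2 : (τ' - w • (1 : CMatrix m))⁻¹ =
      ((a + b * conj z) / ((a * d - b * c : ℝ) : ℂ)) •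
        ((b : ℂ) • (1 : CMatrix m) + (a + b * conj z) • K⁻¹) := by
    refine Matrix.inv_eq_right_inv ?_
    have e3 : (b : ℂ) • (1 : CMatrix m) + (a + b * conj z) • K⁻¹ = B * K⁻¹ := by
      rw [hBK, add_mul, smul_mul_assoc, smul_mul_assoc, one_mul,
        Matrix.mul_nonsing_inv _ hKd.isUnit]
    rw [e3, mul_smul_comm, ← mul_assoc, h1, smul_mul_assoc, Matrix.mul_nonsing_inv _ hKd.isUnit,
      smul_smul]
    convert one_smul ℂ (1 : CMatrix m)
    field_simp
  have htr' : (K⁻¹).trace = m / (z - conj z) := by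
    rw [← htr]
    field_simp
  rw [h2, Matrix.trace_smul, Matrix.trace_add, Matrix.trace_smul, Matrix.trace_smul, htr',
    Matrix.trace_one, Fintype.card_fin, hw]
  simp only [smul_eq_mul]
  have e : ∀ a b c d z z' D m : ℂ, D = a * d - b * c → D ≠ 0 → a + b * z ≠ 0 → a + b * z' ≠ 0 →
      z - z' ≠ 0 → ((c + d * z) / (a + b * z) - (c + d * z') / (a + b * z')) *
        ((a + b * z') / D * (b * m + (a + b * z') * (m / (z - z')))) = m := by
    intro a b c d z z' D m hD hD0 h1 h2 h3
    obtain ⟨P, hP⟩ : ∃ P, P = a + b * z := ⟨_, rfl⟩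
    obtain ⟨Q, hQ⟩ : ∃ Q, Q = a + b * z' := ⟨_, rfl⟩
    have h5 : b * (z - z') + Q = P := by rw [hP, hQ]; ring
    have h4 : (c + d * z) / (a + b * z) - (c + d * z') / (a + b * z') =
        D * (z - z') / ((a + b * z) * (a + b * z')) := by
      rw [div_sub_div _ _ h1 h2, hD]
      congr 1
      ring
    rw [h4]
    rw [← hP] at h1 ⊢
    rw [← hQ] at h2 ⊢
    field_simp
    linear_combination m * h5
  exact e a b c d z (conj z) _ m (by push_cast; rfl) hD hz0 hz1 hzz

lemma IsBarycenter.conj_of_mul_eq {τ τ' μ : CMatrix m} {z : ℂ} (hb : IsBarycenter τ' z)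
    (hμ : μ.det ≠ 0) (h : τ * μ = μ * τ') : IsBarycenter τ z := by
  refine ⟨hb.1, ?_⟩
  have h1 : τ - conj z • (1 : CMatrix m) = μ * (τ' - conj z • (1 : CMatrix m)) * μ⁻¹ := by
    rw [mul_sub, ← h, sub_mul, mul_assoc, Matrix.mul_nonsing_inv _ hμ.isUnit, mul_one,
      mul_smul_comm, mul_one, smul_mul_assoc, Matrix.mul_nonsing_inv _ hμ.isUnit]
  rw [h1, Matrix.mul_inv_rev, Matrix.mul_inv_rev, Matrix.nonsing_inv_nonsing_inv _ hμ.isUnit,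
    Matrix.trace_mul_comm, mul_assoc, Matrix.nonsing_inv_mul _ hμ.isUnit, mul_one]
  exact hb.2

end Parts

section Omega

variable {n : ℕ} (A : BlockMatrix (n + 1)) (p : Fin n)

lemma Omega_succ_zero :
    Omega A p.succ 0 = (complexVec (tailCol A 0) p - Complex.I * complexVec (tailCol A 1) p) / 2 := by
  apply Complex.ext <;> simp [Omega, complexVec, tailCol]

lemma OmegaBar_succ_zero : OmegaBar A p.succ 0 =
    -Complex.I * (complexVec (tailCol A 0) p + Complex.I * complexVec (tailCol A 1) p) / 2 := by
  apply Complex.ext <;> simp [OmegaBar, complexVec, tailCol, sub_eq_add_neg]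

end Omega

namespace Fibration

variable {n : ℕ} {X : Type*} [TopologicalSpace X]
  [ChartedSpace (EuclideanSpace ℝ (Fin (2 * n))) X] {F : Fibration n X} {x : X} {g : Frame n}

lemma complexVec_tailCol_one {τ : CMatrix n} (hτ : F.IsT g (ofParts τ 0))
    {A : BlockMatrix (n + 1)} (hA : A ∈ maurerCartan F.frames₁ g) :
    complexVec (tailCol A 1) = τ *ᵥ complexVec (tailCol A 0) := by
  rw [isT_iff.1 hτ A hA, complexVec_ofParts_mulVec]

/-- Along `frames₁`, the forms `Ω^p_0` are a complex linear function of `ω^i_0`. -/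
lemma two_smul_Omega {τ : CMatrix n} (hτ : F.IsT g (ofParts τ 0))
    {A : BlockMatrix (n + 1)} (hA : A ∈ maurerCartan F.frames₁ g) :
    (fun p : Fin n => 2 * Omega A p.succ 0) =
      ((1 : CMatrix n) - Complex.I • τ) *ᵥ complexVec (tailCol A 0) := by
  funext p
  rw [Omega_succ_zero, complexVec_tailCol_one hτ hA, Matrix.sub_mulVec, Matrix.one_mulVec,
    Matrix.smul_mulVec]
  simp
  ring

lemma two_smul_OmegaBar {τ : CMatrix n} (hτ : F.IsT g (ofParts τ 0))
    {A : BlockMatrix (n + 1)} (hA : A ∈ maurerCartan F.frames₁ g) :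
    (fun p : Fin n => 2 * OmegaBar A p.succ 0) =
      (-Complex.I • ((1 : CMatrix n) + Complex.I • τ)) *ᵥ complexVec (tailCol A 0) := by
  funext p
  rw [OmegaBar_succ_zero, complexVec_tailCol_one hτ hA, Matrix.smul_mulVec, Matrix.add_mulVec,
    Matrix.one_mulVec, Matrix.smul_mulVec]
  simp
  ring

variable [IsManifold (𝓡 (2 * n)) ∞ X]

/-- In complex notation 2Ω^p_0 = (1 - iτ)ω₀ and its antilinear partner is -i(1 + iτ)ω₀. All values
of ω₀ occur, so s = -i(1 + iτ)(1 - iτ)⁻¹. -/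
lemma isS_iff (hg : (F.plane x).IsPositiveFrame (g (0, 0)) (g (0, 1))) {τ s : CMatrix n}
    (hτ : F.IsT g (ofParts τ 0)) (hup : UpperSpectrum τ) :
    F.IsS g s ↔ s * ((1 : CMatrix n) - Complex.I • τ) =
      -Complex.I • ((1 : CMatrix n) + Complex.I • τ) := by
  have h1 : ∀ A ∈ maurerCartan F.frames₂ g, (∀ p : Fin n, OmegaBar A p.succ 0 =
      ∑ q : Fin n, s p q * Omega A q.succ 0) ↔
      (s * ((1 : CMatrix n) - Complex.I • τ)) *ᵥ complexVec (tailCol A 0) =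
      (-Complex.I • ((1 : CMatrix n) + Complex.I • τ)) *ᵥ complexVec (tailCol A 0) := by
    intro A hA
    have hA1 := maurerCartan_mono (fun g hg => hg.1) g hA
    rw [← two_smul_OmegaBar hτ hA1, ← Matrix.mulVec_mulVec, ← two_smul_Omega hτ hA1, eq_comm,
      funext_iff]
    refine forall_congr' fun p => ?_
    simp only [Matrix.mulVec, dotProduct]
    rw [show ∑ q : Fin n, s p q * (2 * Omega A q.succ 0) =
      2 * ∑ q : Fin n, s p q * Omega A q.succ 0 by
        rw [Finset.mul_sum]
        exact Finset.sum_congr rfl fun q _ => by ring]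
    exact (mul_right_inj' two_ne_zero).symm
  obtain ⟨Θ, -, hΘ, -⟩ := exists_isLocalSection₂ hg ((mem_frames₂_iff hg).2 ⟨τ, hτ, hup⟩)
  constructor
  · intro h
    refine Matrix.toLin'.injective (LinearMap.ext fun v => ?_)
    obtain ⟨u, rfl⟩ := complexVec_surjective v
    obtain ⟨A, hA, rfl⟩ := hΘ.exists_mem_maurerCartan u
    exact (h1 A hA).1 (h A hA)
  · intro h A hA
    rw [h1 A hA, h]

/-- With K = τ + i one has s = i(1 - 2iK⁻¹), i times the Cayley transform of τ; its trace vanishes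
exactly when 2i tr K⁻¹ = n, the barycenter equation at z = i. -/
lemma exists_isS_iff (hg : (F.plane x).IsPositiveFrame (g (0, 0)) (g (0, 1))) {τ : CMatrix n}
    (hτ : F.IsT g (ofParts τ 0)) (hup : UpperSpectrum τ) :
    (∃ s, F.IsS g s ∧ s.trace = 0) ↔ IsBarycenter τ Complex.I := by
  set K := τ - (-Complex.I) • (1 : CMatrix n) with hK
  have hKd : K.det ≠ 0 := hup _ (by simp)
  have h1 : (1 : CMatrix n) - Complex.I • τ = -Complex.I • K := by
    rw [hK, smul_sub, smul_smul]
    simp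
    abel
  have h2 : -Complex.I • ((1 : CMatrix n) + Complex.I • τ) = K - (2 * Complex.I) • 1 := by
    rw [hK, smul_add, smul_smul]
    simp
    module
  have h3 : ∀ s : CMatrix n, F.IsS g s ↔ s = Complex.I • (1 - (2 * Complex.I) • K⁻¹) := by
    intro s
    rw [isS_iff hg hτ hup, h1, h2]
    constructor
    · intro h
      have h4 : s * K = Complex.I • (K - (2 * Complex.I) • 1) := by
        rw [← h, mul_smul_comm, smul_smul]
        simp
      have h5 := congrArg (· * K⁻¹) h4
      simp only [mul_assoc, Matrix.mul_nonsing_inv _ hKd.isUnit, mul_one, smul_mul_assoc,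
        sub_mul, one_mul] at h5
      exact h5
    · rintro rfl
      rw [smul_mul_smul_comm, sub_mul, one_mul, smul_mul_assoc,
        Matrix.nonsing_inv_mul _ hKd.isUnit]
      simp
  have h6 : (∃ s, F.IsS g s ∧ s.trace = 0) ↔
      (Complex.I • ((1 : CMatrix n) - (2 * Complex.I) • K⁻¹)).trace = 0 := by
    simp only [h3, exists_eq_left]
  rw [h6, Matrix.trace_smul, Matrix.trace_sub, Matrix.trace_smul, Matrix.trace_one, Fintype.card_fin,
    smul_eq_zero_iff_right Complex.I_ne_zero, sub_eq_zero, IsBarycenter]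
  simp only [Complex.conj_I, Complex.I_im, one_pos, true_and, sub_neg_eq_add, smul_eq_mul]
  rw [← hK, two_mul, eq_comm]

lemma mem_frames₃_iff (hg : (F.plane x).IsPositiveFrame (g (0, 0)) (g (0, 1))) :
    g ∈ F.frames₃ ↔ ∃ τ : CMatrix n, F.IsT g (ofParts τ 0) ∧ UpperSpectrum τ ∧
      IsBarycenter τ Complex.I := by
  constructor
  · rintro ⟨h2, hs⟩
    obtain ⟨τ, hτ, hup⟩ := (mem_frames₂_iff hg).1 h2
    exact ⟨τ, hτ, hup, (exists_isS_iff hg hτ hup).1 hs⟩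
  · rintro ⟨τ, hτ, hup, hb⟩
    exact ⟨(mem_frames₂_iff hg).2 ⟨τ, hτ, hup⟩, (exists_isS_iff hg hτ hup).2 hb⟩

end Fibration

end GreatCircle

namespace GreatCircle

/-! ### The structure group and the sections of `frames₃`. -/

open Matrix ComplexConjugate

lemma ofParts_affine {m : ℕ} (a b : ℝ) (τ : CMatrix m) :
    a • (1 : BlockMatrix m) + b • ofParts τ 0 = ofParts ((a : ℂ) • 1 + (b : ℂ) • τ) 0 := by
  refine parts_ext ?_ ?_
  · simp [cPart_add, cPart_smul]
  · simp [aPart_add, aPart_smul]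

lemma ofParts_mul {m : ℕ} (τ τ' : CMatrix m) : ofParts τ 0 * ofParts τ' 0 = ofParts (τ * τ') 0 := by
  refine parts_ext ?_ ?_
  · simp [cPart_mul]
  · simp [aPart_mul]

lemma isAssociatedComplexStructure_ofParts {m : ℕ} {τ : CMatrix m} (h : UpperSpectrum τ) :
    IsAssociatedComplexStructure (ofParts τ 0) (stdJ m) := by
  rw [isAssociatedComplexStructure_stdJ_iff, cPart_ofParts, aPart_ofParts]
  exact ⟨rfl, h⟩

lemma det_cPart_ne_zero {m : ℕ} {M : BlockMatrix m} (hM : M.det ≠ 0) (ha : aPart M = 0) :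
    (cPart M).det ≠ 0 := by
  have h6 := congrArg cPart (Matrix.nonsing_inv_mul _ hM.isUnit)
  rw [cPart_mul, ha, conjM_zero, mul_zero, add_zero, cPart_one] at h6
  intro h0
  have := congrArg Matrix.det h6
  rw [Matrix.det_mul, h0, mul_zero, Matrix.det_one] at this
  exact zero_ne_one this

lemma UpperSpectrum.conj_of_mul_eq {m : ℕ} {τ τ' μ : CMatrix m} (h : UpperSpectrum τ')
    (hμ : μ.det ≠ 0) (he : τ * μ = μ * τ') : UpperSpectrum τ := by
  intro ζ hζ h0
  have h1 : (τ - ζ • 1) * μ = μ * (τ' - ζ • 1) := by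
    rw [mul_sub, ← he, sub_mul, mul_smul_comm, mul_one, smul_mul_assoc, one_mul]
  have h2 := congrArg Matrix.det h1
  rw [Matrix.det_mul, Matrix.det_mul, h0, zero_mul] at h2
  exact mul_ne_zero hμ (h ζ hζ) h2.symm

namespace Fibration

variable {n : ℕ} {X : Type*} [TopologicalSpace X]
  [ChartedSpace (EuclideanSpace ℝ (Fin (2 * n))) X] {F : Fibration n X} {x : X} {g : Frame n}
  [IsManifold (𝓡 (2 * n)) ∞ X]

/-- The converse of `IsT.frameMul`: the relation between t and t' is forced because the transverse
velocity of e₀ is arbitrary. -/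
lemma IsT.mul_eq {N : BlockMatrix (n + 1)} (hN : IsParabolic N) (hg : g ∈ F.frames₁)
    {t t' : BlockMatrix n} (ht : F.IsT g t) (ht' : F.IsT (GreatCircle.frameMul g N) t') :
    t' * ((tailBlock N)⁻¹ * (N (0, 0) (0, 0) • 1 + N (0, 1) (0, 0) • t)) =
      (tailBlock N)⁻¹ * (N (0, 0) (0, 1) • 1 + N (0, 1) (0, 1) • t) := by
  obtain ⟨x, hx⟩ := hg
  obtain ⟨Θ, -, hΘ, -⟩ := exists_isLocalSection₁ hx
  rw [isT_iff] at ht ht'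
  refine Matrix.toLin'.injective (LinearMap.ext fun u => ?_)
  obtain ⟨A, hA, rfl⟩ := hΘ.exists_mem_maurerCartan u
  have h1 : ∀ δ, tailCol (N⁻¹ * A * N) δ =
      ((tailBlock N)⁻¹ * (N (0, 0) (0, δ) • 1 + N (0, 1) (0, δ) • t)) *ᵥ tailCol A 0 := by
    intro δ
    rw [← Matrix.mulVec_mulVec, Matrix.add_mulVec, Matrix.smul_mulVec, Matrix.smul_mulVec,
      Matrix.one_mulVec, ← ht A hA, ← hN.tailBlock_mulVec_tailCol, Matrix.mulVec_mulVec,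
      Matrix.nonsing_inv_mul _ hN.det_tail_ne_zero.isUnit, Matrix.one_mulVec]
  have h2 := ht' _ (maurerCartan_frameMul hN.det_ne_zero
    (fun g hg => frameMul_mem_frames₁ hN hg) hA)
  rw [h1, h1, Matrix.mulVec_mulVec] at h2
  exact h2.symm

/-- Two frames in `frames₃` over the same point differ by a matrix with complex diagonal blocks. -/
lemma parabolic_of_frames₃ (hn : 0 < n) (hg : (F.plane x).IsPositiveFrame (g (0, 0)) (g (0, 1)))
    (hg3 : g ∈ F.frames₃) {N : BlockMatrix (n + 1)} (hN : IsParabolic N)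
    (hN3 : GreatCircle.frameMul g N ∈ F.frames₃) :
    aPart (tailBlock N) = 0 ∧ N (0, 1) (0, 1) = N (0, 0) (0, 0) ∧
      N (0, 1) (0, 0) = - N (0, 0) (0, 1) := by
  obtain ⟨τ, hτ, hup, hb⟩ := (mem_frames₃_iff hg).1 hg3
  obtain ⟨τ', hτ', hup', hb'⟩ := (mem_frames₃_iff (hN.isPositiveFrame hg)).1 hN3
  have h1 := hτ.mul_eq hN ⟨x, hg⟩ hτ'
  have hdet : 0 < N (0, 0) (0, 0) * N (0, 1) (0, 1) - N (0, 1) (0, 0) * N (0, 0) (0, 1) := by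
    have := hN.head_pos
    rw [Matrix.det_fin_two] at this
    simp only [headBlock, Matrix.of_apply] at this
    linarith
  set a := N (0, 0) (0, 0)
  set b := N (0, 1) (0, 0)
  set c := N (0, 0) (0, 1)
  set d := N (0, 1) (0, 1)
  set M := tailBlock N
  have hM : IsUnit M.det := hN.det_tail_ne_zero.isUnit
  have hBd := hup.det_add_ne_zero hdet
  set τ₁ : CMatrix n := ((c : ℂ) • 1 + (d : ℂ) • τ) * ((a : ℂ) • 1 + (b : ℂ) • τ)⁻¹ with hτ₁
  have h2 : τ₁ * ((a : ℂ) • 1 + (b : ℂ) • τ) = (c : ℂ) • 1 + (d : ℂ) • τ := by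
    rw [hτ₁, mul_assoc, Matrix.nonsing_inv_mul _ hBd.isUnit, mul_one]
  have hup₁ : UpperSpectrum τ₁ := hup.moebius hdet h2
  have hb₁ := hb.moebius hup hdet h2
  rw [ofParts_affine, ofParts_affine, ← h2, ← ofParts_mul] at h1
  -- The head block acts on τ by a Möbius map, giving τ₁, and the tail block conjugates τ₁ to τ'.
  -- Both have spectrum in the upper half-plane, so the tail block is complex.
  have h3 : ofParts τ₁ 0 * M = M * ofParts τ' 0 := by
    have hB := (det_ofParts_ne_zero hBd).isUnit
    have h4 := congrArg (fun Z => M * (Z * (ofParts ((a : ℂ) • 1 + (b : ℂ) • τ) 0)⁻¹) * M) h1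
    simp only [mul_assoc, Matrix.mul_nonsing_inv_cancel_left _ _ hM, Matrix.mul_nonsing_inv _ hB,
      mul_one, Matrix.nonsing_inv_mul _ hM] at h4
    exact h4.symm
  have haM : aPart M = 0 := aPart_eq_zero_of_isAssociated
    (isAssociatedComplexStructure_ofParts hup₁) (isAssociatedComplexStructure_ofParts hup') h3
  have hcM : (cPart M).det ≠ 0 :=
    det_cPart_ne_zero hM.ne_zero haM
  have h9 : τ₁ * cPart M = cPart M * τ' := by
    have := congrArg cPart h3
    simpa [cPart_mul, haM] using this
  have hb₂ := hb'.conj_of_mul_eq hcM h9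
  -- The barycenter of τ₁ is i, being similar to τ', and also (c + di)/(a + bi), the image of the
  -- barycenter i of τ. Equating the two gives d = a and b = -c.
  have h10 := IsBarycenter.unique hn hup₁ hb₂ hb₁
  have h11 : (a : ℂ) + b * Complex.I ≠ 0 := by
    intro h0
    rw [Complex.ext_iff] at h0
    simp at h0
    rw [h0.1, h0.2] at hdet
    simp at hdet
  rw [div_eq_iff h11, Complex.ext_iff] at h10
  simp at h10
  exact ⟨haM, h10.2, by linarith [h10.1]⟩

/-- The matrices of `parabolic_of_frames₃` preserve `frames₃`. -/
lemma frameMul_mem_frames₃_of_parabolic (hg3 : g ∈ F.frames₃) {N : BlockMatrix (n + 1)}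
    (hN : IsParabolic N) (ha : aPart (tailBlock N) = 0)
    (hb : N (0, 1) (0, 1) = N (0, 0) (0, 0) ∧ N (0, 1) (0, 0) = - N (0, 0) (0, 1)) :
    GreatCircle.frameMul g N ∈ F.frames₃ := by
  obtain ⟨x, hg⟩ := hg3.1.1
  obtain ⟨τ, hτ, hup, hbar⟩ := (mem_frames₃_iff hg).1 hg3
  have hdet : 0 < N (0, 0) (0, 0) * N (0, 1) (0, 1) - N (0, 1) (0, 0) * N (0, 0) (0, 1) := by
    have := hN.head_pos
    rw [Matrix.det_fin_two] at this
    simp only [headBlock, Matrix.of_apply] at this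
    linarith
  set a := N (0, 0) (0, 0)
  set b := N (0, 1) (0, 0)
  set c := N (0, 0) (0, 1)
  set d := N (0, 1) (0, 1)
  set M := tailBlock N
  have hcM : (cPart M).det ≠ 0 := det_cPart_ne_zero hN.det_tail_ne_zero ha
  have hM' : M⁻¹ = ofParts (cPart M)⁻¹ 0 := by
    refine Matrix.inv_eq_right_inv ?_
    have hMo : M = ofParts (cPart M) 0 := by rw [← ha, ofParts_parts]
    conv_lhs => rw [hMo]
    rw [cPart_ofParts, ofParts_mul, Matrix.mul_nonsing_inv _ hcM.isUnit]
    exact parts_ext (by simp) (by simp)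
  have hcM' : ((cPart M)⁻¹).det ≠ 0 := by simpa [Matrix.det_nonsing_inv] using hcM
  have hBd := hup.det_add_ne_zero hdet
  set τ₁ : CMatrix n := ((c : ℂ) • 1 + (d : ℂ) • τ) * ((a : ℂ) • 1 + (b : ℂ) • τ)⁻¹ with hτ₁
  have h2 : τ₁ * ((a : ℂ) • 1 + (b : ℂ) • τ) = (c : ℂ) • 1 + (d : ℂ) • τ := by
    rw [hτ₁, mul_assoc, Matrix.nonsing_inv_mul _ hBd.isUnit, mul_one]
  have hup₁ : UpperSpectrum τ₁ := hup.moebius hdet h2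
  have hb₁ := hbar.moebius hup hdet h2
  have hconj : (cPart M)⁻¹ * τ₁ * cPart M * (cPart M)⁻¹ = (cPart M)⁻¹ * τ₁ := by
    rw [mul_assoc, Matrix.mul_nonsing_inv _ hcM.isUnit, mul_one]
  refine (mem_frames₃_iff (hN.isPositiveFrame hg)).2 ⟨(cPart M)⁻¹ * τ₁ * cPart M,
    hτ.frameMul hN ?_, hup₁.conj_of_mul_eq hcM' hconj, IsBarycenter.conj_of_mul_eq ?_ hcM' hconj⟩
  · change _ * (M⁻¹ * (a • 1 + b • ofParts τ 0)) = M⁻¹ * (c • 1 + d • ofParts τ 0)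
    rw [ofParts_affine, ofParts_affine, hM', ofParts_mul, ofParts_mul, ofParts_mul, ← mul_assoc,
      hconj, mul_assoc, h2]
  · have hne : (a : ℂ) + b * Complex.I ≠ 0 := by
      intro h0
      rw [Complex.ext_iff] at h0
      simp at h0
      rw [h0.1, h0.2] at hdet
      simp at hdet
    convert hb₁ using 1
    rw [eq_div_iff hne, hb.1, hb.2]
    push_cast
    linear_combination (-(c : ℂ)) * Complex.I_sq

/-- The matrix normalising the barycenter `z` to `i`. -/
noncomputable def normalizer (z : ℂ) : Matrix (Fin 2) (Fin 2) ℝ := !![1, -z.re / z.im; 0, 1 / z.im]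

lemma isParabolic_normalizer {z : ℂ} (hz : 0 < z.im) :
    IsParabolic (blockDiag (normalizer z) (1 : BlockMatrix n)) :=
  isParabolic_blockDiag (by rw [Matrix.det_fin_two]; simpa [normalizer] using hz) (by simp)

lemma frameMul_mem_frames₃ (hg : (F.plane x).IsPositiveFrame (g (0, 0)) (g (0, 1)))
    {τ : CMatrix n} (hτ : F.IsT g (ofParts τ 0)) (hup : UpperSpectrum τ) {z : ℂ}
    (hz : IsBarycenter τ z) :
    GreatCircle.frameMul g (blockDiag (normalizer z) 1) ∈ F.frames₃ := by
  have hz0 := hz.1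
  have hz0' : (z.im : ℂ) ≠ 0 := by exact_mod_cast hz0.ne'
  have hpar := isParabolic_normalizer (n := n) hz0
  have hdet : 0 < 1 * (1 / z.im) - 0 * (-z.re / z.im) := by simpa using hz0
  have hmul : (((-z.re / z.im : ℝ) : ℂ) • (1 : CMatrix n) + ((1 / z.im : ℝ) : ℂ) • τ) *
      (((1 : ℝ) : ℂ) • 1 + ((0 : ℝ) : ℂ) • τ) =
      ((-z.re / z.im : ℝ) : ℂ) • 1 + ((1 / z.im : ℝ) : ℂ) • τ := by simp
  refine (mem_frames₃_iff (hpar.isPositiveFrame hg)).2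
    -- The normaliser acts by τ ↦ (τ - Re z)/Im z, which takes z to i.
    ⟨((-z.re / z.im : ℝ) : ℂ) • 1 + ((1 / z.im : ℝ) : ℂ) • τ, hτ.frameMul hpar ?_,
      hup.moebius hdet hmul, ?_⟩
  · rw [← ofParts_affine]
    simp [normalizer]
  · have := hz.moebius hup hdet hmul
    convert this using 1
    apply Complex.ext
    · simp
      field_simp
      ring
    · simp
      field_simp

/-- Over every point there is a frame in `frames₃`. -/
lemma exists_mem_frames₃ (hn : 0 < n) (F : Fibration n X) (x : X) :
    ∃ g ∈ F.frames₃, (F.plane x).IsPositiveFrame (g (0, 0)) (g (0, 1)) := by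
  obtain ⟨g₁, hg₁⟩ : ∃ g : Frame n, (F.plane x).IsPositiveFrame (g (0, 0)) (g (0, 1)) := by
    obtain ⟨u, v, b, rfl, rfl, hb⟩ := (F.plane x).exists_isPositiveFrame
    obtain ⟨Q, hQ⟩ := (F.plane x).carrier.exists_isCompl
    have hQd : finrank ℝ Q = 2 * n := by
      have := Submodule.finrank_add_eq_of_isCompl hQ
      rw [(F.plane x).finrank_eq, finrank_euclideanSpace_fin] at this
      omega
    let q : Basis (Fin n × Fin 2) ℝ Q := (finBasisOfFinrankEq ℝ Q hQd).reindex
      (Fintype.equivOfCardEq (by simp [mul_comm]))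
    let e : Fin 2 ⊕ (Fin n × Fin 2) ≃ Fin (n + 1) × Fin 2 :=
      { toFun := Sum.elim (fun δ => (0, δ)) fun i => (i.1.succ, i.2)
        invFun := fun a => Fin.cases (motive := fun _ => Fin 2 ⊕ (Fin n × Fin 2)) (Sum.inl a.2)
          (fun p => Sum.inr (p, a.2)) a.1
        left_inv := by rintro (δ | i) <;> rfl
        right_inv := by
          intro a
          obtain rfl | rfl | ⟨i, rfl⟩ := exists_block_cases a <;> rfl }
    let g : Frame n := ((b.prod q).map ((F.plane x).carrier.prodEquivOfIsCompl Q hQ)).reindex e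
    have hgδ : ∀ δ, g (0, δ) = b δ := by
      intro δ
      have : e.symm (0, δ) = Sum.inl δ := rfl
      simp [g, this]
    exact ⟨g, by rw [hgδ, hgδ]; exact ⟨b, rfl, rfl, hb⟩⟩
  obtain ⟨Θ, t, hΘ, -, ht⟩ := exists_isLocalSection₁ hg₁
  have ht0 := ht.self_of_nhds
  rw [hΘ.apply_base, frameMul_one] at ht0
  -- The tail block achieves the first normalisation; the head block of `normalizer` then achieves
  -- the second without leaving it.
  obtain ⟨M, hM, hJ⟩ := exists_conj_isAssociated fun r => ht0.not_hasEigenvalue ⟨x, hg₁⟩ r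
  have hpar : IsParabolic (blockDiag 1 M) := isParabolic_blockDiag (by simp) hM
  have ht2 : F.IsT (GreatCircle.frameMul g₁ (blockDiag 1 M)) (M⁻¹ * t (chartAt _ x x) * M) := by
    refine ht0.frameMul hpar ?_
    simp only [tailBlock_blockDiag, blockDiag_zero_zero, Matrix.one_apply]
    simp only [mul_assoc, Matrix.mul_nonsing_inv_cancel_left _ _ hM.isUnit]
    simp
  rw [isAssociatedComplexStructure_stdJ_iff] at hJ
  set T := M⁻¹ * t (chartAt _ x x) * M
  set τ := cPart T with hτ
  have hT : T = ofParts τ 0 := by rw [← hJ.1, ofParts_parts]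
  rw [hT] at ht2
  obtain ⟨z, hz⟩ := hJ.2.exists_isBarycenter hn
  exact ⟨_, frameMul_mem_frames₃ (hpar.isPositiveFrame hg₁) ht2 hJ.2 hz,
    (isParabolic_normalizer hz.1).isPositiveFrame (hpar.isPositiveFrame hg₁)⟩

/-- Through every frame in `frames₃` there is a local section of `frames₃`. -/
theorem exists_isLocalSection₃ (hn : 0 < n)
    (hg : (F.plane x).IsPositiveFrame (g (0, 0)) (g (0, 1))) (hg3 : g ∈ F.frames₃) :
    ∃ Θ : EuclideanSpace ℝ (Fin (2 * n)) → BlockMatrix (n + 1),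
      IsLocalSection F F.frames₃ x g Θ := by
  obtain ⟨Θ, τ, hΘ, hτc, hτ⟩ := exists_isLocalSection₂ hg hg3.1
  have hτ0 := hτ.self_of_nhds
  rw [hΘ.apply_base, frameMul_one] at hτ0
  have hb0 : IsBarycenter (τ (chartAt _ x x)) Complex.I := by
    obtain ⟨τ', hτ', -, hb'⟩ := (mem_frames₃_iff hg).1 hg3
    have := congrArg cPart (isT_unique ⟨x, hg⟩ hτ0.1 hτ')
    rw [cPart_ofParts, cPart_ofParts] at this
    rwa [this]
  obtain ⟨z, hz0, hzc, hz⟩ := IsBarycenter.exists_smooth hn hτc hτ0.2 hb0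
  have hre : ContDiffAt ℝ ∞ (fun y => (z y).re) (chartAt _ x x) :=
    Complex.reCLM.contDiff.contDiffAt.comp _ hzc
  have him : ContDiffAt ℝ ∞ (fun y => (z y).im) (chartAt _ x x) :=
    Complex.imCLM.contDiff.contDiffAt.comp _ hzc
  have hne : (z (chartAt _ x x)).im ≠ 0 := by simp [hz0]
  -- The barycenters along a section of `frames₂` vary smoothly from the value i, so their
  -- normalisers start at the identity.
  refine ⟨_, hΘ.mul_blockDiag (h := fun y => normalizer (z y)) (M := fun _ => 1) ?_ ?_ ?_ rfl
    (fun i j => contDiffAt_const) ?_⟩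
  · simp only [normalizer, hz0]
    ext i j
    fin_cases i <;> fin_cases j <;> simp
  · simp [normalizer]
  · rw [Fin.forall_fin_two]
    simp only [Fin.forall_fin_two]
    refine ⟨⟨contDiffAt_const, ?_⟩, contDiffAt_const, ?_⟩
    · exact hre.neg.div him hne
    · exact contDiffAt_const.div him hne
  · filter_upwards [hz, hτ, hΘ.eventually_frame] with y h1 h2 h3
    exact frameMul_mem_frames₃ h3 h2.1 h2.2 h1

end Fibration

end GreatCircle

namespace GreatCircle

/-! ### The form of index `(0, 0̄)` along `frames₃`. -/

open Matrix ComplexConjugate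

/-- A real linear form is the sum of a complex linear and an antilinear one. -/
lemma exists_linear_add_antilinear {m : ℕ} (f : (Fin m → ℂ) →ₗ[ℝ] ℂ) :
    ∃ s s' : Fin m → ℂ, ∀ z, f z = ∑ r, s r * z r + ∑ r, s' r * conj (z r) := by
  refine ⟨fun r => (f (Pi.single r 1) - Complex.I * f (Pi.single r Complex.I)) / 2,
    fun r => (f (Pi.single r 1) + Complex.I * f (Pi.single r Complex.I)) / 2, fun z => ?_⟩
  have h1 : z = ∑ r, ((z r).re • (Pi.single r 1 : Fin m → ℂ) +
      (z r).im • (Pi.single r Complex.I : Fin m → ℂ)) := by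
    funext k
    simp only [Finset.sum_apply, Pi.add_apply, Pi.smul_apply]
    rw [Finset.sum_eq_single k (fun r _ hr => by simp [Pi.single_eq_of_ne hr.symm]) (by simp)]
    simp
  conv_lhs => rw [h1]
  rw [map_sum, ← Finset.sum_add_distrib]
  refine Finset.sum_congr rfl fun r _ => ?_
  rw [map_add, map_smul, map_smul]
  have hz : z r = (z r).re + (z r).im * Complex.I := (Complex.re_add_im _).symm
  have hz' : conj (z r) = (z r).re - (z r).im * Complex.I := by
    apply Complex.ext <;> simp
  rw [hz', Complex.real_smul, Complex.real_smul]
  nth_rw 3 [hz]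
  linear_combination (((z r).im : ℂ) * f (Pi.single r Complex.I)) * Complex.I_sq

/-- A form that is complex linear and antilinear vanishes. -/
lemma eq_zero_of_linear_eq_antilinear {m : ℕ} {s s' : Fin m → ℂ}
    (h : ∀ z : Fin m → ℂ, s ⬝ᵥ z = s' ⬝ᵥ star z) : s' = 0 := by
  funext r
  have h1 := h (Pi.single r 1)
  have h2 := h (Pi.single r Complex.I)
  rw [← Pi.single_star, dotProduct_single, dotProduct_single] at h1 h2
  simp at h1 h2
  rw [h1] at h2
  have h3 : (2 * Complex.I) * s' r = 0 := by linear_combination h2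
  simpa using h3

section Blocks

variable {n : ℕ} (A : BlockMatrix (n + 1))

lemma Omega_succ_zero_add {A B L : BlockMatrix (n + 1)} (h : A = B + L) (hL : ∀ δ, tailCol L δ = 0)
    (p : Fin n) : Omega A p.succ 0 = Omega B p.succ 0 := by
  subst h
  have h0 : ∀ δ, complexVec (tailCol (B + L) δ) = complexVec (tailCol B δ) := fun δ => by
    have : tailCol (B + L) δ = tailCol B δ + tailCol L δ := rfl
    rw [this, hL, add_zero]
  rw [Omega_succ_zero, Omega_succ_zero, h0, h0]

lemma OmegaBar_add {m : ℕ} (B L : BlockMatrix m) (P Q : Fin m) :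
    OmegaBar (B + L) P Q = OmegaBar B P Q + OmegaBar L P Q :=
  congrFun (congrFun (aPart_add B L) P) Q

lemma OmegaBar_zero_zero_eq_zero_iff : OmegaBar A 0 0 = 0 ↔
    A (0, 1) (0, 1) = A (0, 0) (0, 0) ∧ A (0, 1) (0, 0) = -A (0, 0) (0, 1) := by
  rw [Complex.ext_iff]
  simp only [OmegaBar, Complex.zero_re, Complex.zero_im, div_eq_zero_iff, OfNat.ofNat_ne_zero,
    or_false, sub_eq_zero, add_eq_zero_iff_eq_neg]
  exact and_comm

/-- A parabolic matrix with complex diagonal blocks has vanishing antilinear part outside of the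
upper right block. -/
lemma aPart_apply_zero {N : BlockMatrix (n + 1)} (hN : IsParabolic N)
    (h : N (0, 1) (0, 1) = N (0, 0) (0, 0) ∧ N (0, 1) (0, 0) = -N (0, 0) (0, 1)) (P) :
    aPart N P 0 = 0 := by
  refine Fin.cases ?_ (fun p => ?_) P
  · exact (OmegaBar_zero_zero_eq_zero_iff N).2 h
  · rw [aPart_apply]
    apply Complex.ext <;> simp [OmegaBar, hN.apply_succ_zero]

lemma aPart_apply_succ {N : BlockMatrix (n + 1)} (h : aPart (tailBlock N) = 0) (p q : Fin n) :
    aPart N p.succ q.succ = 0 := congrFun (congrFun h p) q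

lemma cPart_succ_zero {N : BlockMatrix (n + 1)} (hN : IsParabolic N) (p : Fin n) :
    cPart N p.succ 0 = 0 := by
  rw [cPart_apply]
  apply Complex.ext <;> simp [Omega, hN.apply_succ_zero]

end Blocks

namespace Fibration

variable {n : ℕ} {X : Type*} [TopologicalSpace X]
  [ChartedSpace (EuclideanSpace ℝ (Fin (2 * n))) X] {F : Fibration n X} {x : X} {g : Frame n}
  [IsManifold (𝓡 (2 * n)) ∞ X]

/-- The matrix 1 - iτ is invertible because -i is not an eigenvalue of τ; so the values Ω^r_0 are as
arbitrary as the transverse velocity of e₀. -/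
lemma exists_maurerCartan_Omega_eq (hn : 0 < n)
    (hg : (F.plane x).IsPositiveFrame (g (0, 0)) (g (0, 1))) (hg3 : g ∈ F.frames₃)
    (z : Fin n → ℂ) : ∃ A ∈ maurerCartan F.frames₃ g, ∀ r : Fin n, Omega A r.succ 0 = z r := by
  obtain ⟨τ, hτ, hup, -⟩ := (mem_frames₃_iff hg).1 hg3
  obtain ⟨Θ, hΘ⟩ := exists_isLocalSection₃ hn hg hg3
  have hd : IsUnit ((1 : CMatrix n) - Complex.I • τ).det := by
    have h1 : (1 : CMatrix n) - Complex.I • τ = -Complex.I • (τ - (-Complex.I) • 1) := by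
      rw [smul_sub, smul_smul]
      simp
      abel
    rw [h1, Matrix.det_smul]
    exact (isUnit_iff_ne_zero.2 (by simp)).mul (hup.isUnit_det (by simp))
  obtain ⟨u, hu⟩ := complexVec_surjective
    (((1 : CMatrix n) - Complex.I • τ)⁻¹ *ᵥ fun r => 2 * z r)
  obtain ⟨A, hA, rfl⟩ := hΘ.exists_mem_maurerCartan u
  refine ⟨A, hA, fun r => ?_⟩
  have h2 := two_smul_Omega hτ (maurerCartan_mono (fun g hg => hg.1.1) g hA)
  rw [hu, Matrix.mulVec_mulVec, Matrix.mul_nonsing_inv _ hd, Matrix.one_mulVec] at h2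
  exact mul_left_cancel₀ two_ne_zero (congrFun h2 r)

lemma eq_zero_of_Omega_eq_zero (hg : (F.plane x).IsPositiveFrame (g (0, 0)) (g (0, 1)))
    (hg3 : g ∈ F.frames₃) {A : BlockMatrix (n + 1)} (hA : A ∈ maurerCartan F.frames₃ g)
    (h : ∀ r : Fin n, Omega A r.succ 0 = 0) : tailCol A 0 = 0 := by
  obtain ⟨τ, hτ, hup, -⟩ := (mem_frames₃_iff hg).1 hg3
  have h2 := two_smul_Omega hτ (maurerCartan_mono (fun g hg => hg.1.1) g hA)
  simp only [h, mul_zero] at h2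
  have h3 : τ *ᵥ complexVec (tailCol A 0) = (-Complex.I) • complexVec (tailCol A 0) := by
    rw [Matrix.sub_mulVec, Matrix.one_mulVec, Matrix.smul_mulVec] at h2
    have h4 : complexVec (tailCol A 0) = Complex.I • τ *ᵥ complexVec (tailCol A 0) :=
      sub_eq_zero.1 h2.symm
    conv_rhs => rw [h4]
    rw [smul_smul]
    simp
  refine complexVec_injective ?_
  rw [upperSpectrum_iff.1 hup _ (by simp) _ h3]
  rfl

/-- Along `frames₃`, the form `Ω^0_{0̄}` is a real linear function of the forms `Ω^r_0`. -/
lemma exists_OmegaBar_eq (hn : 0 < n) (hg : (F.plane x).IsPositiveFrame (g (0, 0)) (g (0, 1)))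
    (hg3 : g ∈ F.frames₃) : ∃ s s' : Fin n → ℂ, ∀ A ∈ maurerCartan F.frames₃ g,
      OmegaBar A 0 0 =
        ∑ r : Fin n, s r * Omega A r.succ 0 + ∑ r : Fin n, s' r * conj (Omega A r.succ 0) := by
  obtain ⟨Θ, hΘ⟩ := exists_isLocalSection₃ hn hg hg3
  set e := chartAt (EuclideanSpace ℝ (Fin (2 * n))) x with he
  set y₀ := e x with hy₀
  have hΘd : ∀ i j, HasFDerivAt (fun y => Θ y i j) (fderiv ℝ (fun y => Θ y i j) y₀) y₀ := fun i j =>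
    ((hΘ.contDiffAt i j).differentiableAt (by simp)).hasFDerivAt
  -- The derivative of the local section gives a linear space of values of the Maurer-Cartan form;
  -- by definition `maurerCartan` is only a set of velocities of curves.
  let D : EuclideanSpace ℝ (Fin (2 * n)) → BlockMatrix (n + 1) := fun v =>
    Matrix.of fun i j => fderiv ℝ (fun y => Θ y i j) y₀ v
  have hDadd : ∀ v w, D (v + w) = D v + D w := fun v w => by
    ext i j
    simp [D]
  have hDsmul : ∀ (c : ℝ) v, D (c • v) = c • D v := fun c v => by
    ext i j
    simp [D]
  have hDmem : ∀ v, D v ∈ maurerCartan F.frames₃ g := by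
    intro v
    have hl : ContDiffAt ℝ ∞ (fun s : ℝ => y₀ + s • v) 0 :=
      contDiffAt_const.add (contDiffAt_id.smul contDiffAt_const)
    have h0 : y₀ + (0 : ℝ) • v = y₀ := by simp
    have hl' : HasDerivAt (fun s : ℝ => y₀ + s • v) v 0 := by
      simpa using ((hasDerivAt_id (0 : ℝ)).smul_const v).const_add y₀
    refine mem_maurerCartan_iff.2 ⟨fun s => Θ (y₀ + s • v), ?_, fun i j => ?_, ?_, fun i j => ?_⟩
    · beta_reduce
      rw [h0, hΘ.apply_base]
    · refine ContDiffAt.comp (g := fun y => Θ y i j) (0 : ℝ) ?_ hl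
      rw [h0]
      exact hΘ.contDiffAt i j
    · have := hl.continuousAt.tendsto
      rw [h0] at this
      exact this.eventually hΘ.eventually_mem
    · have h1 := hΘd i j
      rw [← h0] at h1
      have h2 := h1.comp_hasDerivAt (0 : ℝ) hl'
      rw [h0] at h2
      exact h2
  let tc : EuclideanSpace ℝ (Fin (2 * n)) →ₗ[ℝ] (Fin n × Fin 2 → ℝ) :=
    { toFun := fun v => tailCol (D v) 0
      map_add' := fun v w => by rw [hDadd]; rfl
      map_smul' := fun c v => by rw [hDsmul]; rfl }
  have htc : Function.Injective tc := by
    rw [LinearMap.injective_iff_surjective_of_finrank_eq_finrank (by simp [mul_comm])]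
    intro u
    obtain ⟨v, hv⟩ := hΘ.exists_hasDerivAt u
    refine ⟨v, funext fun i => ?_⟩
    have hl' : HasDerivAt (fun s : ℝ => y₀ + s • v) v 0 := by
      simpa using ((hasDerivAt_id (0 : ℝ)).smul_const v).const_add y₀
    have h1 : HasFDerivAt (fun y => Θ y (i.1.succ, i.2) (0, 0))
        (fderiv ℝ (fun y => Θ y (i.1.succ, i.2) (0, 0)) y₀) (y₀ + (0 : ℝ) • v) := by
      simpa using hΘd (i.1.succ, i.2) (0, 0)
    have h2 := h1.comp_hasDerivAt (0 : ℝ) hl'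
    exact h2.unique (hv i)
  let α : EuclideanSpace ℝ (Fin (2 * n)) →ₗ[ℝ] (Fin n → ℂ) :=
    { toFun := fun v r => Omega (D v) r.succ 0
      map_add' := fun v w => funext fun r => by
        rw [hDadd]
        exact congrFun (congrFun (cPart_add (D v) (D w)) r.succ) 0
      map_smul' := fun c v => funext fun r => by
        rw [hDsmul]
        exact congrFun (congrFun (cPart_smul c (D v)) r.succ) 0 }
  let β : EuclideanSpace ℝ (Fin (2 * n)) →ₗ[ℝ] ℂ :=
    { toFun := fun v => OmegaBar (D v) 0 0
      map_add' := fun v w => by rw [hDadd, OmegaBar_add]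
      map_smul' := fun c v => by
        rw [hDsmul]
        exact congrFun (congrFun (aPart_smul c (D v)) 0) 0 }
  have hα : α.ker = ⊥ := by
    rw [LinearMap.ker_eq_bot']
    intro v hv
    refine htc ?_
    rw [map_zero]
    exact eq_zero_of_Omega_eq_zero hg hg3 (hDmem v) fun r => congrFun hv r
  -- The forms Ω^r_0 determine the base velocity, so along the section the form of index (0, 0̄) is
  -- a real linear function of them. It remains to see that an arbitrary curve in `frames₃` gives
  -- the same function.
  obtain ⟨α', hα'⟩ := LinearMap.exists_leftInverse_of_injective α hα
  obtain ⟨s, s', hs⟩ := exists_linear_add_antilinear (β ∘ₗ α')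
  refine ⟨s, s', fun A hA => ?_⟩
  obtain ⟨N, h0, hN, hNB, hNA⟩ := mem_maurerCartan_iff.1 hA
  have hdet : ∀ᶠ s in 𝓝 (0 : ℝ), (N s).det ≠ 0 := eventually_det_ne_zero hN (by simp [h0])
  let γ : ℝ → V n := fun s => ∑ a, N s a (0, 0) • g a
  have hγ0 : γ 0 = g (0, 0) := by simp [γ, h0, Matrix.one_apply]
  have hγc : ContDiffAt ℝ ∞ γ 0 := ContDiffAt.sum fun a _ => (hN a (0, 0)).smul contDiffAt_const
  let y : ℝ → EuclideanSpace ℝ (Fin (2 * n)) := fun s => F.chartBase x (γ s)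
  have hbg : F.base (g (0, 0)) = x := (F.base_eq_iff hg.left_ne_zero).2 hg.mem_left
  have hy0 : y 0 = y₀ := by
    change F.chartBase x (γ 0) = y₀
    rw [hγ0, chartBase, hbg]
  have hyc : ContDiffAt ℝ ∞ y 0 := by
    refine ContDiffAt.comp (g := F.chartBase x) (0 : ℝ) ?_ hγc
    rw [hγ0]
    exact contDiffAt_chartBase hg.left_ne_zero (by rw [hbg]; exact mem_chart_source _ x)
  have hyt : Tendsto y (𝓝 0) (𝓝 y₀) := by
    have := hyc.continuousAt.tendsto
    rwa [hy0] at this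
  have hΘy : ∀ i j, ContDiffAt ℝ ∞ (fun s => Θ (y s) i j) 0 := fun i j => by
    refine ContDiffAt.comp (g := fun y => Θ y i j) (0 : ℝ) ?_ hyc
    rw [hy0]
    exact hΘ.contDiffAt i j
  have hΘ0 : Θ (y 0) = 1 := by rw [hy0, hΘ.apply_base]
  -- An arbitrary curve of frames is compared with the section over the same base points. By
  -- `parabolic_of_frames₃` the difference L is parabolic with complex head block.
  let L : ℝ → BlockMatrix (n + 1) := fun s => (Θ (y s))⁻¹ * N s
  have hL0 : L 0 = 1 := by simp [L, hΘ0, h0]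
  have hLc : ∀ i j, ContDiffAt ℝ ∞ (fun s => L s i j) 0 :=
    contDiffAt_matrix_mul (contDiffAt_matrix_inv hΘy (by simp [hΘ0])) hN
  have hΘL : ∀ᶠ s in 𝓝 (0 : ℝ), N s = Θ (y s) * L s := by
    filter_upwards [hyt.eventually hΘ.eventually_det_ne_zero] with s hs
    simp only [L]
    rw [Matrix.mul_nonsing_inv_cancel_left _ _ hs.isUnit]
  have hLp : ∀ᶠ s in 𝓝 (0 : ℝ), IsParabolic (L s) ∧ OmegaBar (L s) 0 0 = 0 := by
    have hsrc : ∀ᶠ s in 𝓝 (0 : ℝ), γ s ≠ 0 ∧ F.base (γ s) ∈ e.source := by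
      have h1 : ContinuousAt F.base (γ 0) := by
        rw [hγ0]
        exact (F.contMDiffAt_base hg.left_ne_zero).continuousAt
      have h2 : ContinuousAt (fun s => F.base (γ s)) 0 :=
        ContinuousAt.comp (g := F.base) h1 hγc.continuousAt
      have h3 : ∀ᶠ s in 𝓝 (0 : ℝ), F.base (γ s) ∈ e.source :=
        h2.preimage_mem_nhds (e.open_source.mem_nhds (by rw [hγ0, hbg]; exact mem_chart_source _ x))
      have h4 : ∀ᶠ s in 𝓝 (0 : ℝ), γ s ≠ 0 :=
        hγc.continuousAt.eventually_ne (by rw [hγ0]; exact hg.left_ne_zero)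
      exact h4.and h3
    filter_upwards [hΘL, hNB, hdet, hyt.eventually hΘ.eventually_det_ne_zero,
      hyt.eventually hΘ.eventually_mem, hyt.eventually hΘ.eventually_frame, hsrc]
      with s h1 h2 h3 h4 h5 h6 h7
    obtain ⟨z, hz⟩ := h2.1.1
    have hγs : frameMul g (N s) (0, 0) = γ s := frameMul_apply g h3 _
    have hbz : F.base (γ s) = z := (F.base_eq_iff h7.1).2 (by rw [← hγs]; exact hz.mem_left)
    have hez : e.symm (y s) = z := by
      change e.symm (e (F.base (γ s))) = z
      rw [e.left_inv h7.2, hbz]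
    rw [hez] at h6
    have h8 : (L s).det ≠ 0 := by
      intro h9
      rw [h1, Matrix.det_mul, h9, mul_zero] at h3
      exact h3 rfl
    have h9 : frameMul (frameMul g (Θ (y s))) (L s) = frameMul g (N s) := by
      rw [frameMul_frameMul g h4 h8, ← h1]
    have h10 : IsParabolic (L s) := by
      have := isParabolic_toMatrix h6 hz
      rwa [← h9, toMatrix_frameMul _ h8] at this
    refine ⟨h10, (OmegaBar_zero_zero_eq_zero_iff _).2 ?_⟩
    exact (parabolic_of_frames₃ hn h6 h5 h10 (by rwa [h9])).2
  let L' : BlockMatrix (n + 1) := fun i j => deriv (fun s => L s i j) 0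
  have hL' : ∀ i j, HasDerivAt (fun s => L s i j) (L' i j) 0 := fun i j =>
    ((hLc i j).differentiableAt (by simp)).hasDerivAt
  set v := deriv y 0 with hv
  have hΘy' : ∀ i j, HasDerivAt (fun s => Θ (y s) i j) (D v i j) 0 := fun i j => by
    have h1 := hΘd i j
    rw [← hy0] at h1
    have h2 := h1.comp_hasDerivAt (0 : ℝ) (hyc.differentiableAt (by simp)).hasDerivAt
    rw [hy0] at h2
    exact h2
  -- The product rule at L(0) = Θ(y₀) = 1. The derivative of L contributes neither to Ω^r_0 nor to
  -- the form of index (0, 0̄).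
  have hA : A = D v + L' := by
    ext i j
    have h1 : HasDerivAt (fun s => ∑ k, Θ (y s) i k * L s k j)
        (∑ k, (D v i k * L 0 k j + Θ (y 0) i k * L' k j)) 0 :=
      HasDerivAt.fun_sum fun k _ => (hΘy' i k).mul (hL' k j)
    have h2 : (fun s => N s i j) =ᶠ[𝓝 0] fun s => ∑ k, Θ (y s) i k * L s k j := by
      filter_upwards [hΘL] with s hs
      rw [hs, Matrix.mul_apply]
    rw [(hNA i j).unique (h1.congr_of_eventuallyEq h2), hL0, hΘ0, Finset.sum_add_distrib,
      ← Matrix.mul_apply, ← Matrix.mul_apply, mul_one, one_mul]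
    rfl
  have hL't : ∀ δ, tailCol L' δ = 0 := fun δ => funext fun i =>
    (hL' (i.1.succ, i.2) (0, δ)).unique ((hasDerivAt_const (0 : ℝ) (0 : ℝ)).congr_of_eventuallyEq (by
      filter_upwards [hLp] with s hs using hs.1.apply_succ_zero i.1 i.2 δ))
  have hL'0 : OmegaBar L' 0 0 = 0 := by
    rw [OmegaBar_zero_zero_eq_zero_iff]
    constructor
    · refine (hL' (0, 1) (0, 1)).unique ((hL' (0, 0) (0, 0)).congr_of_eventuallyEq ?_)
      filter_upwards [hLp] with s hs using ((OmegaBar_zero_zero_eq_zero_iff _).1 hs.2).1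
    · refine (hL' (0, 1) (0, 0)).unique ((hL' (0, 0) (0, 1)).neg.congr_of_eventuallyEq ?_)
      filter_upwards [hLp] with s hs using ((OmegaBar_zero_zero_eq_zero_iff _).1 hs.2).2
  have hΩ : (fun r : Fin n => Omega A r.succ 0) = α v :=
    funext fun r => Omega_succ_zero_add hA hL't r
  have h1 := hs (α v)
  have h2 : α' (α v) = v := LinearMap.congr_fun hα' v
  rw [LinearMap.comp_apply, h2, ← hΩ] at h1
  rw [hA, OmegaBar_add, hL'0, add_zero, ← hA]
  exact h1

end Fibration

end GreatCircle

namespace GreatCircle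

open Matrix ComplexConjugate

/-! ### Adapted frames and the complex structure `g J₀ g⁻¹`. -/

section Blocks

variable {n : ℕ} {N : BlockMatrix (n + 1)}

/-- The unipotent parabolic matrices whose only nontrivial part is antilinear. -/
noncomputable def antiUnipotent (s : Fin n → ℂ) : BlockMatrix (n + 1) :=
  ofParts 1 (Matrix.of fun P Q => Fin.cases (motive := fun _ => ℂ)
    (Fin.cases (motive := fun _ => ℂ) 0 s Q) (fun _ => 0) P)

lemma cPart_antiUnipotent (s : Fin n → ℂ) : cPart (antiUnipotent s) = 1 := cPart_ofParts _ _

lemma aPart_antiUnipotent_zero_succ (s : Fin n → ℂ) (q : Fin n) :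
    aPart (antiUnipotent s) 0 q.succ = s q := by
  rw [antiUnipotent, aPart_ofParts]
  rfl

/-- The antilinear part lives in row 0 and columns 1, …, n, so products of two such parts vanish. -/
lemma antiUnipotent_mul_neg (s : Fin n → ℂ) : antiUnipotent s * antiUnipotent (-s) = 1 := by
  have h2 : aPart (antiUnipotent (-s)) = - aPart (antiUnipotent s) := by
    rw [antiUnipotent, antiUnipotent, aPart_ofParts, aPart_ofParts]
    ext P Q
    refine Fin.cases ?_ (fun p => ?_) P <;> refine Fin.cases ?_ (fun q => ?_) Q <;> simp
  refine parts_ext ?_ ?_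
  · rw [cPart_mul, cPart_antiUnipotent, cPart_antiUnipotent, cPart_one, mul_one]
    have : aPart (antiUnipotent s) * conjM (aPart (antiUnipotent (-s))) = 0 := by
      rw [antiUnipotent, antiUnipotent, aPart_ofParts, aPart_ofParts]
      ext P Q
      rw [Matrix.mul_apply, Fin.sum_univ_succ]
      refine Fin.cases ?_ (fun p => ?_) P <;> simp
    rw [this, add_zero]
  · rw [aPart_mul, cPart_antiUnipotent, cPart_antiUnipotent, h2, conjM_one]
    simp

lemma antiUnipotent_inv (s : Fin n → ℂ) : (antiUnipotent s)⁻¹ = antiUnipotent (-s) :=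
  Matrix.inv_eq_right_inv (antiUnipotent_mul_neg s)

lemma isParabolic_antiUnipotent (s : Fin n → ℂ) : IsParabolic (antiUnipotent s) := by
  refine ⟨?_, ?_, ?_⟩
  · have h1 := antiUnipotent_mul_neg s
    intro h0
    have := congrArg Matrix.det h1
    rw [Matrix.det_mul, h0, zero_mul, Matrix.det_one] at this
    exact zero_ne_one this
  · rw [Fin.forall_fin_two]
    constructor <;> funext ⟨p, ε⟩ <;> fin_cases ε <;>
      simp [tailCol, antiUnipotent, ofParts, Matrix.one_apply, Fin.succ_ne_zero]
  · rw [Matrix.det_fin_two]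
    simp [headBlock, antiUnipotent, ofParts]

lemma tailBlock_antiUnipotent (s : Fin n → ℂ) : tailBlock (antiUnipotent s) = 1 := by
  ext ⟨p, ε⟩ ⟨q, δ⟩
  fin_cases ε <;> fin_cases δ <;> by_cases h : p = q <;>
    simp [tailBlock, antiUnipotent, ofParts, Matrix.one_apply, h]

/-- The head block is multiplication by a complex number, and its determinant |c|² is positive. -/
lemma IsParabolic.cPart_zero_zero_ne_zero (hN : IsParabolic N)
    (h : N (0, 1) (0, 1) = N (0, 0) (0, 0) ∧ N (0, 1) (0, 0) = -N (0, 0) (0, 1)) :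
    cPart N 0 0 ≠ 0 := by
  intro h0
  rw [cPart_apply, Complex.ext_iff] at h0
  simp only [Omega, h.1, h.2, Complex.zero_re, Complex.zero_im] at h0
  have h1 := hN.head_pos
  have h2 : N (0, 0) (0, 0) = 0 := by linarith [h0.1]
  have h3 : N (0, 0) (0, 1) = 0 := by linarith [h0.2]
  rw [Matrix.det_fin_two] at h1
  simp only [headBlock, Matrix.of_apply, h.1, h.2, h2, h3] at h1
  simp at h1

/-- The transformation of `Ω^0_{0̄}` under conjugation with a parabolic matrix. -/
lemma IsParabolic.OmegaBar_conj {A A' : BlockMatrix (n + 1)} (hN : IsParabolic N)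
    (h : N (0, 1) (0, 1) = N (0, 0) (0, 0) ∧ N (0, 1) (0, 0) = -N (0, 0) (0, 1))
    (hA : N * A' = A * N) :
    cPart N 0 0 * OmegaBar A' 0 0 + (fun r : Fin n => cPart N 0 r.succ) ⬝ᵥ
        (fun r => OmegaBar A' r.succ 0) + (fun r : Fin n => aPart N 0 r.succ) ⬝ᵥ
        star (fun r : Fin n => Omega A' r.succ 0) = OmegaBar A 0 0 * conj (cPart N 0 0) := by
  have h1 := congrFun (congrFun (congrArg aPart hA) 0) 0
  rw [aPart_mul, aPart_mul, Matrix.add_apply, Matrix.add_apply] at h1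
  simp only [Matrix.mul_apply, Fin.sum_univ_succ (n := n), aPart_apply_zero hN h, conjM_apply,
    cPart_succ_zero hN, map_zero, mul_zero, zero_mul, Finset.sum_const_zero, add_zero,
    zero_add] at h1
  exact h1

lemma IsParabolic.Omega_conj {A A' : BlockMatrix (n + 1)} (hN : IsParabolic N)
    (h : N (0, 1) (0, 1) = N (0, 0) (0, 0) ∧ N (0, 1) (0, 0) = -N (0, 0) (0, 1))
    (ha : aPart (tailBlock N) = 0) (hA : N * A' = A * N) :
    cPart (tailBlock N) *ᵥ (fun r : Fin n => Omega A' r.succ 0) =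
      cPart N 0 0 • fun r : Fin n => Omega A r.succ 0 := by
  funext p
  have h1 := congrFun (congrFun (congrArg cPart hA) p.succ) 0
  rw [cPart_mul, cPart_mul, Matrix.add_apply, Matrix.add_apply] at h1
  simp only [Matrix.mul_apply, Fin.sum_univ_succ (n := n), aPart_apply_zero hN h, conjM_apply,
    cPart_succ_zero hN, map_zero, mul_zero, zero_mul, Finset.sum_const_zero, add_zero,
    zero_add, aPart_apply_succ ha] at h1
  rw [Pi.smul_apply, smul_eq_mul, mul_comm]
  exact h1

end Blocks

section FrameJ

variable {n : ℕ}

/-- The complex structure `g J₀ g⁻¹`. -/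
noncomputable def frameJ (g : Frame n) : V n →ₗ[ℝ] V n := Matrix.toLin g g (stdJ (n + 1))

lemma frameJ_apply (g : Frame n) (P : Fin (n + 1)) :
    frameJ g (g (P, 0)) = g (P, 1) ∧ frameJ g (g (P, 1)) = -g (P, 0) := by
  rw [frameJ, Matrix.toLin_self, Matrix.toLin_self, Fintype.sum_prod_type, Fintype.sum_prod_type]
  simp [stdJ, Matrix.one_apply]

lemma eq_frameJ {g : Frame n} {J : V n →ₗ[ℝ] V n}
    (h : ∀ P, J (g (P, 0)) = g (P, 1) ∧ J (g (P, 1)) = -g (P, 0)) : J = frameJ g := by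
  refine g.ext fun a => ?_
  obtain ⟨P, ε⟩ := a
  fin_cases ε
  · exact (h P).1.trans (frameJ_apply g P).1.symm
  · exact (h P).2.trans (frameJ_apply g P).2.symm

/-- A matrix without antilinear part commutes with J₀. -/
lemma frameJ_frameMul (g : Frame n) {N : BlockMatrix (n + 1)} (hN : N.det ≠ 0)
    (h : aPart N = 0) : frameJ (frameMul g N) = frameJ g := by
  have hJ : stdJ (n + 1) * N = N * stdJ (n + 1) := by
    refine parts_ext ?_ ?_
    · rw [cPart_mul, cPart_mul, h]
      simp
    · rw [aPart_mul, aPart_mul, h]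
      simp
  refine (frameMul g N).ext fun b => ?_
  have h1 : ∀ b, frameMul g N b = Matrix.toLin g g N (g b) := fun b => by
    rw [frameMul_apply g hN, Matrix.toLin_self]
  rw [frameJ, Matrix.toLin_self]
  simp only [h1]
  rw [frameJ, ← Matrix.toLin_mul_apply, hJ, Matrix.toLin_mul_apply g g g, Matrix.toLin_self g g (stdJ (n + 1)), map_sum]
  exact Finset.sum_congr rfl fun x _ => (map_smul _ _ _).symm

end FrameJ

end GreatCircle

namespace GreatCircle

open Matrix ComplexConjugate

namespace Fibration

variable {n : ℕ} {X : Type*} [TopologicalSpace X]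
  [ChartedSpace (EuclideanSpace ℝ (Fin (2 * n))) X] {F : Fibration n X} {x : X} {g : Frame n}
  [IsManifold (𝓡 (2 * n)) ∞ X]

/-- The two earlier normalisations only involve the diagonal blocks, which are trivial here. -/
lemma frameMul_antiUnipotent_mem_frames₃ (hg3 : g ∈ F.frames₃) (s : Fin n → ℂ) :
    GreatCircle.frameMul g (antiUnipotent s) ∈ F.frames₃ := by
  refine frameMul_mem_frames₃_of_parabolic hg3 (isParabolic_antiUnipotent s) ?_ ?_
  · rw [tailBlock_antiUnipotent, aPart_one]
  · simp [antiUnipotent, ofParts]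

/-- Over every point there is an adapted frame. -/
lemma exists_mem_adaptedFrames (hn : 0 < n) (F : Fibration n X) (x : X) :
    ∃ g ∈ F.adaptedFrames, (F.plane x).IsPositiveFrame (g (0, 0)) (g (0, 1)) := by
  obtain ⟨g, hg3, hg⟩ := exists_mem_frames₃ hn F x
  -- Moving by `antiUnipotent s'` leaves the forms Ω^r_0 unchanged and subtracts the sum of s'ᵣ
  -- times the conjugate of Ω^r_0 from the form of index (0, 0̄), which cancels its antilinear part.
  obtain ⟨s, s', hs⟩ := exists_OmegaBar_eq hn hg hg3
  have hpar := isParabolic_antiUnipotent s'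
  refine ⟨_, ⟨frameMul_antiUnipotent_mem_frames₃ hg3 s', ?_⟩, hpar.isPositiveFrame hg⟩
  refine ⟨s, fun A' hA' => ?_⟩
  have hback : ∀ g ∈ F.frames₃, GreatCircle.frameMul g (antiUnipotent s')⁻¹ ∈ F.frames₃ := by
    intro g hg
    rw [antiUnipotent_inv]
    exact frameMul_antiUnipotent_mem_frames₃ hg _
  obtain ⟨A, hA, rfl⟩ := exists_maurerCartan_frameMul hpar hback hA'
  set A' := (antiUnipotent s')⁻¹ * A * antiUnipotent s' with hA'
  have hmul : antiUnipotent s' * A' = A * antiUnipotent s' := by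
    rw [hA', ← mul_assoc, ← mul_assoc, Matrix.mul_nonsing_inv _ hpar.det_ne_zero.isUnit, one_mul]
  have hb : antiUnipotent s' (0, 1) (0, 1) = antiUnipotent s' (0, 0) (0, 0) ∧
      antiUnipotent s' (0, 1) (0, 0) = -antiUnipotent s' (0, 0) (0, 1) := by
    simp [antiUnipotent, ofParts]
  have h1 := hpar.OmegaBar_conj hb hmul
  have h2 := hpar.Omega_conj hb (by rw [tailBlock_antiUnipotent, aPart_one]) hmul
  simp only [tailBlock_antiUnipotent, cPart_antiUnipotent, cPart_one, Matrix.one_mulVec,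
    Matrix.one_apply_eq, one_smul] at h2
  rw [cPart_antiUnipotent, hs A hA] at h1
  simp only [aPart_antiUnipotent_zero_succ, Matrix.one_apply_eq, one_mul, map_one, mul_one,
    Matrix.one_apply_ne (Fin.succ_ne_zero _).symm] at h1
  have h3 : ∀ r : Fin n, Omega A' r.succ 0 = Omega A r.succ 0 := fun r => congrFun h2 r
  simp only [dotProduct, zero_mul, Finset.sum_const_zero, add_zero, Pi.star_apply, h3,
    Complex.star_def] at h1
  simp only [h3]
  exact add_right_cancel h1

/-- Two adapted frames over the same point define the same complex structure. -/
lemma frameJ_eq_of_adaptedFrames (hn : 0 < n) {g' : Frame n}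
    (hg : (F.plane x).IsPositiveFrame (g (0, 0)) (g (0, 1)))
    (hg' : (F.plane x).IsPositiveFrame (g' (0, 0)) (g' (0, 1)))
    (hga : g ∈ F.adaptedFrames) (hga' : g' ∈ F.adaptedFrames) : frameJ g' = frameJ g := by
  obtain ⟨N, hN, rfl⟩ : ∃ N, IsParabolic N ∧ GreatCircle.frameMul g N = g' :=
    ⟨_, isParabolic_toMatrix hg hg', frameMul_toMatrix g g'⟩
  refine frameJ_frameMul g hN.det_ne_zero ?_
  obtain ⟨haN, hb⟩ := parabolic_of_frames₃ hn hg hga.1 hN hga'.1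
  obtain ⟨s, hs⟩ := hga.2
  obtain ⟨s', hs'⟩ := hga'.2
  obtain ⟨T, hT, -⟩ := hga'.1.2
  have hc := hN.cPart_zero_zero_ne_zero hb
  set c := cPart N 0 0
  set M := cPart (tailBlock N)
  set k : Fin n → ℂ := fun r => cPart N 0 r.succ with hk
  set k' : Fin n → ℂ := fun r => aPart N 0 r.succ with hk'
  -- By adaptedness of both frames and Ω^p_0̄ = T Ω_0, every term of the transformation law is
  -- complex linear in z = (Ω^r_0) except k' applied to z̄. All z occur, so k' = 0. The other
  -- antilinear entries of N vanish by `parabolic_of_frames₃`.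
  have hk0 : k' = 0 := by
    refine eq_zero_of_linear_eq_antilinear
      (s := (conj c * c⁻¹) • (s ᵥ* M) - c • s' - k ᵥ* T) fun z => ?_
    obtain ⟨A, hA, hz⟩ := exists_maurerCartan_Omega_eq hn hg hga.1 (c⁻¹ • (M *ᵥ z))
    have hA' := maurerCartan_frameMul hN.det_ne_zero
      (fun g hg => frameMul_mem_frames₃_of_parabolic hg hN haN hb) hA
    set A' := N⁻¹ * A * N with hA'm
    have hmul : N * A' = A * N := by
      rw [hA'm, ← mul_assoc, ← mul_assoc, Matrix.mul_nonsing_inv _ hN.det_ne_zero.isUnit, one_mul]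
    have h1 := hN.OmegaBar_conj hb hmul
    have h2 := hN.Omega_conj hb haN hmul
    have hz' : (fun r : Fin n => Omega A' r.succ 0) = z := by
      have hM := (det_cPart_ne_zero hN.det_tail_ne_zero haN).isUnit
      rw [funext hz, smul_smul, mul_inv_cancel₀ hc, one_smul] at h2
      have h6 := congrArg (fun v => M⁻¹ *ᵥ v) h2
      simp only [Matrix.mulVec_mulVec] at h6
      rwa [Matrix.nonsing_inv_mul _ hM, Matrix.one_mulVec, Matrix.one_mulVec] at h6
    have h3 : (fun r : Fin n => OmegaBar A' r.succ 0) = T *ᵥ z := by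
      rw [← hz']
      exact funext fun p => hT A' (maurerCartan_mono (fun g hg => hg.1) _ hA') p
    have h4 : OmegaBar A' 0 0 = s' ⬝ᵥ z := by
      rw [← hz']
      exact hs' A' hA'
    have h5 : OmegaBar A 0 0 = s ⬝ᵥ (c⁻¹ • (M *ᵥ z)) := by
      rw [← funext hz]
      exact hs A hA
    rw [h3, hz', h4, h5] at h1
    rw [sub_dotProduct, sub_dotProduct, smul_dotProduct, smul_dotProduct, ← dotProduct_mulVec,
      ← dotProduct_mulVec]
    rw [dotProduct_smul] at h1
    simp only [smul_eq_mul] at h1 ⊢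
    linear_combination -h1
  ext P Q
  refine Fin.cases (aPart_apply_zero hN hb P) (fun q => ?_) Q
  refine Fin.cases (congrFun hk0 q) (fun p => aPart_apply_succ haN p q) P

theorem existsUnique_isOsculating (hn : 0 < n) (F : Fibration n X) (x : X) :
    ∃! J, F.IsOsculating x J := by
  obtain ⟨g, hga, hg⟩ := exists_mem_adaptedFrames hn F x
  refine ⟨frameJ g, ⟨g, hga, hg, frameJ_apply g⟩, ?_⟩
  rintro J ⟨g', hga', hg', hJ⟩
  rw [eq_frameJ hJ]
  exact frameJ_eq_of_adaptedFrames hn hg hg' hga hga'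

lemma isOsculating_osculatingJ (hn : 0 < n) (F : Fibration n X) (x : X) :
    F.IsOsculating x (F.osculatingJ x) :=
  Classical.epsilon_spec (existsUnique_isOsculating hn F x).exists

/-- On the plane `x`, the complex structure can be read off from any frame in `frames₃`. -/
lemma osculatingJ_apply (hn : 0 < n) (hg : (F.plane x).IsPositiveFrame (g (0, 0)) (g (0, 1)))
    (hg3 : g ∈ F.frames₃) : F.osculatingJ x (g (0, 0)) = g (0, 1) ∧
      F.osculatingJ x (g (0, 1)) = -g (0, 0) := by
  obtain ⟨g₀, hga, hg₀, hJ⟩ := isOsculating_osculatingJ hn F x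
  obtain ⟨N, hN, rfl⟩ : ∃ N, IsParabolic N ∧ GreatCircle.frameMul g₀ N = g :=
    ⟨_, isParabolic_toMatrix hg₀ hg, frameMul_toMatrix g₀ g⟩
  -- On the plane only the head block of N matters. It is already complex before the last
  -- normalisation, so no section of adapted frames is needed to show smoothness of J on the planes.
  obtain ⟨-, hb⟩ := parabolic_of_frames₃ hn hg₀ hga.1 hN hg3
  rw [hN.frameMul_zero, hN.frameMul_zero, hb.1, hb.2]
  simp only [map_add, map_smul, (hJ 0).1, (hJ 0).2]
  constructor <;> module

end Fibration

end GreatCircle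

namespace GreatCircle

/-! ### Real and imaginary parts -/

section ReIm

variable {n : ℕ}

@[simp] lemma toVC_apply (v : V n) (k) : toVC v k = (v k : ℂ) := rfl

/-- The real part of a vector of `V ⊗ ℂ`. -/
noncomputable def rePart : VC n →L[ℝ] V n :=
  (EuclideanSpace.equiv (Fin (2 * n + 1 + 1)) ℝ).symm.toContinuousLinearMap ∘L
    ContinuousLinearMap.pi fun k => Complex.reCLM ∘L ContinuousLinearMap.proj k

/-- The imaginary part of a vector of `V ⊗ ℂ`. -/
noncomputable def imPart : VC n →L[ℝ] V n :=
  (EuclideanSpace.equiv (Fin (2 * n + 1 + 1)) ℝ).symm.toContinuousLinearMap ∘L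
    ContinuousLinearMap.pi fun k => Complex.imCLM ∘L ContinuousLinearMap.proj k

@[simp] lemma rePart_apply (w : VC n) (k) : rePart w k = (w k).re := rfl

@[simp] lemma imPart_apply (w : VC n) (k) : imPart w k = (w k).im := rfl

/-- The complex vector `u - i v`. -/
noncomputable def subI (u v : V n) : VC n := toVC u - Complex.I • toVC v

lemma subI_apply (u v : V n) (k) : subI u v k = u k - Complex.I * v k := rfl

@[simp] lemma rePart_subI (u v : V n) : rePart (subI u v) = u := by
  ext k
  simp [subI_apply]

@[simp] lemma imPart_subI (u v : V n) : imPart (subI u v) = -v := by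
  ext k
  simp [subI_apply]

lemma smul_subI (z : ℂ) (u v : V n) :
    z • subI u v = subI (z.re • u + z.im • v) (z.re • v - z.im • u) := by
  funext k
  apply Complex.ext <;> simp [subI_apply] 
  ring

lemma subI_ne_zero {u : V n} (hu : u ≠ 0) (v : V n) : subI u v ≠ 0 := by
  intro h
  apply hu
  rw [← rePart_subI u v, h, map_zero]

end ReIm

namespace Fibration

variable {n : ℕ} {X : Type*} [TopologicalSpace X]
  [ChartedSpace (EuclideanSpace ℝ (Fin (2 * n))) X] {F : Fibration n X} {x : X} {g : Frame n}

lemma satoLift_apply (v : V n) : F.satoLift x v = subI v (F.osculatingJ x v) := rfl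

@[simp] lemma rePart_satoLift (v : V n) : rePart (F.satoLift x v) = v := rePart_subI _ _

@[simp] lemma imPart_satoLift (v : V n) : imPart (F.satoLift x v) = -F.osculatingJ x v :=
  imPart_subI _ _

lemma satoLift_ne_zero {v : V n} (h0 : v ≠ 0) : F.satoLift x v ≠ 0 := subI_ne_zero h0 _

variable [IsManifold (𝓡 (2 * n)) ∞ X]

/-! ### The complex structure of the planes -/

/-- For v = a e₀ + b e₁ the frame (v, Jv) has determinant a² + b². Thus J determines the orientation
of the plane. -/
lemma isPositiveFrame_osculatingJ (hn : 0 < n) {v : V n} (hv : v ∈ (F.plane x).carrier)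
    (h0 : v ≠ 0) : (F.plane x).IsPositiveFrame v (F.osculatingJ x v) := by
  obtain ⟨g, hg3, hg⟩ := exists_mem_frames₃ hn F x
  obtain ⟨h1, h2⟩ := osculatingJ_apply hn hg hg3
  obtain ⟨a, b, rfl⟩ := hg.exists_of_mem hv
  have h3 : F.osculatingJ x (a • g (0, 0) + b • g (0, 1)) = (-b) • g (0, 0) + a • g (0, 1) := by
    rw [map_add, map_smul, map_smul, h1, h2]
    module
  rw [h3, OrientedPlane.isPositiveFrame_combination_iff hg]
  by_contra! h
  have ha : a = 0 := mul_self_eq_zero.1 (by nlinarith [mul_self_nonneg a, mul_self_nonneg b])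
  have hb : b = 0 := mul_self_eq_zero.1 (by nlinarith [mul_self_nonneg a, mul_self_nonneg b])
  simp [ha, hb] at h0

lemma osculatingJ_mem (hn : 0 < n) {v : V n} (hv : v ∈ (F.plane x).carrier) :
    F.osculatingJ x v ∈ (F.plane x).carrier := by
  obtain rfl | h0 := eq_or_ne v 0
  · simp
  · exact (isPositiveFrame_osculatingJ hn hv h0).mem_right

lemma osculatingJ_osculatingJ (hn : 0 < n) (v : V n) :
    F.osculatingJ x (F.osculatingJ x v) = -v := by
  obtain ⟨g, -, -, h⟩ := isOsculating_osculatingJ hn F x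
  have : F.osculatingJ x ∘ₗ F.osculatingJ x = -LinearMap.id := by
    refine g.ext fun b => ?_
    obtain ⟨P, δ⟩ := b
    fin_cases δ
    · simp [(h P).1, (h P).2]
    · simp [(h P).1, (h P).2]
  exact LinearMap.congr_fun this v

lemma satoLift_osculatingJ (hn : 0 < n) (v : V n) :
    F.satoLift x (F.osculatingJ x v) = Complex.I • F.satoLift x v := by
  rw [satoLift_apply, satoLift_apply, smul_subI, osculatingJ_osculatingJ hn]
  simp

lemma smul_satoLift (hn : 0 < n) (z : ℂ) (v : V n) :
    z • F.satoLift x v = F.satoLift x (z.re • v + z.im • F.osculatingJ x v) := by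
  rw [satoLift_apply, satoLift_apply, smul_subI, map_add, map_smul, map_smul,
    osculatingJ_osculatingJ hn, smul_neg, sub_eq_add_neg]

/-- The image of the plane `x` is a complex line. -/
lemma span_satoLift (hn : 0 < n) {v : V n} (hv : v ∈ (F.plane x).carrier) (h0 : v ≠ 0) :
    ((ℂ ∙ F.satoLift x v : Submodule ℂ (VC n)) : Set (VC n)) =
      F.satoLift x '' (F.plane x).carrier := by
  ext w
  simp only [SetLike.mem_coe, Submodule.mem_span_singleton, mem_image]
  constructor
  · rintro ⟨z, rfl⟩
    exact ⟨_, Submodule.add_mem _ (Submodule.smul_mem _ _ hv)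
      (Submodule.smul_mem _ _ (osculatingJ_mem hn hv)), (smul_satoLift hn z v).symm⟩
  · rintro ⟨u, hu, rfl⟩
    obtain ⟨a, b, rfl⟩ := (isPositiveFrame_osculatingJ hn hv h0).exists_of_mem hu
    exact ⟨⟨a, b⟩, smul_satoLift hn _ v⟩

theorem submodule_sato (hn : 0 < n) (F : Fibration n X) (x : X) :
    ((F.sato x).submodule : Set (VC n)) = F.satoLift x '' (F.plane x).carrier := by
  obtain ⟨u, v, hu⟩ := (F.plane x).exists_isPositiveFrame
  refine Classical.epsilon_spec (p := fun L : CP (2 * n + 1) =>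
    (L.submodule : Set (VC n)) = F.satoLift x '' (F.plane x).carrier)
    ⟨Projectivization.mk ℂ (F.satoLift x u) (satoLift_ne_zero hu.left_ne_zero), ?_⟩
  rw [Projectivization.submodule_mk]
  exact span_satoLift hn hu.mem_left hu.left_ne_zero

lemma sato_eq_mk (hn : 0 < n) {v : V n} (hv : v ∈ (F.plane x).carrier) (h0 : v ≠ 0) :
    F.sato x = Projectivization.mk ℂ (F.satoLift x v) (satoLift_ne_zero h0) := by
  refine Projectivization.submodule_injective (SetLike.coe_injective ?_)
  rw [submodule_sato hn, Projectivization.submodule_mk, span_satoLift hn hv h0]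

/-- A vector of the line is recovered from its real part; this turns questions about σ(x) into
questions about the plane. -/
lemma mem_submodule_sato_iff (hn : 0 < n) {w : VC n} : w ∈ (F.sato x).submodule ↔
    rePart w ∈ (F.plane x).carrier ∧ F.satoLift x (rePart w) = w := by
  rw [← SetLike.mem_coe, submodule_sato hn]
  constructor
  · rintro ⟨v, hv, rfl⟩
    rw [rePart_satoLift]
    exact ⟨hv, rfl⟩
  · rintro ⟨h1, h2⟩
    exact ⟨_, h1, h2⟩

lemma rePart_ne_zero (hn : 0 < n) {w : VC n} (hw : w ∈ (F.sato x).submodule) (h0 : w ≠ 0) :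
    rePart w ≠ 0 := by
  intro h
  rw [mem_submodule_sato_iff hn, h, map_zero] at hw
  exact h0 hw.2.symm

/-- The real part recovers the base point. -/
lemma base_rePart (hn : 0 < n) {w : VC n} (hw : w ∈ (F.sato x).submodule) (h0 : w ≠ 0) :
    F.base (rePart w) = x :=
  (F.base_eq_iff (rePart_ne_zero hn hw h0)).2 ((mem_submodule_sato_iff hn).1 hw).1

lemma base_rePart_rep (hn : 0 < n) (F : Fibration n X) (x : X) :
    F.base (rePart (F.sato x).rep) = x := by
  refine base_rePart hn ?_ (F.sato x).rep_nonzero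
  rw [Projectivization.submodule_eq]
  exact Submodule.mem_span_singleton_self _

theorem sato_injective (hn : 0 < n) (F : Fibration n X) : Function.Injective F.sato :=
  fun x y h => by rw [← base_rePart_rep hn F x, h, base_rePart_rep hn]

/-- A real vector in the line would be its own real part v, with imaginary part -Jv = 0, contrary to
J² = -1. -/
theorem sato_notMem_realPoints (hn : 0 < n) (F : Fibration n X) (x : X) :
    F.sato x ∉ realPoints n := by
  rintro ⟨v, h0, hv⟩
  rw [mem_submodule_sato_iff hn] at hv
  have h1 : toVC v = subI v 0 := by simp [subI]
  have h2 := congrArg imPart hv.2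
  rw [h1, rePart_subI, imPart_satoLift, imPart_subI, neg_zero, neg_eq_zero] at h2
  have h3 := osculatingJ_osculatingJ (F := F) (x := x) hn v
  rw [h2, map_zero] at h3
  exact h0 (neg_eq_zero.1 h3.symm)

end Fibration

end GreatCircle

/-! ### Smooth maps to complex projective space -/

namespace CP

variable {m : ℕ}

lemma chart_mem_maximalAtlas (i : Fin (m + 1)) :
    chart i ∈ IsManifold.maximalAtlas 𝓘(ℝ, Fin m → ℂ) ∞ (CP m) :=
  IsManifold.subset_maximalAtlas (mem_range_self i)

/-- The section of the tautological bundle whose `i`-th coordinate is `1`. -/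
noncomputable def affineLift (i : Fin (m + 1)) (L : CP m) : Fin (m + 1) → ℂ :=
  i.insertNth (1 : ℂ) (affine i L)

lemma affineLift_ne_zero (i : Fin (m + 1)) (L : CP m) : affineLift i L ≠ 0 :=
  insertNth_ne_zero i _

lemma mk_affineLift {i : Fin (m + 1)} {L : CP m} (h : L ∈ (chart i).source) :
    Projectivization.mk ℂ (affineLift i L) (affineLift_ne_zero i L) = L :=
  (chart i).left_inv h

lemma affineLift_mem_submodule {i : Fin (m + 1)} {L : CP m} (h : L ∈ (chart i).source) :
    affineLift i L ∈ L.submodule := by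
  have := Submodule.mem_span_singleton_self (R := ℂ) (affineLift i L)
  rwa [← Projectivization.submodule_mk _ (affineLift_ne_zero i L), mk_affineLift h] at this

lemma contMDiffAt_affineLift {i : Fin (m + 1)} {L : CP m} (h : L ∈ (chart i).source) :
    ContMDiffAt 𝓘(ℝ, Fin m → ℂ) 𝓘(ℝ, Fin (m + 1) → ℂ) ∞ (affineLift i) L :=
  (contDiff_insertNth i).contMDiff.contMDiffAt.comp L
    (contMDiffAt_of_mem_maximalAtlas (chart_mem_maximalAtlas i) h)

/-- A map to projective space is smooth where it has a smooth lift to nonzero vectors: divide by a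
coordinate that does not vanish at the point. -/
lemma contMDiffAt_of_eventuallyEq_mk {E H M : Type*} [NormedAddCommGroup E] [NormedSpace ℝ E]
    [TopologicalSpace H] {I : ModelWithCorners ℝ E H} [TopologicalSpace M] [ChartedSpace H M]
    {f : M → Fin (m + 1) → ℂ} {σ : M → CP m} {x : M}
    (hf : ContMDiffAt I 𝓘(ℝ, Fin (m + 1) → ℂ) ∞ f x)
    (hσ : ∀ᶠ y in 𝓝 x, ∃ h : f y ≠ 0, σ y = Projectivization.mk ℂ (f y) h) :
    ContMDiffAt I 𝓘(ℝ, Fin m → ℂ) ∞ σ x := by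
  obtain ⟨i, hi⟩ := Function.ne_iff.1 hσ.self_of_nhds.1
  have hd : ContDiffAt ℝ ∞ (fun v : Fin (m + 1) → ℂ => fun j => v (i.succAbove j) / v i) (f x) := by
    refine contDiffAt_pi.2 fun j => ?_
    simp only [div_eq_mul_inv]
    exact (contDiff_apply ℝ ℂ _).contDiffAt.mul ((contDiff_apply ℝ ℂ _).contDiffAt.inv hi)
  have h1 := (contMDiffAt_symm_of_mem_maximalAtlas (chart_mem_maximalAtlas i)
    (mem_univ ((fun j => f x (i.succAbove j) / f x i) : Fin m → ℂ))).comp x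
      (hd.contMDiffAt.comp x hf)
  refine h1.congr_of_eventuallyEq ?_
  have hi' : ∀ᶠ y in 𝓝 x, f y i ≠ 0 :=
    ((continuous_apply i).continuousAt.comp hf.continuousAt).eventually_ne hi
  filter_upwards [hσ, hi'] with y ⟨h, hy⟩ hyi
  rw [hy]
  have h2 := (chart i).left_inv ((rep_mk_ne_zero_iff i (f y) h).2 hyi)
  rw [← h2]
  exact congrArg (ofAffine i) (affine_mk i (f y) h)

end CP

namespace GreatCircle

lemma contDiff_subI {n : ℕ} : ContDiff ℝ ∞ (fun p : V n × V n => subI p.1 p.2) :=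
  (((toVC.toContinuousLinearMap ∘L ContinuousLinearMap.fst ℝ (V n) (V n)) -
    Complex.I • (toVC.toContinuousLinearMap ∘L ContinuousLinearMap.snd ℝ (V n) (V n)) :
      V n × V n →L[ℝ] VC n)).contDiff

namespace Fibration

variable {n : ℕ} {X : Type*} [TopologicalSpace X]
  [ChartedSpace (EuclideanSpace ℝ (Fin (2 * n))) X] {F : Fibration n X} {x : X}

/-- The base point of a complex line, read off from the `i`-th affine chart; this is a local left
inverse of the Sato map. -/
noncomputable def satoInv (F : Fibration n X) (i : Fin (2 * n + 1 + 1)) (L : CP (2 * n + 1)) : X :=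
  F.base (rePart (CP.affineLift i L))

lemma contMDiffAt_satoInv {i} {L : CP (2 * n + 1)} (h : L ∈ (CP.chart i).source)
    (h0 : rePart (CP.affineLift i L) ≠ 0) :
    ContMDiffAt 𝓘(ℝ, Fin (2 * n + 1) → ℂ) (𝓡 (2 * n)) ∞ (F.satoInv i) L := by
  have h1 := rePart.contDiff.contMDiff.contMDiffAt.comp L (CP.contMDiffAt_affineLift h)
  exact (F.contMDiffAt_base h0).comp L h1

variable [IsManifold (𝓡 (2 * n)) ∞ X]

/-- Smooth local frames `(u, J u)` of the planes of the fibration. -/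
lemma exists_smooth_frame (hn : 0 < n) (F : Fibration n X) (x : X) : ∃ u v : X → V n,
    ContMDiffAt (𝓡 (2 * n)) 𝓘(ℝ, V n) ∞ u x ∧ ContMDiffAt (𝓡 (2 * n)) 𝓘(ℝ, V n) ∞ v x ∧
    ∀ᶠ y in 𝓝 x, (F.plane y).IsPositiveFrame (u y) (v y) ∧ F.osculatingJ y (u y) = v y := by
  obtain ⟨g, hg3, hg⟩ := exists_mem_frames₃ hn F x
  obtain ⟨Θ, hΘ⟩ := exists_isLocalSection₃ hn hg hg3
  set e := chartAt (EuclideanSpace ℝ (Fin (2 * n))) x with he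
  have hx : x ∈ e.source := mem_chart_source _ x
  have hc : ContMDiffAt (𝓡 (2 * n)) (𝓡 (2 * n)) ∞ e x := contMDiffAt_of_mem_maximalAtlas
    (IsManifold.chart_mem_maximalAtlas x) hx
  have hs : ∀ δ : Fin 2, ContMDiffAt (𝓡 (2 * n)) 𝓘(ℝ, V n) ∞
      (fun y => ∑ a, Θ (e y) a (0, δ) • g a) x := by
    intro δ
    have h1 : ContDiffAt ℝ ∞ (fun y => ∑ a, Θ y a (0, δ) • g a) (e x) :=
      ContDiffAt.sum fun a _ => (hΘ.contDiffAt _ _).smul contDiffAt_const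
    exact h1.contMDiffAt.comp x hc
  refine ⟨_, _, hs 0, hs 1, ?_⟩
  filter_upwards [e.open_source.mem_nhds hx, hc.continuousAt.eventually hΘ.eventually_mem,
    hc.continuousAt.eventually hΘ.eventually_frame,
    hc.continuousAt.eventually hΘ.eventually_det_ne_zero] with y h1 h2 h3 h4
  rw [← he, e.left_inv h1] at h3
  have h5 := (osculatingJ_apply hn h3 h2).1
  rw [frameMul_apply g h4, frameMul_apply g h4] at h3 h5
  exact ⟨h3, h5⟩

theorem contMDiff_sato (hn : 0 < n) (F : Fibration n X) :
    ContMDiff (𝓡 (2 * n)) 𝓘(ℝ, Fin (2 * n + 1) → ℂ) ∞ F.sato := by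
  intro x
  obtain ⟨u, v, hu, hv, h⟩ := exists_smooth_frame hn F x
  refine CP.contMDiffAt_of_eventuallyEq_mk (f := fun y => subI (u y) (v y))
    (contDiff_subI.contMDiff.contMDiffAt.comp x (hu.prodMk_space hv)) ?_
  filter_upwards [h] with y hy
  refine ⟨subI_ne_zero hy.1.left_ne_zero _, ?_⟩
  rw [sato_eq_mk hn hy.1.mem_left hy.1.left_ne_zero]
  congr 1
  rw [satoLift_apply, hy.2]

lemma satoInv_sato (hn : 0 < n) {i} (h : F.sato x ∈ (CP.chart i).source) :
    F.satoInv i (F.sato x) = x :=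
  base_rePart hn (CP.affineLift_mem_submodule h) (CP.affineLift_ne_zero _ _)

lemma contMDiffAt_satoInv_sato (hn : 0 < n) {i} (h : F.sato x ∈ (CP.chart i).source) :
    ContMDiffAt 𝓘(ℝ, Fin (2 * n + 1) → ℂ) (𝓡 (2 * n)) ∞ (F.satoInv i) (F.sato x) :=
  contMDiffAt_satoInv h
    (rePart_ne_zero hn (CP.affineLift_mem_submodule h) (CP.affineLift_ne_zero _ _))

/-- Neighbourhoods of x are recovered by pulling back along the continuous local left inverse
`satoInv`; the affine chart used is open. -/
theorem isEmbedding_sato (hn : 0 < n) (F : Fibration n X) : IsEmbedding F.sato := by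
  refine ⟨isInducing_iff_nhds.2 fun x => le_antisymm
    (contMDiff_sato hn F).continuous.continuousAt.le_comap ?_, sato_injective hn F⟩
  obtain ⟨i, hi⟩ := CP.exists_rep_ne_zero (F.sato x)
  have hc := (contMDiffAt_satoInv_sato (F := F) (x := x) hn hi).continuousAt
  intro U hU
  rw [← satoInv_sato hn hi] at hU
  refine ⟨_, inter_mem (hc hU) ((CP.chart i).open_source.mem_nhds hi), ?_⟩
  rintro y ⟨h1, h2⟩
  have h3 : F.satoInv i (F.sato y) ∈ U := h1
  rwa [satoInv_sato hn h2] at h3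

end Fibration

end GreatCircle

namespace GreatCircle

/-! ### Maps with a smooth left inverse are immersions -/

section Immersion

variable {E E' : Type*} [NormedAddCommGroup E] [NormedSpace ℝ E] [FiniteDimensional ℝ E]
  [NormedAddCommGroup E'] [NormedSpace ℝ E'] [FiniteDimensional ℝ E']

/-- The inverse function theorem for a smooth map whose derivative at a point is the identity. -/
lemma exists_openPartialHomeomorph {κ : E' → E'} {W : Set E'} {b : E'} (hW : IsOpen W) (hb : b ∈ W)
    (hκ : ContDiffOn ℝ ∞ κ W) (hd : HasFDerivAt κ (ContinuousLinearMap.id ℝ E') b) :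
    ∃ θ : OpenPartialHomeomorph E' E', b ∈ θ.source ∧ θ.source ⊆ W ∧ (θ : E' → E') = κ ∧
      ContDiffOn ℝ ∞ θ θ.source ∧ ContDiffOn ℝ ∞ θ.symm θ.target := by
  have hcd : ∀ {z}, z ∈ W → ContDiffAt ℝ ∞ κ z := fun hz => hκ.contDiffAt (hW.mem_nhds hz)
  have hd' : HasFDerivAt κ (ContinuousLinearEquiv.refl ℝ E' : E' →L[ℝ] E') b := hd
  let θ₀ := (hcd hb).toOpenPartialHomeomorph κ hd' (by simp)
  have hc : ContinuousOn (fderiv ℝ κ) W := hκ.continuousOn_fderiv_of_isOpen hW (by simp)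
  -- Shrinking to the open set where the derivative stays invertible makes the inverse smooth on its
  -- whole target, not only at one point.
  let W' : Set E' := W ∩ fderiv ℝ κ ⁻¹' range ((↑) : (E' ≃L[ℝ] E') → E' →L[ℝ] E')
  have hW' : IsOpen W' := hc.isOpen_inter_preimage hW ContinuousLinearEquiv.isOpen
  have hbW' : b ∈ W' := ⟨hb, ContinuousLinearEquiv.refl ℝ E', by rw [hd'.fderiv]⟩
  let θ := θ₀.restrOpen W' hW'
  have hcoe : (θ : E' → E') = κ := (hcd hb).toOpenPartialHomeomorph_coe hd' (by simp)
  have hs : θ.source ⊆ W' := fun z hz => hz.2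
  refine ⟨θ, ⟨(hcd hb).mem_toOpenPartialHomeomorph_source hd' (by simp), hbW'⟩,
    fun z hz => (hs hz).1, hcoe, ?_, fun z hz => ContDiffAt.contDiffWithinAt ?_⟩
  · rw [hcoe]
    exact hκ.mono fun z hz => (hs hz).1
  · obtain ⟨h1, A, hA⟩ := hs (θ.map_target hz)
    refine θ.contDiffAt_symm (f₀' := A) hz ?_ ?_
    · rw [hcoe, hA]
      exact ((hcd h1).differentiableAt (by simp)).hasFDerivAt
    · rw [hcoe]
      exact hcd h1

/-- A left inverse `R` of a linear map `A` splits the target of `A`. -/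
lemma exists_equiv_of_comp_eq_id {A : E →L[ℝ] E'} {R : E' →L[ℝ] E}
    (h : R ∘L A = ContinuousLinearMap.id ℝ E) :
    ∃ e : (E × EuclideanSpace ℝ (Fin (finrank ℝ E' - finrank ℝ E))) ≃L[ℝ] E',
      ∀ u, e (u, 0) = A u := by
  have hRA : ∀ u, R (A u) = u := fun u => by
    simpa using congrArg (fun L : E →L[ℝ] E => L u) h
  have hr : finrank ℝ (LinearMap.ker (R : E' →ₗ[ℝ] E)) = finrank ℝ E' - finrank ℝ E := by
    have h1 := (R : E' →ₗ[ℝ] E).finrank_range_add_finrank_ker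
    rw [LinearMap.range_eq_top.2 fun u => ⟨A u, hRA u⟩, finrank_top] at h1
    omega
  let C : EuclideanSpace ℝ (Fin (finrank ℝ E' - finrank ℝ E)) ≃ₗ[ℝ]
      LinearMap.ker (R : E' →ₗ[ℝ] E) :=
    LinearEquiv.ofFinrankEq _ _ (by rw [finrank_euclideanSpace_fin, hr])
  let L : (E × EuclideanSpace ℝ (Fin (finrank ℝ E' - finrank ℝ E))) →ₗ[ℝ] E' :=
    (A : E →ₗ[ℝ] E').coprod ((LinearMap.ker (R : E' →ₗ[ℝ] E)).subtype ∘ₗ C.toLinearMap)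
  have hL : ∀ u w, L (u, w) = A u + (C w : E') := fun u w => rfl
  have hC : ∀ w, R (C w : E') = 0 := fun w => (C w).2
  have hinj : Function.Injective L := by
    rw [injective_iff_map_eq_zero]
    rintro ⟨u, w⟩ h0
    rw [hL] at h0
    have hu : u = 0 := by
      have := congrArg R h0
      rwa [map_add, hRA, hC, add_zero, map_zero] at this
    subst hu
    rw [map_zero, zero_add, ZeroMemClass.coe_eq_zero, C.map_eq_zero_iff] at h0
    rw [h0]
    rfl
  have hsurj : Function.Surjective L := by
    intro z
    have hz : z - A (R z) ∈ LinearMap.ker (R : E' →ₗ[ℝ] E) := by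
      change R (z - A (R z)) = 0
      rw [map_sub, hRA, sub_self]
    refine ⟨(R z, C.symm ⟨_, hz⟩), ?_⟩
    rw [hL, C.apply_symm_apply]
    simp
  refine ⟨(LinearEquiv.ofBijective L ⟨hinj, hsurj⟩).toContinuousLinearEquiv, fun u => ?_⟩
  change L (u, 0) = A u
  rw [hL, map_zero]
  simp

/-- A smooth map with a smooth local left inverse is an immersion. -/
theorem isImmersionAtOfComplement_of_leftInverse {M N : Type*} [TopologicalSpace M]
    [ChartedSpace E M] [IsManifold 𝓘(ℝ, E) ∞ M] [TopologicalSpace N] [ChartedSpace E' N]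
    [IsManifold 𝓘(ℝ, E') ∞ N] {f : M → N} (hf : ContMDiff 𝓘(ℝ, E) 𝓘(ℝ, E') ∞ f) {x : M}
    {ρ : N → M} {U : Set N} (hU : IsOpen U) (hx : f x ∈ U)
    (hρ : ContMDiffOn 𝓘(ℝ, E') 𝓘(ℝ, E) ∞ ρ U) (h : ∀ y, f y ∈ U → ρ (f y) = y) :
    IsImmersionAtOfComplement (EuclideanSpace ℝ (Fin (finrank ℝ E' - finrank ℝ E)))
      𝓘(ℝ, E) 𝓘(ℝ, E') ∞ f x := by
  set φ := chartAt E x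
  set ψ := chartAt E' (f x)
  have hφ : φ ∈ IsManifold.maximalAtlas 𝓘(ℝ, E) ∞ M := IsManifold.chart_mem_maximalAtlas x
  have hψ : ψ ∈ IsManifold.maximalAtlas 𝓘(ℝ, E') ∞ N := IsManifold.chart_mem_maximalAtlas (f x)
  have hxφ : x ∈ φ.source := mem_chart_source E x
  have hxψ : f x ∈ ψ.source := mem_chart_source E' (f x)
  let D : Set M := φ.source ∩ f ⁻¹' ψ.source
  have hD : IsOpen D := φ.open_source.inter (ψ.open_source.preimage hf.continuous)
  -- On this open set the left inverse lands where f can be read in the chosen charts, so f' ∘ ρ'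
  -- makes sense and is smooth near the point.
  let U' : Set N := U ∩ ρ ⁻¹' D
  have hU' : IsOpen U' := hρ.continuousOn.isOpen_inter_preimage hU hD
  let W : Set E' := ψ.target ∩ ψ.symm ⁻¹' U'
  have hW : IsOpen W := ψ.isOpen_inter_preimage_symm hU'
  let ρ' : E' → E := fun z => φ (ρ (ψ.symm z))
  let f' : E → E' := fun y => ψ (f (φ.symm y))
  have hψW : ∀ {p}, f p ∈ ψ.source → f p ∈ U → p ∈ D → ψ (f p) ∈ W := by
    intro p h1 h2 h3
    refine ⟨ψ.map_source h1, ?_⟩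
    rw [mem_preimage, ψ.left_inv h1]
    exact ⟨h2, by rwa [mem_preimage, h p h2]⟩
  have hbW : ψ (f x) ∈ W := hψW hxψ hx ⟨hxφ, hxψ⟩
  have hρ'f : ∀ {p}, f p ∈ ψ.source → f p ∈ U → ρ' (ψ (f p)) = φ p := by
    intro p h1 h2
    simp only [ρ', ψ.left_inv h1, h p h2]
  have hρ's : ContDiffOn ℝ ∞ ρ' W := by
    rw [← contMDiffOn_iff_contDiffOn]
    refine (contMDiffOn_of_mem_maximalAtlas hφ).comp (hρ.comp
      ((contMDiffOn_symm_of_mem_maximalAtlas hψ).mono fun z hz => hz.1) fun z hz => hz.2.1)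
      fun z hz => hz.2.2.1
  have hf's : ContDiffOn ℝ ∞ f' (φ.target ∩ φ.symm ⁻¹' D) := by
    rw [← contMDiffOn_iff_contDiffOn]
    exact (contMDiffOn_of_mem_maximalAtlas hψ).comp (hf.comp_contMDiffOn
      ((contMDiffOn_symm_of_mem_maximalAtlas hφ).mono fun z hz => hz.1)) fun z hz => hz.2.2
  have hmaps : MapsTo ρ' W (φ.target ∩ φ.symm ⁻¹' D) := fun z hz =>
    ⟨φ.map_source hz.2.2.1, by simpa only [ρ', mem_preimage, φ.left_inv hz.2.2.1] using hz.2.2⟩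
  have hρ'x : ρ' (ψ (f x)) = φ x := hρ'f hxψ hx
  have hDx : φ x ∈ φ.target ∩ φ.symm ⁻¹' D := hρ'x ▸ hmaps hbW
  have hDo : IsOpen (φ.target ∩ φ.symm ⁻¹' D) := φ.isOpen_inter_preimage_symm hD
  obtain ⟨A, hA⟩ : ∃ A, HasFDerivAt f' A (φ x) :=
    ((hf's.contDiffAt (hDo.mem_nhds hDx)).differentiableAt (by simp))
  obtain ⟨R, hR⟩ : ∃ R, HasFDerivAt ρ' R (ψ (f x)) :=
    ((hρ's.contDiffAt (hW.mem_nhds hbW)).differentiableAt (by simp))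
  have hf'x : f' (φ x) = ψ (f x) := by simp only [f', φ.left_inv hxφ]
  have hRA : R ∘L A = ContinuousLinearMap.id ℝ E := by
    have h1 : HasFDerivAt (ρ' ∘ f') (R ∘L A) (φ x) := HasFDerivAt.comp _ (hf'x ▸ hR) hA
    refine h1.unique ((hasFDerivAt_id (φ x)).congr_of_eventuallyEq ?_)
    have h2 : φ.target ∩ φ.symm ⁻¹' (D ∩ f ⁻¹' U) ∈ 𝓝 (φ x) :=
      (φ.isOpen_inter_preimage_symm (hD.inter (hU.preimage hf.continuous))).mem_nhds
        ⟨hDx.1, hDx.2, by rwa [mem_preimage, φ.left_inv hxφ]⟩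
    filter_upwards [h2] with y hy
    exact (hρ'f hy.2.1.2 hy.2.2).trans (φ.right_inv hy.1)
  obtain ⟨e, he⟩ := exists_equiv_of_comp_eq_id hRA
  -- This straightens the image: at z = f'(y) one has ρ'(z) = y and κ(z) = A y, the point (y, 0) of
  -- the splitting. Its derivative at the centre is 1 - AR + AR = 1, so κ is a local diffeomorphism.
  let κ : E' → E' := fun z => z - f' (ρ' z) + A (ρ' z)
  have hκ : ContDiffOn ℝ ∞ κ W :=
    (contDiffOn_id.sub (hf's.comp hρ's hmaps)).add (A.contDiff.comp_contDiffOn hρ's)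
  have hκd : HasFDerivAt κ (ContinuousLinearMap.id ℝ E') (ψ (f x)) := by
    have h1 : HasFDerivAt (fun z => f' (ρ' z)) (A ∘L R) (ψ (f x)) :=
      HasFDerivAt.comp (g := f') _ (hρ'x.symm ▸ hA) hR
    have h2 : HasFDerivAt (fun z => A (ρ' z)) (A ∘L R) (ψ (f x)) :=
      A.hasFDerivAt.comp _ hR
    have h3 := ((hasFDerivAt_id _).sub h1).add h2
    rw [sub_add_cancel] at h3
    exact h3
  obtain ⟨θ, hθb, hθW, hθ, hθs, hθs'⟩ := exists_openPartialHomeomorph hW hbW hκ hκd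
  have hcod : ψ.trans θ ∈ IsManifold.maximalAtlas 𝓘(ℝ, E') ∞ N := by
    refine OpenPartialHomeomorph.mem_maximalAtlas_of_contMDiffOn _ ?_ ?_
    · rw [OpenPartialHomeomorph.coe_trans, OpenPartialHomeomorph.trans_source]
      exact hθs.contMDiffOn.comp ((contMDiffOn_of_mem_maximalAtlas hψ).mono inter_subset_left)
        inter_subset_right
    · rw [OpenPartialHomeomorph.coe_trans_symm, OpenPartialHomeomorph.trans_target]
      exact (contMDiffOn_symm_of_mem_maximalAtlas hψ).comp
        (hθs'.contMDiffOn.mono inter_subset_left) inter_subset_right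
  have hS : IsOpen (f ⁻¹' (ψ.trans θ).source) :=
    (ψ.trans θ).open_source.preimage hf.continuous
  have hres : ∀ {S : Set M}, IsOpen S → ∀ {y}, y ∈ ((φ.restr S).extend 𝓘(ℝ, E)).target →
      y ∈ φ.target ∧ φ.symm y ∈ S := by
    intro S hS y hy
    simpa [hS.interior_eq] using hy
  have hfx : f x ∈ (ψ.trans θ).source := by
    rw [OpenPartialHomeomorph.trans_source]
    exact ⟨hxψ, hθb⟩
  refine IsImmersionAtOfComplement.mk_of_continuousAt hf.continuous.continuousAt e
    (φ.restr (f ⁻¹' (ψ.trans θ).source)) (ψ.trans θ) ?_ hfx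
    (restr_mem_maximalAtlas _ hφ hS) hcod ?_
  · rw [OpenPartialHomeomorph.restr_source' _ _ hS]
    exact ⟨hxφ, hfx⟩
  · intro y hy
    obtain ⟨h1, h2⟩ := hres hS hy
    rw [mem_preimage, OpenPartialHomeomorph.trans_source] at h2
    have h3 := hθW h2.2
    have h4 : f (φ.symm y) ∈ U := by
      have := h3.2.1
      rwa [ψ.left_inv h2.1] at this
    have h5 : ρ' (ψ (f (φ.symm y))) = y := (hρ'f h2.1 h4).trans (φ.right_inv h1)
    have h6 : κ (ψ (f (φ.symm y))) = e (y, 0) := by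
      simp only [κ, h5, he]
      simp [f']
    rw [← hθ] at h6
    simpa using h6

end Immersion

namespace Fibration

variable {n : ℕ} {X : Type*} [TopologicalSpace X]
  [ChartedSpace (EuclideanSpace ℝ (Fin (2 * n))) X] [IsManifold (𝓡 (2 * n)) ∞ X]

theorem isSmoothEmbedding_sato (hn : 0 < n) (F : Fibration n X) :
    IsSmoothEmbedding (𝓡 (2 * n)) 𝓘(ℝ, Fin (2 * n + 1) → ℂ) ∞ F.sato := by
  refine ⟨⟨EuclideanSpace ℝ (Fin (finrank ℝ (Fin (2 * n + 1) → ℂ) -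
    finrank ℝ (EuclideanSpace ℝ (Fin (2 * n))))), inferInstance, inferInstance, fun x => ?_⟩, isEmbedding_sato hn F⟩
  obtain ⟨i, hi⟩ := CP.exists_rep_ne_zero (F.sato x)
  have hc : ContinuousOn (fun L => rePart (CP.affineLift i L)) (CP.chart i).source := fun L hL =>
    (rePart.continuous.continuousAt.comp
      (CP.contMDiffAt_affineLift hL).continuousAt).continuousWithinAt
  have ho := hc.isOpen_inter_preimage (CP.chart i).open_source
    (isOpen_compl_singleton (x := (0 : V n)))
  exact isImmersionAtOfComplement_of_leftInverse (contMDiff_sato hn F) ho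
    ⟨hi, rePart_ne_zero hn (CP.affineLift_mem_submodule hi) (CP.affineLift_ne_zero _ _)⟩
    (fun L hL => (contMDiffAt_satoInv (F := F) hL.1 hL.2).contMDiffWithinAt)
    fun y hy => satoInv_sato hn hy.1

end Fibration

end GreatCircle

namespace GreatCircle

namespace Fibration

variable {n : ℕ} {X : Type*} [TopologicalSpace X]
  [ChartedSpace (EuclideanSpace ℝ (Fin (2 * n))) X]

/-- The points of `X'` with the same image under the Sato map as the points of `X`. -/
noncomputable def satoTransfer {X' : Type*} [TopologicalSpace X']
    [ChartedSpace (EuclideanSpace ℝ (Fin (2 * n))) X'] (F : Fibration n X) (F' : Fibration n X')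
    (x : X) : X' :=
  F'.base (rePart (F.sato x).rep)

lemma sato_satoTransfer {X' : Type*} [TopologicalSpace X']
    [ChartedSpace (EuclideanSpace ℝ (Fin (2 * n))) X'] [IsManifold (𝓡 (2 * n)) ∞ X']
    {F : Fibration n X} {F' : Fibration n X'} (hn : 0 < n) (h : range F.sato ⊆ range F'.sato)
    (x : X) : F'.sato (satoTransfer F F' x) = F.sato x := by
  obtain ⟨x', hx'⟩ := h (mem_range_self x)
  rw [satoTransfer, ← hx', base_rePart_rep hn]

variable [IsManifold (𝓡 (2 * n)) ∞ X]

/-! ### The tautological bundle -/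

lemma contMDiffOn_satoLift (hn : 0 < n) (F : Fibration n X) :
    ContMDiffOn ((𝓡 (2 * n)).prod 𝓘(ℝ, V n)) 𝓘(ℝ, VC n) ∞
      (fun q : X × V n => F.satoLift q.1 q.2) F.lineBundle := by
  rintro ⟨x, v₀⟩ hm
  obtain ⟨u, w, hu, hw, h⟩ := exists_smooth_frame hn F x
  obtain ⟨α, β, hαβ⟩ := h.self_of_nhds.1.exists_area_eq_one
  let a := α.toContinuousLinearMap
  let b := β.toContinuousLinearMap
  let D : V n → V n → ℝ := fun y z => a y * b z - b y * a z
  -- The line bundle is not open in X × V, so J is extended off the planes: Cramer's rule for the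
  -- area form D gives the coordinates of v in the frame (u, Ju), and Jv is expressed by them.
  let Φ : V n × V n × V n → VC n := fun q => subI q.1
    ((D q.1 q.2.2 / D q.2.1 q.2.2) • q.2.2 - (D q.2.1 q.1 / D q.2.1 q.2.2) • q.2.1)
  have hΦ : ContDiffAt ℝ ∞ Φ (v₀, u x, w x) := by
    have hD : ContDiff ℝ ∞ (fun q : V n × V n => D q.1 q.2) :=
      ((a.contDiff.comp contDiff_fst).mul (b.contDiff.comp contDiff_snd)).sub
        ((b.contDiff.comp contDiff_fst).mul (a.contDiff.comp contDiff_snd))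
    have h1 : ContDiff ℝ ∞ (fun q : V n × V n × V n => q.2.1) := contDiff_fst.comp contDiff_snd
    have h2 : ContDiff ℝ ∞ (fun q : V n × V n × V n => q.2.2) := contDiff_snd.comp contDiff_snd
    have h0 : D (u x) (w x) ≠ 0 := by
      change α (u x) * β (w x) - β (u x) * α (w x) ≠ 0
      rw [hαβ]
      exact one_ne_zero
    have hd := (hD.comp (h1.prodMk h2)).contDiffAt (x := (v₀, u x, w x))
    refine contDiff_subI.contDiffAt.comp _ (contDiffAt_fst.prodMk ?_)
    exact (((hD.comp (contDiff_fst.prodMk h2)).contDiffAt.div hd h0).smul h2.contDiffAt).sub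
      (((hD.comp (h1.prodMk contDiff_fst)).contDiffAt.div hd h0).smul h1.contDiffAt)
  have hq : ContMDiffAt ((𝓡 (2 * n)).prod 𝓘(ℝ, V n)) 𝓘(ℝ, V n × V n × V n) ∞
      (fun q : X × V n => (q.2, u q.1, w q.1)) (x, v₀) :=
    contMDiffAt_snd.prodMk_space (ContMDiffAt.prodMk_space
      (ContMDiffAt.comp (g := u) (x, v₀) hu contMDiffAt_fst)
      (ContMDiffAt.comp (g := w) (x, v₀) hw contMDiffAt_fst))
  have hs := (ContMDiffAt.comp (g := Φ) (x, v₀) hΦ.contMDiffAt hq).contMDiffWithinAt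
    (s := F.lineBundle)
  have hev : ∀ᶠ q : X × V n in 𝓝 (x, v₀), q ∈ F.lineBundle →
      F.satoLift q.1 q.2 = Φ (q.2, u q.1, w q.1) := by
    have h0 : ∀ᶠ y in 𝓝 x, D (u y) (w y) ≠ 0 := by
      have hc : ContinuousAt (fun y => D (u y) (w y)) x :=
        (((a.continuous.continuousAt.comp hu.continuousAt).mul
          (b.continuous.continuousAt.comp hw.continuousAt)).sub
          ((b.continuous.continuousAt.comp hu.continuousAt).mul
          (a.continuous.continuousAt.comp hw.continuousAt)))
      refine hc.eventually_ne ?_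
      change α (u x) * β (w x) - β (u x) * α (w x) ≠ 0
      rw [hαβ]
      exact one_ne_zero
    filter_upwards [continuous_fst.continuousAt.eventually (h.and h0)] with q hq hqm
    obtain ⟨⟨h1, h2⟩, h3⟩ := hq
    obtain ⟨y, v⟩ := q
    obtain ⟨r, s, hv⟩ := h1.exists_of_mem hqm
    have hv' : v = r • u y + s • w y := hv
    have h4 : F.osculatingJ y (u y) = w y := h2
    have h5 : F.osculatingJ y (w y) = -u y := by rw [← h4, osculatingJ_osculatingJ hn]
    have h6 : D v (w y) = r * D (u y) (w y) := by
      simp only [D, hv', map_add, map_smul, smul_eq_mul]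
      ring
    have h7 : D (u y) v = s * D (u y) (w y) := by
      simp only [D, hv', map_add, map_smul, smul_eq_mul]
      ring
    have h3' : D (u y) (w y) ≠ 0 := h3
    simp only [Φ, satoLift_apply, h6, h7, mul_div_cancel_right₀ _ h3']
    congr 1
    rw [hv', map_add, map_smul, map_smul, h4, h5, smul_neg, sub_eq_add_neg]
  exact hs.congr_of_eventuallyEq_of_mem (eventually_nhdsWithin_iff.2 hev) hm

theorem pullsBackTautological (hn : 0 < n) (F : Fibration n X) : F.PullsBackTautological where
  mapsTo_J _ _ hv := osculatingJ_mem hn hv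
  J_sq _ _ _ := osculatingJ_osculatingJ hn _
  complexLinear _ _ _ := satoLift_osculatingJ hn _
  bijOn := by
    refine ⟨?_, ?_, ?_⟩
    · rintro ⟨x, v⟩ hv
      have h : F.satoLift x v ∈ (F.sato x).submodule := (mem_submodule_sato_iff hn).2
        ⟨by rwa [rePart_satoLift], by rw [rePart_satoLift]⟩
      exact h
    · rintro ⟨x, v⟩ - ⟨y, w⟩ - h
      obtain rfl : x = y := congrArg Prod.fst h
      have := congrArg (fun q : X × VC n => rePart q.2) h
      simp only [rePart_satoLift] at this
      rw [this]
    · rintro ⟨x, w⟩ hw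
      obtain ⟨h1, h2⟩ := (mem_submodule_sato_iff hn).1 (show w ∈ (F.sato x).submodule from hw)
      exact ⟨(x, rePart w), h1, congrArg (Prod.mk x) h2⟩
  smooth := contMDiffOn_satoLift hn F
  -- The inverse is the real part, a linear map that does not depend on the base point.
  smooth_inverse := ⟨fun q => rePart q.2, fun q _ => rePart_satoLift q.2,
    (rePart.contDiff.contMDiff.comp contMDiff_snd).contMDiffOn⟩

/-! ### The image of the Sato map determines the fibration -/

section Image

variable {X' : Type*} [TopologicalSpace X']
  [ChartedSpace (EuclideanSpace ℝ (Fin (2 * n))) X']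
  [IsManifold (𝓡 (2 * n)) ∞ X'] {F : Fibration n X} {F' : Fibration n X'}

/-- Real parts of the line recover the plane and imaginary parts recover J on it. A common frame (u,
Ju) is positive for both planes, so the orientations agree as well. -/
lemma plane_eq_of_sato_eq (hn : 0 < n) {x : X} {x' : X'} (h : F'.sato x' = F.sato x) :
    F'.plane x' = F.plane x := by
  obtain ⟨u, _, hu⟩ := (F.plane x).exists_isPositiveFrame
  have h1 : F.satoLift x u ∈ (F'.sato x').submodule := by
    rw [h, mem_submodule_sato_iff hn, rePart_satoLift]
    exact ⟨hu.mem_left, rfl⟩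
  rw [mem_submodule_sato_iff hn, rePart_satoLift] at h1
  have h2 := congrArg imPart h1.2
  rw [imPart_satoLift, imPart_satoLift, neg_inj] at h2
  have h3 := isPositiveFrame_osculatingJ hn h1.1 hu.left_ne_zero
  rw [h2] at h3
  exact OrientedPlane.eq_of_isPositiveFrame h3
    (isPositiveFrame_osculatingJ hn hu.mem_left hu.left_ne_zero)

/-- Locally the transfer is σ for one fibration followed by the smooth left inverse of σ for the
other. -/
lemma contMDiff_satoTransfer (hn : 0 < n) (h : range F.sato ⊆ range F'.sato) :
    ContMDiff (𝓡 (2 * n)) (𝓡 (2 * n)) ∞ (satoTransfer F F') := by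
  intro x
  obtain ⟨i, hi⟩ := CP.exists_rep_ne_zero (F.sato x)
  have hi' : F.sato x ∈ (CP.chart i).source := hi
  have h1 := contMDiffAt_satoInv_sato (F := F') (x := satoTransfer F F' x) hn
    (i := i) (by rwa [sato_satoTransfer hn h])
  rw [sato_satoTransfer hn h] at h1
  refine (h1.comp x (contMDiff_sato hn F x)).congr_of_eventuallyEq ?_
  filter_upwards [(contMDiff_sato hn F).continuous.continuousAt.preimage_mem_nhds
    ((CP.chart i).open_source.mem_nhds hi')] with y hy
  rw [Function.comp_apply, ← sato_satoTransfer hn h y, satoInv_sato hn]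
  rwa [sato_satoTransfer hn h]

theorem exists_diffeomorph_of_range_sato_eq (hn : 0 < n) (h : range F.sato = range F'.sato) :
    ∃ φ : X ≃ₘ^∞⟮𝓡 (2 * n), 𝓡 (2 * n)⟯ X',
      (∀ p, F'.proj p = φ (F.proj p)) ∧ ∀ x, F'.plane (φ x) = F.plane x := by
  have hp : ∀ x, F'.plane (satoTransfer F F' x) = F.plane x := fun x =>
    plane_eq_of_sato_eq hn (sato_satoTransfer hn h.subset x)
  refine ⟨⟨⟨satoTransfer F F', satoTransfer F' F, fun x => ?_, fun x => ?_⟩,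
    contMDiff_satoTransfer hn h.subset, contMDiff_satoTransfer hn h.superset⟩, fun p => ?_, hp⟩
  · apply sato_injective hn F
    rw [sato_satoTransfer hn h.superset, sato_satoTransfer hn h.subset]
  · apply sato_injective hn F'
    rw [sato_satoTransfer hn h.subset, sato_satoTransfer hn h.superset]
  · rw [← F'.mem_plane_iff]
    change _ ∈ (F'.plane (satoTransfer F F' (F.proj p))).carrier
    rw [hp, F.mem_plane_iff]

end Image

end Fibration

end GreatCircle

namespace GreatCircle

/-! ### The linear group acts on fibrations -/

section Submersion

variable {E E' M M' N : Type*} [NormedAddCommGroup E] [NormedSpace ℝ E] [NormedAddCommGroup E']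
  [NormedSpace ℝ E'] [TopologicalSpace M] [ChartedSpace E M]
  [TopologicalSpace M'] [ChartedSpace E M'] [IsManifold 𝓘(ℝ, E) ∞ M']
  [TopologicalSpace N] [ChartedSpace E' N]

/-- A submersion composed with a diffeomorphism is a submersion. -/
lemma isSubmersion_comp_diffeomorph {f : M → N} (hf : IsSubmersion 𝓘(ℝ, E) 𝓘(ℝ, E') ∞ f)
    (τ : M' ≃ₘ⟮𝓘(ℝ, E), 𝓘(ℝ, E)⟯ M) : IsSubmersion 𝓘(ℝ, E) 𝓘(ℝ, E') ∞ (f ∘ τ) := by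
  obtain ⟨K, i₁, i₂, h⟩ := hf
  refine ⟨K, i₁, i₂, fun p => ?_⟩
  have hp := h (τ p)
  have hd : τ.toHomeomorph.transOpenPartialHomeomorph hp.domChart ∈
      IsManifold.maximalAtlas 𝓘(ℝ, E) ∞ M' := by
    refine OpenPartialHomeomorph.mem_maximalAtlas_of_contMDiffOn _ ?_ ?_
    · exact (contMDiffOn_of_mem_maximalAtlas hp.domChart_mem_maximalAtlas).comp
        τ.contMDiff.contMDiffOn fun q hq => hq
    · exact τ.symm.contMDiff.comp_contMDiffOn
        (contMDiffOn_symm_of_mem_maximalAtlas hp.domChart_mem_maximalAtlas)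
  refine IsSubmersionAtOfComplement.mk_of_charts hp.equiv _ hp.codChart hp.mem_domChart_source
    hp.mem_codChart_source hd hp.codChart_mem_maximalAtlas
    (fun q hq => hp.source_subset_preimage_source hq) ?_
  intro w hw
  have h1 := hp.writtenInCharts (show w ∈ (hp.domChart.extend 𝓘(ℝ, E)).target by simpa using hw)
  simpa using h1

end Submersion

variable {n : ℕ}

lemma toSphere_smul {r : ℝ} (hr : 0 < r) (v : V n) : toSphere (r • v) = toSphere v := by
  obtain rfl | h := eq_or_ne v 0
  · simp
  · refine Subtype.ext ?_
    rw [coe_toSphere h, coe_toSphere (smul_ne_zero hr.ne' h), norm_smul, smul_smul,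
      Real.norm_of_nonneg hr.le, mul_inv_rev, mul_assoc, inv_mul_cancel₀ hr.ne', mul_one]

/-- The action of an invertible linear map on the rays from the origin. -/
noncomputable def sphereDiffeo (φ : V n ≃ₗ[ℝ] V n) :
    S n ≃ₘ⟮𝓡 (2 * n + 1), 𝓡 (2 * n + 1)⟯ S n where
  toFun p := toSphere (φ p)
  invFun p := toSphere (φ.symm p)
  left_inv p := by
    have h : φ p ≠ 0 := by simp
    beta_reduce
    rw [coe_toSphere h, map_smul, φ.symm_apply_apply, toSphere_smul (by positivity), toSphere_coe]
  right_inv p := by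
    have h : φ.symm p ≠ 0 := by simp
    beta_reduce
    rw [coe_toSphere h, map_smul, φ.apply_symm_apply, toSphere_smul (by positivity), toSphere_coe]
  contMDiff_toFun p :=
    ContMDiffAt.comp (g := toSphere) p (contMDiffAt_toSphere (by simp))
      (φ.toContinuousLinearEquiv.contDiff.contMDiff.contMDiffAt.comp p (contMDiff_coe_sphere_V p))
  contMDiff_invFun p :=
    ContMDiffAt.comp (g := toSphere) p (contMDiffAt_toSphere (by simp))
      (φ.symm.toContinuousLinearEquiv.contDiff.contMDiff.contMDiffAt.comp p
        (contMDiff_coe_sphere_V p))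

lemma mem_map_carrier_iff {P : OrientedPlane n} {φ : V n ≃ₗ[ℝ] V n} {v : V n} :
    v ∈ (P.map φ).carrier ↔ φ.symm v ∈ P.carrier :=
  Submodule.mem_map_equiv (e := φ) _

namespace Fibration

variable {X : Type*} [TopologicalSpace X] [ChartedSpace (EuclideanSpace ℝ (Fin (2 * n))) X]

/-- The image of a great circle fibration under an invertible linear map. -/
noncomputable def map (F : Fibration n X) (φ : V n ≃ₗ[ℝ] V n) : Fibration n X where
  proj := F.proj ∘ sphereDiffeo φ.symm
  isSubmersion_proj := isSubmersion_comp_diffeomorph F.isSubmersion_proj _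
  plane x := (F.plane x).map φ
  mem_plane_iff p x := by
    have h : φ.symm p ≠ 0 := by simp
    rw [mem_map_carrier_iff, ← F.base_eq_iff h]
    rfl
  continuous_orientation x := by
    obtain ⟨U, hU, a, b, ha, hb, hab⟩ := F.continuous_orientation x
    exact ⟨U, hU, fun y => φ (a y), fun y => φ (b y),
      φ.toContinuousLinearEquiv.continuous.comp_continuousOn ha,
      φ.toContinuousLinearEquiv.continuous.comp_continuousOn hb,
      fun y hy => (OrientedPlane.isPositiveFrame_map φ).2 (hab y hy)⟩

section Equivariance

variable {X' : Type*} [TopologicalSpace X'] [ChartedSpace (EuclideanSpace ℝ (Fin (2 * n))) X']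
  {F : Fibration n X} {F' : Fibration n X'} {φ : V n ≃ₗ[ℝ] V n} {ψ : X → X'} {g : Frame n}

/-- With membership transported in both directions the values of g⁻¹dg agree, so each invariant and
normalisation defined from them is carried along in turn. -/
lemma maurerCartan_map_eq {B B' : Set (Frame n)} (h : ∀ g, g.map φ ∈ B' ↔ g ∈ B) (g : Frame n) :
    maurerCartan B' (g.map φ) = maurerCartan B g := by
  have hs : ∀ g : Frame n, (g.map φ).map φ.symm = g := fun g => by
    ext b
    simp
  have hs' : ∀ g : Frame n, (g.map φ.symm).map φ = g := fun g => by
    ext b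
    simp
  refine Subset.antisymm (fun A hA => ?_) fun A hA => maurerCartan_map (fun g => (h g).2) hA
  rw [← hs g]
  exact maurerCartan_map (fun g hg => (h _).1 (by rwa [hs'])) hA

lemma map_mem_frames₁ (h : ∀ x, F'.plane (ψ x) = (F.plane x).map φ) (g : Frame n) :
    g.map φ ∈ F'.frames₁ ↔ g ∈ F.frames₁ := by
  simp only [frames₁, mem_ofPred_eq, Basis.map_apply]
  constructor
  · rintro ⟨x', hx'⟩
    -- The base map ψ is not assumed surjective. The plane of the second fibration through φ(e₀) is
    -- nevertheless the image of the plane through e₀, because distinct planes meet only in 0.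
    have h1 : φ (g (0, 0)) ∈ (F'.plane (ψ (F.base (g (0, 0))))).carrier := by
      rw [h, mem_map_carrier_iff, φ.symm_apply_apply]
      exact F.mem_plane_base (g.ne_zero _)
    have h2 := (F'.base_eq_iff hx'.left_ne_zero).2 hx'.mem_left
    rw [(F'.base_eq_iff hx'.left_ne_zero).2 h1] at h2
    rw [← h2, h, OrientedPlane.isPositiveFrame_map] at hx'
    exact ⟨_, hx'⟩
  · rintro ⟨x, hx⟩
    exact ⟨ψ x, by rwa [h, OrientedPlane.isPositiveFrame_map]⟩

lemma map_mem_frames₂ (h : ∀ x, F'.plane (ψ x) = (F.plane x).map φ) (g : Frame n) :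
    g.map φ ∈ F'.frames₂ ↔ g ∈ F.frames₂ := by
  simp only [frames₂, IsT, mem_ofPred_eq, map_mem_frames₁ h,
    maurerCartan_map_eq (map_mem_frames₁ h)]

lemma map_mem_frames₃ (h : ∀ x, F'.plane (ψ x) = (F.plane x).map φ) (g : Frame n) :
    g.map φ ∈ F'.frames₃ ↔ g ∈ F.frames₃ := by
  simp only [frames₃, IsS, mem_ofPred_eq, map_mem_frames₂ h,
    maurerCartan_map_eq (map_mem_frames₂ h)]

lemma map_mem_adaptedFrames (h : ∀ x, F'.plane (ψ x) = (F.plane x).map φ) (g : Frame n) :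
    g.map φ ∈ F'.adaptedFrames ↔ g ∈ F.adaptedFrames := by
  simp only [adaptedFrames, mem_ofPred_eq, map_mem_frames₃ h,
    maurerCartan_map_eq (map_mem_frames₃ h)]

variable [IsManifold (𝓡 (2 * n)) ∞ X] [IsManifold (𝓡 (2 * n)) ∞ X']

/-- Adapted frames are carried to adapted frames, so φ J φ⁻¹ is osculating; uniqueness identifies it
with the chosen structure. -/
lemma osculatingJ_map (hn : 0 < n) (h : ∀ x, F'.plane (ψ x) = (F.plane x).map φ) (x : X) (v : V n) :
    F'.osculatingJ (ψ x) (φ v) = φ (F.osculatingJ x v) := by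
  obtain ⟨g, hg, hgx, hgJ⟩ := isOsculating_osculatingJ hn F x
  have h1 : F'.IsOsculating (ψ x)
      ((φ : V n →ₗ[ℝ] V n) ∘ₗ F.osculatingJ x ∘ₗ (φ.symm : V n →ₗ[ℝ] V n)) := by
    refine ⟨g.map φ, (map_mem_adaptedFrames h g).2 hg, ?_, fun P => ?_⟩
    · rw [h, Basis.map_apply, Basis.map_apply, OrientedPlane.isPositiveFrame_map]
      exact hgx
    · simp [(hgJ P).1, (hgJ P).2]
  rw [(existsUnique_isOsculating hn F' (ψ x)).unique (isOsculating_osculatingJ hn F' (ψ x)) h1]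
  simp

lemma satoLift_map (hn : 0 < n) (h : ∀ x, F'.plane (ψ x) = (F.plane x).map φ) (x : X) (v : V n) :
    F'.satoLift (ψ x) (φ v) = complexify (φ : V n →ₗ[ℝ] V n) (F.satoLift x v) := by
  rw [satoLift_apply, satoLift_apply, osculatingJ_map hn h, subI, subI, map_sub, map_smul,
    complexify_toVC, complexify_toVC]
  rfl

theorem sato_map (hn : 0 < n) (h : ∀ x, F'.plane (ψ x) = (F.plane x).map φ) (x : X) :
    (F'.sato (ψ x)).submodule =
      (F.sato x).submodule.map (complexify (φ : V n →ₗ[ℝ] V n)) := by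
  refine SetLike.coe_injective ?_
  rw [Submodule.map_coe, submodule_sato hn, submodule_sato hn, h]
  change _ '' (φ '' _) = _
  rw [image_image, image_image]
  exact image_congr fun v _ => satoLift_map hn h x v

end Equivariance

end Fibration

end GreatCircle

/-- Equivariance is asserted for any second fibration whose planes are the images gx, over an
arbitrary map of bases. The image fibration with base X and the identity map is a special case. -/
theorem mainTheorem6 (n : ℕ) (hn : 1 ≤ n)
    {X : Type*} [TopologicalSpace X] [T2Space X]
    [ChartedSpace (EuclideanSpace ℝ (Fin (2 * n))) X] [IsManifold (𝓡 (2 * n)) ∞ X]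
    {X' : Type*} [TopologicalSpace X'] [T2Space X']
    [ChartedSpace (EuclideanSpace ℝ (Fin (2 * n))) X'] [IsManifold (𝓡 (2 * n)) ∞ X']
    (F : GreatCircle.Fibration n X) (F' : GreatCircle.Fibration n X') :
    -- the osculating complex structure and the Sato map are well defined
    (∀ x, ∃! J, F.IsOsculating x J) ∧
    (∀ x, ((F.sato x).submodule : Set (GreatCircle.VC n)) =
      F.satoLift x '' (F.plane x).carrier) ∧
    -- the Sato map is an embedding and avoids the real points
    IsSmoothEmbedding (𝓡 (2 * n)) 𝓘(ℝ, Fin (2 * n + 1) → ℂ) ∞ F.sato ∧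
    (∀ x, F.sato x ∉ GreatCircle.realPoints n) ∧
    -- equivariance under `SL(V)`
    (∀ g : SpecialLinearGroup ℝ (GreatCircle.V n),
      (∃ G : GreatCircle.Fibration n X, ∀ x, G.plane x = (F.plane x).map g.1) ∧
      ∀ φ : X → X', (∀ x, F'.plane (φ x) = (F.plane x).map g.1) →
        ∀ x, (F'.sato (φ x)).submodule =
          (F.sato x).submodule.map (GreatCircle.complexify (g.1 : _ →ₗ[ℝ] _))) ∧
    -- the tautological bundle pulls back to `O(-1)_X`
    F.PullsBackTautological ∧
    -- the image of the Sato map determines the fibration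
    (Set.range F.sato = Set.range F'.sato →
      ∃ φ : X ≃ₘ^∞⟮𝓡 (2 * n), 𝓡 (2 * n)⟯ X',
        (∀ p, F'.proj p = φ (F.proj p)) ∧ ∀ x, F'.plane (φ x) = F.plane x) :=
  ⟨fun x => GreatCircle.Fibration.existsUnique_isOsculating hn F x,
    fun x => GreatCircle.Fibration.submodule_sato hn F x,
    GreatCircle.Fibration.isSmoothEmbedding_sato hn F,
    fun x => GreatCircle.Fibration.sato_notMem_realPoints hn F x,
    fun g => ⟨⟨F.map g.1, fun _ => rfl⟩, fun _ h x => GreatCircle.Fibration.sato_map hn h x⟩,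
    GreatCircle.Fibration.pullsBackTautological hn F,
    fun h => GreatCircle.Fibration.exists_diffeomorph_of_range_sato_eq hn h⟩
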